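/- Let $n \ge 1$ be an integer, let $S$ be a scheme over $\mathbb{C}$, and let $\pi_Y \colon Y \to S$ be an $A_n$-bundle with respect to line bundles $\mathcal{L}_x, \mathcal{L}_y, \mathcal{L}_z$ on $S$. This means the following. Let $\pi_E \colon E = \mathrm{Spec}_S\, \mathrm{Sym}^\bullet_{\mathcal{O}_S} (\mathcal{L}_x \oplus \mathcal{L}_y \oplus \mathcal{L}_z)^\vee \to S$ be the total space of $\mathcal{L}_x \oplus \mathcal{L}_y \oplus \mathcal{L}_z$. There are a closed embedding $\iota \colon Y \hookrightarrow E$ of $S$-schemes and an affine open cover $\{S_i\}_i$ of $S$ such that for each $i$ there are trivializations $\mathcal{L}_x|_{S_i} \simeq \mathcal{L}_y|_{S_i} \simeq \mathcal{L}_z|_{S_i} \simeq \mathcal{O}_{S_i}$, with corresponding sections $x_i \in \Gamma(S_i, \mathcal{L}_x^\vee)$, $y_i \in \Gamma(S_i, \mathcal{L}_y^\vee)$, $z_i \in \Gamma(S_i, \mathcal{L}_z^\vee)$, and an isomorphism of $S_i$-schemes $$\pi_Y^{-1}(S_i) \simeq \mathrm{Spec}\, \mathcal{O}_S(S_i)[x_i,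 y_i, z_i]/(x_i y_i - z_i^{n+1})$$ which, under the isomorphism $\pi_E^{-1}(S_i) \simeq \mathrm{Spec}\, \mathcal{O}_S(S_i)[x_i, y_i, z_i]$ given by the coordinates $x_i, y_i, z_i$, identifies the restriction of $\iota$ with the standard closed embedding into $\mathrm{Spec}\, \mathcal{O}_S(S_i)[x_i, y_i, z_i]$. Then there is an isomorphism of $\mathcal{O}_S$-modules $$(\pi_Y)_* \left( \mathcal{E}xt^1_{\mathcal{O}_Y}(\Omega^1_{Y/S}, \mathcal{O}_Y) \right) \simeq \bigoplus_{2 \le j \le n+1} \mathcal{L}_z^{\otimes j}.$$ -/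

import Mathlib

open CategoryTheory Limits AlgebraicGeometry TopologicalSpace

universe u

noncomputable section

namespace AnBundle

/-! ### Preliminaries on the category of sheaves of modules on a scheme

We record that `X.Modules` is a Grothendieck abelian category. In particular it has enough
injectives, so that right derived functors on it are defined. -/

/-- The sheafification functor from presheaves of `𝒪_X`-modules to sheaves of `𝒪_X`-modules. -/
abbrev sheafify (X : Scheme.{u}) : X.PresheafOfModules ⥤ X.Modules :=
  PresheafOfModules.sheafification (𝟙 X.ringCatSheaf.obj)

/-- Sheafification is left adjoint to the forgetful functor. -/
abbrev sheafifyAdj (X : Scheme.{u}) : sheafify X ⊣ Scheme.Modules.toPresheafOfModules X :=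
  PresheafOfModules.sheafificationAdjunction (𝟙 X.ringCatSheaf.obj)

instance {C : Type u} [SmallCategory C] (R : Cᵒᵖ ⥤ RingCat.{u}) (J : Type u) [SmallCategory J]
    [IsFiltered J] : HasExactColimitsOfShape J (PresheafOfModules.{u} R) :=
  HasExactColimitsOfShape.domain_of_functor J (PresheafOfModules.toPresheaf R)

instance (X : Scheme.{u}) : HasFiniteBiproducts X.Modules := Abelian.hasFiniteBiproducts

instance (X : Scheme.{u}) : PreservesFiniteLimits (sheafify X) :=
  inferInstanceAs (PreservesFiniteLimits
    (PresheafOfModules.sheafification (𝟙 X.ringCatSheaf.obj)))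

instance (X : Scheme.{u}) (J : Type u) [SmallCategory J] [IsFiltered J] :
    HasExactColimitsOfShape J X.Modules :=
  (sheafifyAdj X).hasExactColimitsOfShape J

lemma isSeparating_sheafify_free (X : Scheme.{u}) :
    ObjectProperty.IsSeparating (.ofObj fun U : X.Opens =>
      (sheafify X).obj ((PresheafOfModules.free X.ringCatSheaf.obj).obj (yoneda.obj U))) := by
  intro M N f g h
  apply (Scheme.Modules.toPresheafOfModules X).map_injective
  apply PresheafOfModules.freeYoneda.isSeparating X.ringCatSheaf.obj
  rintro _ ⟨U⟩ a
  apply ((sheafifyAdj X).homEquiv _ _).symm.injective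
  rw [Adjunction.homEquiv_naturality_right_symm, Adjunction.homEquiv_naturality_right_symm]
  exact h _ (ObjectProperty.ofObj_apply _ U) (((sheafifyAdj X).homEquiv _ _).symm a)

instance (X : Scheme.{u}) : IsGrothendieckAbelian.{u} X.Modules where
  ab5OfSize := { ofShape := fun _ _ _ => inferInstance }
  hasSeparator := ⟨_, (isSeparating_sheafify_free X).isSeparator_coproduct⟩

/-- The structure sheaf of `X` as an `𝒪_X`-module. -/
abbrev structureModule (X : Scheme.{u}) : X.Modules := SheafOfModules.unit X.ringCatSheaf

section Sections

variable {X : Scheme.{u}} (M : X.Modules)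

lemma map_map {U V W : X.Opens} (hV : V ≤ U) (hW : W ≤ V) (s : Γ(M, U)) :
    M.presheaf.map (homOfLE hW).op (M.presheaf.map (homOfLE hV).op s) =
      M.presheaf.map (homOfLE (hW.trans hV)).op s := by
  rw [← ConcreteCategory.comp_apply, ← M.presheaf.map_comp]
  rfl

lemma eq_of_res_eq {ι : Type u} {U : ι → X.Opens} {V : X.Opens} (hV : V ≤ iSup U)
    {s t : Γ(M, V)} (h : ∀ i, M.presheaf.map (homOfLE (inf_le_left (b := U i))).op s =
      M.presheaf.map (homOfLE (inf_le_left (b := U i))).op t) : s = t :=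
  TopCat.Sheaf.eq_of_locally_eq' ⟨M.presheaf, M.isSheaf⟩ (fun i => V ⊓ U i) V
    (fun i => homOfLE inf_le_left) (by rw [← inf_iSup_eq]; exact le_inf le_rfl hV) s t h

end Sections

/-! ### The internal Hom sheaf -/

/-- A morphism `F|_U ⟶ G|_U` of sheaves of `𝒪_U`-modules, given by its components on the open
subsets of `U`. -/
@[ext]
structure LocalHom {X : Scheme.{u}} (F G : X.Modules) (U : X.Opens) : Type u where
  /-- The component on an open subset `V` of `U`. -/
  app (V : X.Opens) (hV : V ≤ U) : Γ(F, V) →ₗ[Γ(X, V)] Γ(G, V)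
  naturality {V W : X.Opens} (hV : V ≤ U) (hWV : W ≤ V) (s : Γ(F, V)) :
    app W (hWV.trans hV) (F.presheaf.map (homOfLE hWV).op s) =
      G.presheaf.map (homOfLE hWV).op (app V hV s)

namespace LocalHom

variable {X : Scheme.{u}} {F F' G G' : X.Modules} {U : X.Opens}

instance : Zero (LocalHom F G U) := ⟨⟨fun _ _ => 0, by simp⟩⟩

instance : Add (LocalHom F G U) :=
  ⟨fun φ ψ => ⟨fun V hV => φ.app V hV + ψ.app V hV, fun hV hW s => by
    simp [φ.naturality hV hW, ψ.naturality hV hW]⟩⟩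

instance : Neg (LocalHom F G U) :=
  ⟨fun φ => ⟨fun V hV => -φ.app V hV, fun hV hW s => by simp [φ.naturality hV hW]⟩⟩

instance : SMul Γ(X, U) (LocalHom F G U) :=
  ⟨fun r φ => ⟨fun V hV => X.presheaf.map (homOfLE hV).op r • φ.app V hV, fun hV hW s => by
    simp only [LinearMap.smul_apply, φ.naturality hV hW, Scheme.Modules.map_smul]
    rw [← CommRingCat.comp_apply, ← X.presheaf.map_comp]
    rfl⟩⟩

@[simp] lemma zero_app (V : X.Opens) (hV : V ≤ U) : (0 : LocalHom F G U).app V hV = 0 := rfl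

@[simp] lemma add_app (φ ψ : LocalHom F G U) (V : X.Opens) (hV : V ≤ U) :
    (φ + ψ).app V hV = φ.app V hV + ψ.app V hV := rfl

@[simp] lemma neg_app (φ : LocalHom F G U) (V : X.Opens) (hV : V ≤ U) :
    (-φ).app V hV = -φ.app V hV := rfl

@[simp] lemma smul_app (r : Γ(X, U)) (φ : LocalHom F G U) (V : X.Opens) (hV : V ≤ U) :
    (r • φ).app V hV = X.presheaf.map (homOfLE hV).op r • φ.app V hV := rfl

instance : AddCommGroup (LocalHom F G U) where
  add_assoc _ _ _ := by ext : 3; simp [add_assoc]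
  zero_add _ := by ext : 3; simp
  add_zero _ := by ext : 3; simp
  add_comm _ _ := by ext : 3; simp [add_comm]
  neg_add_cancel _ := by ext : 3; simp
  nsmul := nsmulRec
  zsmul := zsmulRec

instance : Module Γ(X, U) (LocalHom F G U) where
  one_smul _ := by ext : 3; simp
  mul_smul _ _ _ := by ext : 3; simp [mul_smul]
  smul_zero _ := by ext : 3; simp
  smul_add _ _ _ := by ext : 3; simp
  add_smul _ _ _ := by ext : 3; simp [add_smul]
  zero_smul _ := by ext : 3; simp

/-- Restriction to a smaller open subset. -/
def res {V : X.Opens} (h : V ≤ U) : LocalHom F G U →+ LocalHom F G V where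
  toFun φ := ⟨fun W hW => φ.app W (hW.trans h), fun hV => φ.naturality (hV.trans h)⟩
  map_zero' := rfl
  map_add' _ _ := rfl

lemma res_smul {V : X.Opens} (h : V ≤ U) (r : Γ(X, U)) (φ : LocalHom F G U) :
    res h (r • φ) = X.presheaf.map (homOfLE h).op r • res h φ := by
  ext W hW s
  change X.presheaf.map (homOfLE (hW.trans h)).op r • φ.app W (hW.trans h) s =
    X.presheaf.map (homOfLE hW).op (X.presheaf.map (homOfLE h).op r) • φ.app W (hW.trans h) s
  rw [← CommRingCat.comp_apply, ← X.presheaf.map_comp]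
  rfl

/-- Composition with a morphism in the target. -/
def postcomp (g : G ⟶ G') : LocalHom F G U →+ LocalHom F G' U where
  toFun φ := ⟨fun V hV =>
    { toFun s := g.app V (φ.app V hV s)
      map_add' := by simp
      map_smul' := by simp }, fun {V W} hV hWV s => by
      simp only [LinearMap.coe_mk, AddHom.coe_mk, φ.naturality hV hWV]
      exact ConcreteCategory.congr_hom (g.mapPresheaf.naturality (homOfLE hWV).op) _⟩
  map_zero' := by ext; simp
  map_add' _ _ := by ext; simp

/-- Composition with a morphism in the source. -/
def precomp (f : F' ⟶ F) : LocalHom F G U →+ LocalHom F' G U where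
  toFun φ := ⟨fun V hV =>
    { toFun s := φ.app V hV (f.app V s)
      map_add' := by simp
      map_smul' := by simp }, fun {V W} hV hWV s => by
      simp only [LinearMap.coe_mk, AddHom.coe_mk, ← φ.naturality hV hWV]
      congr 1
      exact ConcreteCategory.congr_hom (f.mapPresheaf.naturality (homOfLE hWV).op) s⟩
  map_zero' := by ext; simp
  map_add' _ _ := by ext; simp

/-- `φ : F|_U ⟶ G|_U` is an isomorphism. -/
def IsIsomorphism (φ : LocalHom F G U) : Prop :=
  ∀ (V : X.Opens) (hV : V ≤ U), Function.Bijective (φ.app V hV)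

end LocalHom

section SheafHom

variable {X : Scheme.{u}} (F G : X.Modules)

/-- The presheaf of abelian groups `U ↦ Hom(F|_U, G|_U)`. -/
def localHomPresheaf : TopCat.Presheaf Ab.{u} X where
  obj U := .of (LocalHom F G U.unop)
  map i := AddCommGrpCat.ofHom (LocalHom.res i.unop.le)

instance (U : X.Opensᵒᵖ) : Module (X.ringCatSheaf.obj.obj U) ((localHomPresheaf F G).obj U) :=
  inferInstanceAs (Module Γ(X, U.unop) (LocalHom F G U.unop))

lemma exists_glue {ι : Type u} {U : ι → X.Opens} (φ : ∀ i, LocalHom F G (U i))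
    (h : ∀ i j, LocalHom.res (inf_le_left : U i ⊓ U j ≤ U i) (φ i) =
      LocalHom.res inf_le_right (φ j))
    (V : X.Opens) (hV : V ≤ iSup U) (s : Γ(F, V)) :
    ∃ t : Γ(G, V), ∀ i, G.presheaf.map (homOfLE (inf_le_left (b := U i))).op t =
      (φ i).app (V ⊓ U i) inf_le_right (F.presheaf.map (homOfLE inf_le_left).op s) := by
  refine (TopCat.Sheaf.existsUnique_gluing' ⟨G.presheaf, G.isSheaf⟩ (fun i => V ⊓ U i) V
    (fun i => homOfLE inf_le_left) (by rw [← inf_iSup_eq]; exact le_inf le_rfl hV)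
    (fun i => (φ i).app (V ⊓ U i) inf_le_right (F.presheaf.map (homOfLE inf_le_left).op s))
    ?_).exists
  intro i j
  have h1 := (φ i).naturality (inf_le_right : V ⊓ U i ≤ U i)
    (inf_le_left : (V ⊓ U i) ⊓ (V ⊓ U j) ≤ V ⊓ U i) (F.presheaf.map (homOfLE inf_le_left).op s)
  have h2 := (φ j).naturality (inf_le_right : V ⊓ U j ≤ U j)
    (inf_le_right : (V ⊓ U i) ⊓ (V ⊓ U j) ≤ V ⊓ U j) (F.presheaf.map (homOfLE inf_le_left).op s)
  rw [map_map] at h1 h2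
  refine h1.symm.trans (Eq.trans ?_ h2)
  exact DFunLike.congr_fun (congr_fun (congr_fun (congr_arg LocalHom.app (h i j))
    ((V ⊓ U i) ⊓ (V ⊓ U j))) (inf_le_inf inf_le_right inf_le_right)) _

lemma isSheaf_localHomPresheaf : (localHomPresheaf F G).IsSheaf := by
  rw [TopCat.Presheaf.isSheaf_iff_isSheafUniqueGluing]
  intro ι U φ hφ
  replace hφ : ∀ i j, LocalHom.res (inf_le_left : U i ⊓ U j ≤ U i) (φ i) =
    LocalHom.res inf_le_right (φ j) := hφ
  choose t ht using exists_glue F G φ hφ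
  refine ⟨(⟨fun V hV => ⟨⟨t V hV, fun a b => ?_⟩, fun r a => ?_⟩, fun {V W} hV hW s => ?_⟩ :
    LocalHom F G (iSup U)), fun i => ?_, fun ψ hψ => ?_⟩
  · refine eq_of_res_eq G hV fun i => ?_
    rw [ht, map_add, map_add, map_add, ht, ht]
  · refine eq_of_res_eq G hV fun i => ?_
    dsimp only
    rw [ht, Scheme.Modules.map_smul, Scheme.Modules.map_smul, map_smul, ht]
    rfl
  · refine eq_of_res_eq G (hW.trans hV) fun i => ?_
    change G.presheaf.map _ (t W _ _) = G.presheaf.map _ (G.presheaf.map _ (t V _ _))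
    rw [ht, map_map, map_map]
    have h1 := ht V hV s i
    have h2 := (φ i).naturality (inf_le_right : V ⊓ U i ≤ U i)
      (inf_le_inf_right (U i) hW) (F.presheaf.map (homOfLE inf_le_left).op s)
    rw [← h1, map_map, map_map] at h2
    exact h2
  · refine LocalHom.ext ?_
    funext V hV
    ext s
    change t V (hV.trans (le_iSup U i)) s = (φ i).app V hV s
    refine eq_of_res_eq G (hV.trans (le_iSup U i)) fun j => ?_
    rw [ht]
    have h1 := (φ i).naturality hV (inf_le_left (b := U j)) s
    rw [← h1]
    exact (DFunLike.congr_fun (congr_fun (congr_fun (congr_arg LocalHom.app (hφ i j))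
      (V ⊓ U j)) (inf_le_inf_right _ hV)) _).symm
  · refine LocalHom.ext ?_
    funext V hV
    ext s
    change (LocalHom.app ψ V hV) s = t V hV s
    refine eq_of_res_eq G hV fun j => ?_
    rw [ht]
    refine (LocalHom.naturality (F := F) (G := G) ψ hV (inf_le_left (b := U j)) s).symm.trans ?_
    exact DFunLike.congr_fun (congr_fun (congr_fun (congr_arg LocalHom.app (hψ j))
      (V ⊓ U j)) inf_le_right) _

/-- The sheaf of `𝒪_X`-modules `ℋom(F, G)`, with sections `U ↦ Hom(F|_U, G|_U)`. -/
def sheafHom : X.Modules where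
  val := PresheafOfModules.ofPresheaf (R := X.ringCatSheaf.obj) (localHomPresheaf F G) fun {_ _} i r φ =>
    LocalHom.res_smul (F := F) (G := G) i.unop.le r φ
  isSheaf := isSheaf_localHomPresheaf F G

/-- The functor `ℋom(F, -)` on sheaves of `𝒪_X`-modules. -/
def sheafHomFunctor : X.Modules ⥤ X.Modules where
  obj G := sheafHom F G
  map {G G'} g := ⟨PresheafOfModules.homMk
    { app U := AddCommGrpCat.ofHom (LocalHom.postcomp (F := F) (U := U.unop) g)
      naturality _ _ _ := rfl }
    (by
      intro U r φ
      refine LocalHom.ext ?_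
      funext V hV
      refine LinearMap.ext fun s => ?_
      exact g.app_smul _ _)⟩
  map_id _ := rfl
  map_comp _ _ := rfl

instance : (sheafHomFunctor F).Additive where
  map_add := rfl

/-- The sheaf `ℰxt^i(F, G)`: the value at `G` of the `i`-th right derived functor of
`ℋom(F, -)`. -/
def sheafExt (i : ℕ) : X.Modules := ((sheafHomFunctor F).rightDerived i).obj G

/-- The dual `F^∨ = ℋom(F, 𝒪_X)`. -/
abbrev dual : X.Modules := sheafHom F (structureModule X)

end SheafHom

/-! ### Line bundles and tensor powers -/

/-- `L` is a line bundle: it is locally isomorphic to the structure sheaf. -/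
def IsLineBundle {X : Scheme.{u}} (L : X.Modules) : Prop :=
  ∀ p : X, ∃ (U : X.Opens) (_ : p ∈ U) (t : LocalHom L (structureModule X) U), t.IsIsomorphism

/-- The tensor product of sheaves of `𝒪_X`-modules: the sheaf associated with
`U ↦ Γ(M, U) ⊗ Γ(N, U)`. -/
def tensorObj {X : Scheme.{u}} (M N : X.Modules) : X.Modules :=
  (sheafify X).obj (PresheafOfModules.Monoidal.tensorObj (R := X.presheaf) M.val N.val)

/-- The tensor power `M^{⊗ j}`. -/
def tensorPow {X : Scheme.{u}} (M : X.Modules) : ℕ → X.Modules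
  | 0 => structureModule X
  | j + 1 => tensorObj (tensorPow M j) M

/-! ### Relative differentials -/

/-- The morphism of presheaves of rings `π⁻¹𝒪_S ⟶ 𝒪_Y`, where `π⁻¹` is the inverse image of
presheaves. -/
def inverseImageToStructure {Y S : Scheme.{u}} (π : Y ⟶ S) :
    (TopCat.Presheaf.pullback CommRingCat.{u} π.base).obj S.presheaf ⟶ Y.presheaf :=
  ((TopCat.Presheaf.pullbackPushforwardAdjunction CommRingCat.{u} π.base).homEquiv _ _).symm π.c

/-- The sheaf `Ω¹_{Y/S}` of relative differentials of `π : Y ⟶ S`: the sheaf associated with the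
presheaf `U ↦ Ω¹_{𝒪_Y(U) / (π⁻¹𝒪_S)(U)}`. -/
def relativeDifferentials {Y S : Scheme.{u}} (π : Y ⟶ S) : Y.Modules :=
  (sheafify Y).obj
    (PresheafOfModules.DifferentialsConstruction.relativeDifferentials' (inverseImageToStructure π))

/-! ### The total space of a vector bundle -/

/-- The total space `Spec_S Sym(M^∨)` of a vector bundle `M` on `S`: a scheme `E` affine over `S`,
together with a morphism `M^∨ ⟶ π_* 𝒪_E` of `𝒪_S`-modules (the linear functions on `E`) which
exhibits `π_* 𝒪_E` as the symmetric algebra of `M^∨`, that is, which exhibits `𝒪_E(π⁻¹U)` as the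
symmetric algebra over `𝒪_S(U)` of `Γ(U, M^∨)` for every affine open subset `U` of `S`.
This determines `E` up to a unique isomorphism. -/
structure TotalSpace {S : Scheme.{u}} (M : S.Modules) where
  /-- The underlying scheme. -/
  E : Scheme.{u}
  /-- The projection to the base. -/
  proj : E ⟶ S
  isAffineHom : IsAffineHom proj
  /-- The inclusion of the linear functions. -/
  lin : dual M ⟶ (Scheme.Modules.pushforward proj).obj (structureModule E)
  isSymmetricAlgebra (U : S.Opens) (hU : IsAffineOpen U) :
    letI : Algebra Γ(S, U) Γ(E, proj ⁻¹ᵁ U) := (proj.app U).hom.toAlgebra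
    IsSymmetricAlgebra (R := Γ(S, U)) (M := LocalHom M (structureModule S) U)
      (A := Γ(E, proj ⁻¹ᵁ U))
      { toFun := fun φ => lin.app U φ
        map_add' := fun φ ψ => (lin.app U).hom.map_add φ ψ
        map_smul' := fun r φ => lin.app_smul r φ }

namespace TotalSpace

variable {S : Scheme.{u}} {M : S.Modules} (T : TotalSpace M)

/-- The function on `π⁻¹U` given by a linear form on `M|_U`. -/
def linearFunction {U : S.Opens} (φ : LocalHom M (structureModule S) U) :
    Γ(T.E, T.proj ⁻¹ᵁ U) :=
  T.lin.app U φ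

end TotalSpace

/-! ### `A_n`-bundles -/

section Bundle

variable {S : Scheme.{u}} {Lx Ly Lz : S.Modules}

/-- The morphism `π_E⁻¹(U) ⟶ 𝔸³_U = Spec 𝒪_S(U)[x, y, z]` given by linear forms `x`, `y`, `z` on
`Lx|_U`, `Ly|_U`, `Lz|_U`, where `E` is the total space of `Lx ⊕ Ly ⊕ Lz`. -/
def coordMap (T : TotalSpace (Lx ⊞ (Ly ⊞ Lz))) {U : S.Opens}
    (x : LocalHom Lx (structureModule S) U) (y : LocalHom Ly (structureModule S) U)
    (z : LocalHom Lz (structureModule S) U) :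
    (T.proj ⁻¹ᵁ U).toScheme ⟶ Spec (.of (MvPolynomial (Fin 3) Γ(S, U))) :=
  (T.proj ⁻¹ᵁ U).toSpecΓ ≫ Spec.map (CommRingCat.ofHom
    (MvPolynomial.eval₂Hom (T.proj.app U).hom
      ![T.linearFunction (x.precomp biprod.fst),
        T.linearFunction (y.precomp (biprod.snd ≫ biprod.fst)),
        T.linearFunction (z.precomp (biprod.snd ≫ biprod.snd))]))

/-- The ideal `(x y - z^{n+1})` of `A[x, y, z]`. -/
def anIdeal (n : ℕ) (A : Type u) [CommRing A] : Ideal (MvPolynomial (Fin 3) A) :=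
  Ideal.span {MvPolynomial.X 0 * MvPolynomial.X 1 - MvPolynomial.X 2 ^ (n + 1)}

/-- The closed embedding `Spec A[x, y, z] / (x y - z^{n+1}) ⟶ Spec A[x, y, z]`. -/
def anEmbedding (n : ℕ) (A : Type u) [CommRing A] :
    Spec (.of (MvPolynomial (Fin 3) A ⧸ anIdeal n A)) ⟶ Spec (.of (MvPolynomial (Fin 3) A)) :=
  Spec.map (CommRingCat.ofHom (Ideal.Quotient.mk (anIdeal n A)))

/-- `π : Y ⟶ S` is an `A_n`-bundle with respect to the line bundles `Lx`, `Ly`, `Lz` on `S`. -/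
structure IsAnBundle (n : ℕ) {Y : Scheme.{u}} (π : Y ⟶ S) (Lx Ly Lz : S.Modules) : Prop where
  isLineBundle_x : IsLineBundle Lx
  isLineBundle_y : IsLineBundle Ly
  isLineBundle_z : IsLineBundle Lz
  /-- There is a closed embedding `ι` of `S`-schemes of `Y` into the total space of
  `Lx ⊕ Ly ⊕ Lz` such that `S` is covered by affine open subsets `U` which have trivializations
  `x`, `y`, `z` of the three line bundles, for which `ι⁻¹(π_E⁻¹(U)) = π⁻¹(U)` is identified with
  the closed subscheme `x y = z^{n+1}` of `π_E⁻¹(U) ≅ 𝔸³_U`. -/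
  exists_embedding : ∃ (T : TotalSpace (Lx ⊞ (Ly ⊞ Lz))) (ι : Y ⟶ T.E),
    IsClosedImmersion ι ∧ ι ≫ T.proj = π ∧
    ∀ p : S, ∃ (U : S.Opens) (_ : p ∈ U) (_ : IsAffineOpen U)
      (x : LocalHom Lx (structureModule S) U) (y : LocalHom Ly (structureModule S) U)
      (z : LocalHom Lz (structureModule S) U),
      x.IsIsomorphism ∧ y.IsIsomorphism ∧ z.IsIsomorphism ∧
      IsIso (coordMap T x y z) ∧
      ∃ e : (ι ⁻¹ᵁ T.proj ⁻¹ᵁ U).toScheme ≅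
          Spec (.of (MvPolynomial (Fin 3) Γ(S, U) ⧸ anIdeal n Γ(S, U))),
        e.hom ≫ anEmbedding n Γ(S, U) = (ι ∣_ (T.proj ⁻¹ᵁ U)) ≫ coordMap T x y z

end Bundle

end AnBundle

end

/-!
The map in question is a morphism `⨁ L_z^{⊗ j} ⟶ π_* ℰxt¹(Ω¹_{Y/S}, 𝒪_Y)` which is explicit in
every chart. Let `x`, `y`, `z` be the coordinates on `W = π⁻¹V`, for an affine open subset `V` of
`S`. On open subsets of `W` the function `y` is not a zero divisor, and `Ω¹_{Y/S}` is generated by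
`dx`, `dy`, `dz` with the single relation `y dx + x dy = (n + 1) z ^ n dz`
(`IsAnChart.localHom_eq_zero`, `IsAnChart.exists_localHom`). So if `𝒪_Y ⟶ I₀ ⟶ I₁ ⟶ I₂` is the
beginning of an injective resolution, sections of `ℰxt¹` are locally triples of cocycles in `I₁`,
the values at `dx`, `dy`, `dz`, subject to this relation, and modulo the triples which lift to
`I₀` with the relation.

Sections of `I₀` are divisible by `y` (`exists_smul_eq_of_injective`), and the cocycle
`dx ↦ d₀ (y⁻¹)`, `dy ↦ 0`, `dz ↦ 0` defines a section `e` of `ℰxt¹` over `W`. Lifting cocycles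
locally to `I₀` and evaluating the relation on the lifts, one finds that `e` generates `ℰxt¹`
(`exists_eq_smul`), that its annihilator is the Jacobian ideal `(x, y, z ^ n)`
(`smul_eq_zero_iff`, where `n + 1` is inverted), and that `e = c ^ (n + 1) e'` if `x' = a x`,
`y' = b y`, `z' = c z` are other coordinates (`generator_eq_smul`; comparing the equations of `Y`
gives `a b = c ^ (n + 1)`). A partition of unity passes from local generation to
`Γ(W, ℰxt¹) = Γ(W, 𝒪_Y) / (x, y, z ^ n)`, which is free over `Γ(V, 𝒪_S)` with basis `z ^ k e` for
`0 ≤ k < n` (`IsAnChart.bijective_sum`).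

Since `z` is also a trivialization of `L_z`, the map `s ↦ z^{⊗ j}(s) z ^ (n + 1 - j) e` on
sections of `L_z^{⊗ j}` is defined in the chart, and the transformation rule for `e` shows that it
does not depend on the chart (`monomialClass_eq`). These maps glue (`exists_monomialHom`), and
their sum over `2 ≤ j ≤ n + 1` is an isomorphism because the exponents `n + 1 - j` run through
`0, …, n - 1`.
-/

noncomputable section

namespace AnBundle

/-! ### Sections of associated sheaves -/

section SheafifyUnit

variable {X : Scheme.{u}} (P : PresheafOfModules.{u} X.ringCatSheaf.obj)

/-- The map from the sections of a presheaf of modules to those of the associated sheaf. -/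
def sheafifyUnit (V : X.Opens) : P.obj (.op V) →ₗ[X.ringCatSheaf.obj.obj (.op V)]
    ((sheafify X).obj P).val.obj (.op V) :=
  (((sheafifyAdj X).unit.app P).app (.op V)).hom

lemma map_sheafifyUnit {V W : X.Opens} (h : W ≤ V) (s : P.obj (.op V)) :
    ((sheafify X).obj P).presheaf.map (homOfLE h).op (sheafifyUnit P V s) =
      sheafifyUnit P W (P.map (homOfLE h).op s) :=
  (PresheafOfModules.naturality_apply ((sheafifyAdj X).unit.app P) (homOfLE h).op s).symm

/-- Locally, every section of the associated sheaf comes from the presheaf. -/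
lemma exists_sheafifyUnit_eq {V : X.Opens} (s : Γ((sheafify X).obj P, V)) (p : X) (hp : p ∈ V) :
    ∃ (W : X.Opens) (h : W ≤ V) (_ : p ∈ W) (t : P.obj (.op W)),
      sheafifyUnit P W t = ((sheafify X).obj P).presheaf.map (homOfLE h).op s := by
  have := Presheaf.imageSieve_mem (Opens.grothendieckTopology X)
    (CategoryTheory.toSheafify (Opens.grothendieckTopology X) P.presheaf) (U := .op V) s
  obtain ⟨W, f, ⟨t, ht⟩, hpW⟩ := this p hp
  exact ⟨W, f.le, hpW, t, ht⟩

/-- A section of the presheaf which vanishes in the associated sheaf vanishes locally. -/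
lemma exists_map_eq_zero_of_sheafifyUnit_eq_zero {V : X.Opens} (s : P.obj (.op V))
    (hs : sheafifyUnit P V s = 0) (p : X) (hp : p ∈ V) :
    ∃ (W : X.Opens) (h : W ≤ V) (_ : p ∈ W), P.map (homOfLE h).op s = 0 := by
  have := Presheaf.equalizerSieve_mem (Opens.grothendieckTopology X)
    (CategoryTheory.toSheafify (Opens.grothendieckTopology X) P.presheaf) (X := .op V) s 0
    (hs.trans (map_zero (sheafifyUnit P V)).symm)
  obtain ⟨W, f, h, hpW⟩ := this p hp
  exact ⟨W, f.le, hpW, h.trans (map_zero (P.map f.op).hom)⟩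

end SheafifyUnit

section Exactness

variable {X : Scheme.{u}}

/-- An epimorphism of sheaves of modules is locally surjective on sections. -/
lemma exists_app_eq_of_epi {M N : X.Modules} (f : M ⟶ N) [Epi f] {V : X.Opens} (s : Γ(N, V))
    (p : X) (hp : p ∈ V) :
    ∃ (W : X.Opens) (h : W ≤ V) (_ : p ∈ W) (t : Γ(M, W)),
      f.app W t = N.presheaf.map (homOfLE h).op s := by
  let F : M.val ⟶ N.val := f.val
  let q := cokernel.π F
  -- The sheaf associated with the presheaf cokernel is a quotient of `N` on which `f` vanishes.
  let g : N ⟶ (sheafify X).obj (cokernel F) :=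
    Scheme.Modules.fullyFaithfulToPresheafOfModules.preimage (q ≫ (sheafifyAdj X).unit.app _)
  have hg : g = 0 := by
    rw [← cancel_epi f, comp_zero]
    apply (Scheme.Modules.toPresheafOfModules X).map_injective
    rw [Functor.map_comp, Functor.FullyFaithful.map_preimage, Functor.map_zero]
    change F ≫ q ≫ _ = 0
    rw [cokernel.condition_assoc, zero_comp]
  have h0 : sheafifyUnit (cokernel F) V (q.app (.op V) s) = 0 := by
    have h1 : (Scheme.Modules.toPresheafOfModules X).map g = 0 := by rw [hg, Functor.map_zero]
    rw [Functor.FullyFaithful.map_preimage] at h1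
    have h2 := congr_arg (fun k => PresheafOfModules.Hom.app k (.op V)) h1
    exact ConcreteCategory.congr_hom h2 s
  obtain ⟨W, h, hW, hs⟩ := exists_map_eq_zero_of_sheafifyUnit_eq_zero _ _ h0 p hp
  refine ⟨W, h, hW, ?_⟩
  have h3 : q.app (.op W) (N.presheaf.map (homOfLE h).op s) = 0 :=
    (PresheafOfModules.naturality_apply q (homOfLE h).op s).trans hs
  have ex : (ShortComplex.mk F q (cokernel.condition F)).Exact :=
    ShortComplex.exact_of_g_is_cokernel _ (cokernelIsCokernel F)
  have ex2 := ex.map (PresheafOfModules.evaluation _ (.op W))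
  rw [ShortComplex.moduleCat_exact_iff] at ex2
  exact ex2 _ h3

end Exactness

/-! ### Exactness and gluing on sections -/

section Exactness

variable {X : Scheme.{u}}

lemma hom_app_res {M N : X.Modules} (f : M ⟶ N) {V W : X.Opens} (h : W ≤ V) (s : Γ(M, V)) :
    f.app W (M.presheaf.map (homOfLE h).op s) = N.presheaf.map (homOfLE h).op (f.app V s) :=
  ConcreteCategory.congr_hom (f.mapPresheaf.naturality (homOfLE h).op) s

/-- Taking sections over `V` is left exact. -/
lemma sections_exact_of_mono_of_exact {S : ShortComplex X.Modules} [Mono S.f] (hS : S.Exact)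
    (V : X.Opens) :
    Function.Injective (S.f.app V) ∧
      ∀ s : Γ(S.X₂, V), S.g.app V s = 0 → ∃ t, S.f.app V t = s := by
  let G := Scheme.Modules.toPresheafOfModules X ⋙ PresheafOfModules.evaluation _ (.op V)
  have : PreservesFiniteLimits G := by
    have : PreservesFiniteLimits (Scheme.Modules.toPresheafOfModules X) := inferInstance
    exact comp_preservesFiniteLimits _ _
  have hm : Mono (G.map S.f) := inferInstance
  have hk : IsLimit (KernelFork.ofι S.f S.zero) := hS.fIsKernel
  have hk2 := (KernelFork.mapIsLimit _ hk G)
  refine ⟨(ModuleCat.mono_iff_injective _).1 hm, ?_⟩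
  have hz : G.map S.f ≫ G.map S.g = 0 := by rw [← G.map_comp, S.zero, G.map_zero]
  have ex := ShortComplex.exact_of_f_is_kernel (ShortComplex.mk (G.map S.f) (G.map S.g) hz) hk2
  rw [ShortComplex.moduleCat_exact_iff] at ex
  exact fun s hs => ex s hs

lemma injective_app_of_mono {M N : X.Modules} (f : M ⟶ N) [Mono f] (V : X.Opens) :
    Function.Injective (f.app V) :=
  (sections_exact_of_mono_of_exact (S := ShortComplex.mk f (cokernel.π f) (cokernel.condition f))
    (ShortComplex.exact_of_g_is_cokernel _ (cokernelIsCokernel f)) V).1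

lemma exists_app_eq_of_exact {S : ShortComplex X.Modules} (hS : S.Exact) {V : X.Opens}
    (s : Γ(S.X₂, V)) (hs : S.g.app V s = 0) (p : X) (hp : p ∈ V) :
    ∃ (W : X.Opens) (h : W ≤ V) (_ : p ∈ W) (t : Γ(S.X₁, W)),
      S.f.app W t = S.X₂.presheaf.map (homOfLE h).op s := by
  obtain ⟨t, rfl⟩ := (sections_exact_of_mono_of_exact (S := ShortComplex.mk (kernel.ι S.g) S.g
    (kernel.condition _)) (ShortComplex.exact_of_f_is_kernel _ (kernelIsKernel S.g)) V).2 s hs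
  have := S.exact_iff_epi_kernel_lift.1 hS
  obtain ⟨W, h, hW, a, ha⟩ := exists_app_eq_of_epi (kernel.lift S.g S.f S.zero) t p hp
  refine ⟨W, h, hW, a, ?_⟩
  dsimp only
  rw [← hom_app_res, ← ha, ← ConcreteCategory.comp_apply, ← Scheme.Modules.Hom.comp_app,
    kernel.lift_ι]

end Exactness

section Glue

variable {X : Scheme.{u}}

lemma map_self (M : X.Modules) {V : X.Opens} (h : V ≤ V) (s : Γ(M, V)) :
    M.presheaf.map (homOfLE h).op s = s :=
  ConcreteCategory.congr_hom (M.presheaf.map_id _) s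

lemma structure_map_map {U V W : X.Opens} (hV : V ≤ U) (hW : W ≤ V) (s : Γ(X, U)) :
    X.presheaf.map (homOfLE hW).op (X.presheaf.map (homOfLE hV).op s) =
      X.presheaf.map (homOfLE (hW.trans hV)).op s := by
  rw [← ConcreteCategory.comp_apply, ← X.presheaf.map_comp]
  rfl

lemma structure_map_self {V : X.Opens} (h : V ≤ V) (s : Γ(X, V)) :
    X.presheaf.map (homOfLE h).op s = s :=
  ConcreteCategory.congr_hom (X.presheaf.map_id _) s

lemma eq_of_locally_eq (M : X.Modules) {V : X.Opens} {s t : Γ(M, V)}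
    (h : ∀ p ∈ V, ∃ (W : X.Opens) (hW : W ≤ V), p ∈ W ∧
      M.presheaf.map (homOfLE hW).op s = M.presheaf.map (homOfLE hW).op t) : s = t := by
  choose W hW hp he using h
  refine eq_of_res_eq M (U := fun p : V => W p.1 p.2)
    (fun p hpV => Opens.mem_iSup.2 ⟨⟨p, hpV⟩, hp p hpV⟩) fun p => ?_
  rw [← map_map M (hW p.1 p.2) (inf_le_right : V ⊓ W p.1 p.2 ≤ _), he, map_map]

lemma exists_glue_sections (M : X.Modules) {V : X.Opens} (W : V → X.Opens) (hW : ∀ p, W p ≤ V)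
    (hp : ∀ p, p.1 ∈ W p) (t : ∀ p, Γ(M, W p))
    (h : ∀ p q, M.presheaf.map (homOfLE (inf_le_left : W p ⊓ W q ≤ W p)).op (t p) =
      M.presheaf.map (homOfLE (inf_le_right : W p ⊓ W q ≤ W q)).op (t q)) :
    ∃ s : Γ(M, V), ∀ p, M.presheaf.map (homOfLE (hW p)).op s = t p :=
  (TopCat.Sheaf.existsUnique_gluing' ⟨M.presheaf, M.isSheaf⟩ W V (fun p => homOfLE (hW p))
    (fun p hpV => Opens.mem_iSup.2 ⟨⟨p, hpV⟩, hp ⟨p, hpV⟩⟩) t h).exists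

/-- An additive relation between the sections of two sheaves which is locally total, compatible
with restriction and relates `0` only to `0` is contained in the graph of a unique morphism. -/
lemma exists_hom_of_rel {F G : X.Modules} (U : X.Opens)
    (Rel : ∀ V : X.Opens, Γ(F, V) → Γ(G, V) → Prop)
    (rel_zero : ∀ V t, V ≤ U → Rel V 0 t → t = 0)
    (rel_sub : ∀ V s t s' t', V ≤ U → Rel V s t → Rel V s' t' → Rel V (s - s') (t - t'))
    (rel_map : ∀ V W (hW : W ≤ V) s t, V ≤ U → Rel V s t →
      Rel W (F.presheaf.map (homOfLE hW).op s) (G.presheaf.map (homOfLE hW).op t))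
    (rel_exists : ∀ V (s : Γ(F, V)), V ≤ U → ∀ p ∈ V, ∃ (W : X.Opens) (hW : W ≤ V), p ∈ W ∧
      ∃ t, Rel W (F.presheaf.map (homOfLE hW).op s) t) :
    ∃ φ : ∀ V : X.Opens, V ≤ U → (Γ(F, V) →+ Γ(G, V)),
      (∀ V W (hV : V ≤ U) (hW : W ≤ V) s, φ W (hW.trans hV) (F.presheaf.map (homOfLE hW).op s) =
        G.presheaf.map (homOfLE hW).op (φ V hV s)) ∧
      ∀ V (hV : V ≤ U) s t, Rel V s t → φ V hV s = t := by
  have rel_eq {V : X.Opens} {s : Γ(F, V)} {t t' : Γ(G, V)} (hV : V ≤ U) (h : Rel V s t)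
      (h' : Rel V s t') : t = t' := by
    have := rel_sub V s t s t' hV h h'
    rw [sub_self] at this
    exact sub_eq_zero.1 (rel_zero V _ hV this)
  have key (V : X.Opens) (hV : V ≤ U) (s : Γ(F, V)) : ∃ t : Γ(G, V),
      ∀ p ∈ V, ∃ (W : X.Opens) (hW : W ≤ V), p ∈ W ∧
        Rel W (F.presheaf.map (homOfLE hW).op s) (G.presheaf.map (homOfLE hW).op t) := by
    choose W hW hp t ht using fun p : V => rel_exists V s hV p.1 p.2
    obtain ⟨t', ht'⟩ := exists_glue_sections G W hW hp t fun p q => by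
      have h1 := rel_map _ _ (inf_le_left : W p ⊓ W q ≤ W p) _ _ ((hW p).trans hV) (ht p)
      have h2 := rel_map _ _ (inf_le_right : W p ⊓ W q ≤ W q) _ _ ((hW q).trans hV) (ht q)
      rw [map_map] at h1 h2
      exact rel_eq ((inf_le_left.trans (hW p)).trans hV) h1 h2
    exact ⟨t', fun p hpV => ⟨W ⟨p, hpV⟩, hW _, hp _, by rw [ht']; exact ht _⟩⟩
  have uniq (V : X.Opens) (hV : V ≤ U) (s : Γ(F, V)) (t t' : Γ(G, V))
      (ht : ∀ p ∈ V, ∃ (W : X.Opens) (hW : W ≤ V), p ∈ W ∧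
        Rel W (F.presheaf.map (homOfLE hW).op s) (G.presheaf.map (homOfLE hW).op t))
      (ht' : ∀ p ∈ V, ∃ (W : X.Opens) (hW : W ≤ V), p ∈ W ∧
        Rel W (F.presheaf.map (homOfLE hW).op s) (G.presheaf.map (homOfLE hW).op t')) :
      t = t' := by
    refine eq_of_locally_eq G fun p hp => ?_
    obtain ⟨W, hW, hpW, h⟩ := ht p hp
    obtain ⟨W', hW', hpW', h'⟩ := ht' p hp
    refine ⟨W ⊓ W', inf_le_left.trans hW, ⟨hpW, hpW'⟩, ?_⟩
    have h1 := rel_map _ _ (inf_le_left : W ⊓ W' ≤ W) _ _ (hW.trans hV) h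
    have h2 := rel_map _ _ (inf_le_right : W ⊓ W' ≤ W') _ _ (hW'.trans hV) h'
    rw [map_map, map_map] at h1 h2
    exact rel_eq ((inf_le_left.trans hW).trans hV) h1 h2
  choose φ hφ using key
  have hsub (V : X.Opens) (hV : V ≤ U) (s s' : Γ(F, V)) :
      φ V hV (s - s') = φ V hV s - φ V hV s' := by
    refine uniq V hV _ _ _ (hφ V hV _) fun p hp => ?_
    obtain ⟨W, hW, hpW, h⟩ := hφ V hV s p hp
    obtain ⟨W', hW', hpW', h'⟩ := hφ V hV s' p hp
    refine ⟨W ⊓ W', inf_le_left.trans hW, ⟨hpW, hpW'⟩, ?_⟩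
    have h1 := rel_map _ _ (inf_le_left : W ⊓ W' ≤ W) _ _ (hW.trans hV) h
    have h2 := rel_map _ _ (inf_le_right : W ⊓ W' ≤ W') _ _ (hW'.trans hV) h'
    rw [map_map, map_map] at h1 h2
    rw [map_sub, map_sub]
    exact rel_sub _ _ _ _ _ ((inf_le_left.trans hW).trans hV) h1 h2
  refine ⟨fun V hV => AddMonoidHom.ofMapSub (φ V hV) (hsub V hV), fun V W hV hW s => ?_,
    fun V hV s t h => ?_⟩
  · refine uniq W (hW.trans hV) _ _ _ (hφ W _ _) fun p hp => ?_
    obtain ⟨W', hW', hpW', h'⟩ := hφ V hV s p (hW hp)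
    refine ⟨W ⊓ W', inf_le_left, ⟨hp, hpW'⟩, ?_⟩
    have h2 := rel_map _ _ (inf_le_right : W ⊓ W' ≤ W') _ _ (hW'.trans hV) h'
    rw [map_map, map_map] at h2 ⊢
    exact h2
  · refine uniq V hV _ _ _ (hφ V hV _) fun p hp => ⟨V, le_rfl, hp, ?_⟩
    rwa [map_self, map_self]

end Glue

section Desc

variable {X : Scheme.{u}} {P : PresheafOfModules.{u} X.ringCatSheaf.obj} {G : X.Modules}
  {U : X.Opens}

/-- A morphism from the restriction to `U` of a presheaf to a sheaf factors through the associated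
sheaf. -/
lemma exists_localHom_sheafify (a : ∀ V : X.Opens, V ≤ U → P.obj (.op V) →+ Γ(G, V))
    (a_smul : ∀ V (hV : V ≤ U) (r : X.ringCatSheaf.obj.obj (.op V)) (s : P.obj (.op V)),
      a V hV (r • s) = (show Γ(X, V) from r) • a V hV s)
    (a_map : ∀ V W (hV : V ≤ U) (hW : W ≤ V) (s : P.obj (.op V)),
      a W (hW.trans hV) (P.map (homOfLE hW).op s) = G.presheaf.map (homOfLE hW).op (a V hV s)) :
    ∃ φ : LocalHom ((sheafify X).obj P) G U, ∀ V (hV : V ≤ U) (s : P.obj (.op V)),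
      φ.app V hV (sheafifyUnit P V s) = a V hV s := by
  obtain ⟨φ, hφ, hφ'⟩ := exists_hom_of_rel (F := (sheafify X).obj P) (G := G) U
    (fun V s t => ∃ (hV : V ≤ U) (w : P.obj (.op V)), sheafifyUnit P V w = s ∧ a V hV w = t)
    (by
      rintro V t - ⟨hV, w, hw, rfl⟩
      refine eq_of_locally_eq G fun p hp => ?_
      obtain ⟨W, hW, hpW, h0⟩ := exists_map_eq_zero_of_sheafifyUnit_eq_zero _ _ hw p hp
      refine ⟨W, hW, hpW, ?_⟩
      rw [← a_map _ _ hV hW, h0, map_zero]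
      exact (a W _).map_zero)
    (by
      rintro V _ _ _ _ - ⟨hV, w, rfl, rfl⟩ ⟨_, w', rfl, rfl⟩
      exact ⟨hV, w - w', map_sub _ _ _, map_sub _ _ _⟩)
    (by
      rintro V W hW _ _ - ⟨hV, w, rfl, rfl⟩
      exact ⟨hW.trans hV, P.map (homOfLE hW).op w, (map_sheafifyUnit P hW w).symm, a_map _ _ _ _ _⟩)
    (by
      intro V s hV p hp
      obtain ⟨W, hW, hpW, w, hw⟩ := exists_sheafifyUnit_eq P s p hp
      exact ⟨W, hW, hpW, _, hW.trans hV, w, hw, rfl⟩)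
  refine ⟨⟨fun V hV => { φ V hV with map_smul' := ?_ }, fun hV hW s => hφ _ _ hV hW s⟩,
    fun V hV s => hφ' _ _ _ _ ⟨hV, s, rfl, rfl⟩⟩
  intro r s
  refine eq_of_locally_eq G fun p hp => ?_
  obtain ⟨W, hW, hpW, w, hw⟩ := exists_sheafifyUnit_eq P s p hp
  refine ⟨W, hW, hpW, ?_⟩
  change G.presheaf.map _ (φ V hV (r • s)) = G.presheaf.map _ (r • φ V hV s)
  rw [Scheme.Modules.map_smul, ← hφ, ← hφ, Scheme.Modules.map_smul, ← hw,
    hφ' W (hW.trans hV) _ _ ⟨hW.trans hV, w, rfl, rfl⟩]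
  refine hφ' W (hW.trans hV) _ _ ⟨hW.trans hV,
    (show X.ringCatSheaf.obj.obj (.op W) from X.presheaf.map (homOfLE hW).op r) • w,
    map_smul (sheafifyUnit P W) _ _, a_smul _ _ _ _⟩

lemma localHom_sheafify_ext {φ ψ : LocalHom ((sheafify X).obj P) G U}
    (h : ∀ V (hV : V ≤ U) (s : P.obj (.op V)),
      φ.app V hV (sheafifyUnit P V s) = ψ.app V hV (sheafifyUnit P V s)) : φ = ψ := by
  refine LocalHom.ext ?_
  funext V hV
  refine LinearMap.ext fun s => eq_of_locally_eq G fun p hp => ?_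
  obtain ⟨W, hW, hpW, w, hw⟩ := exists_sheafifyUnit_eq P s p hp
  exact ⟨W, hW, hpW, by rw [← φ.naturality, ← ψ.naturality, ← hw, h]⟩

end Desc

/-! ### Divisibility of injective modules -/

section FreeYoneda

variable {C : Type u} [SmallCategory C] (R : Cᵒᵖ ⥤ RingCat.{u})

/-- If `r` restricts to nonzerodivisors, the endomorphism of the free presheaf of modules on one
generator over `V` which multiplies the generator by `r` is a monomorphism. -/
lemma mono_freeYoneda_smul {V : C} (r : R.obj (.op V))
    (hr : ∀ (W : C) (i : W ⟶ V) (c : R.obj (.op W)), c * R.map i.op r = 0 → c = 0) :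
    Mono ((PresheafOfModules.freeYonedaEquiv
      (M := (PresheafOfModules.free R).obj (yoneda.obj V))).symm
        (r • (ModuleCat.freeMk (𝟙 V) :
          ((PresheafOfModules.free R).obj (yoneda.obj V)).obj (.op V)))) := by
  set m := (PresheafOfModules.freeYonedaEquiv
    (M := (PresheafOfModules.free R).obj (yoneda.obj V))).symm
      (r • (ModuleCat.freeMk (𝟙 V) :
        ((PresheafOfModules.free R).obj (yoneda.obj V)).obj (.op V)))
  apply PresheafOfModules.mono_of_injective
  intro W
  let mW : ((yoneda.obj V).obj W →₀ R.obj W) →+ ((yoneda.obj V).obj W →₀ R.obj W) :=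
    (m.app W).hom.toAddMonoidHom
  let gen (j : (yoneda.obj V).obj W) : (ModuleCat.free (R.obj W)).obj ((yoneda.obj V).obj W) :=
    ModuleCat.freeMk j
  have m_gen (j : (yoneda.obj V).obj W) : m.app W (gen j) = R.map j.op r • gen j := by
    have h₁ : ((PresheafOfModules.free R).obj (yoneda.obj V)).map j.op
        (ModuleCat.freeMk (𝟙 V) :
          (ModuleCat.free (R.obj (.op V))).obj ((yoneda.obj V).obj (.op V))) = gen j :=
      (ModuleCat.freeDesc_apply _ _).trans
        (congr_arg gen (Category.comp_id (X := W.unop) j))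
    rw [← h₁]
    refine (PresheafOfModules.naturality_apply m j.op _).trans ?_
    refine (congr_arg _ (PresheafOfModules.freeYonedaEquiv_symm_app
      ((PresheafOfModules.free R).obj (yoneda.obj V)) V (r • ModuleCat.freeMk (𝟙 V)))).trans ?_
    exact PresheafOfModules.map_smul _ _ _ _
  have key (a : (yoneda.obj V).obj W →₀ R.obj W) (i : (yoneda.obj V).obj W) :
      mW a i = a i * R.map i.op r := by
    induction a using Finsupp.induction_linear with
    | zero => rw [map_zero]; exact (zero_mul _).symm
    | add a b ha hb =>
      rw [map_add]
      exact (congr_arg₂ (· + ·) ha hb).trans (add_mul _ _ _).symm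
    | single j c =>
      have h₁ : (Finsupp.single j c : (yoneda.obj V).obj W →₀ R.obj W) = c • gen j := by
        refine Eq.trans ?_ (Finsupp.smul_single _ _ _).symm
        rw [smul_eq_mul, mul_one]
      have h₂ : mW (Finsupp.single j c) = c • R.map j.op r • gen j :=
        (congr_arg mW h₁).trans (((m.app W).hom.map_smul c _).trans (congr_arg (c • ·) (m_gen j)))
      refine (DFunLike.congr_fun h₂ i).trans ?_
      change c * (R.map j.op r * (Finsupp.single j 1 : (yoneda.obj V).obj W →₀ R.obj W) i) = _
      by_cases hij : j = i
      · subst hij; simp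
      · simp [hij]
  rw [injective_iff_map_eq_zero]
  intro a ha
  refine Finsupp.ext fun i => hr _ i _ ?_
  exact (key (show (yoneda.obj V).obj W →₀ R.obj W from a) i).symm.trans
    (congr_arg (fun k : (yoneda.obj V).obj W →₀ R.obj W => k i) ha)

end FreeYoneda

section Divisible

variable {X : Scheme.{u}}

/-- The sheaf associated with the free presheaf on one generator over `V` represents `Γ(-, V)`. -/
lemma exists_hom_of_section {V : X.Opens} {M : X.Modules} (s : Γ(M, V)) :
    ∃ f : (sheafify X).obj ((PresheafOfModules.free X.ringCatSheaf.obj).obj (yoneda.obj V)) ⟶ M,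
      f.app V (sheafifyUnit _ V (ModuleCat.freeMk (𝟙 V))) = s := by
  let k := PresheafOfModules.freeYonedaEquiv (M := M.val) (X := V) |>.symm s
  refine ⟨((sheafifyAdj X).homEquiv _ _).symm k, ?_⟩
  have h1 : (sheafifyAdj X).homEquiv _ _ (((sheafifyAdj X).homEquiv _ M).symm k) = k :=
    Equiv.apply_symm_apply _ _
  rw [Adjunction.homEquiv_unit] at h1
  have h2 := ConcreteCategory.congr_hom
    (congr_arg (fun k => PresheafOfModules.Hom.app k (.op V)) h1) (ModuleCat.freeMk (𝟙 V))
  exact h2.trans (PresheafOfModules.freeYonedaEquiv_symm_app _ _ _)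

/-- Sections of an injective module are divisible by the nonzerodivisors of the structure sheaf:
the morphism from the free sheaf on one generator given by a section extends along multiplication
by the nonzerodivisor. -/
lemma exists_smul_eq_of_injective (I : X.Modules) [Injective I] {V : X.Opens} (r : Γ(X, V))
    (hr : ∀ W (hW : W ≤ V), X.presheaf.map (homOfLE hW).op r ∈ nonZeroDivisors Γ(X, W))
    (s : Γ(I, V)) : ∃ t : Γ(I, V), r • t = s := by
  let Fr := (PresheafOfModules.free X.ringCatSheaf.obj).obj (yoneda.obj V)
  let m : Fr ⟶ Fr := PresheafOfModules.freeYonedaEquiv.symm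
    ((show X.ringCatSheaf.obj.obj (.op V) from r) • (ModuleCat.freeMk (𝟙 V) : Fr.obj (.op V)))
  have hm : Mono m := by
    refine mono_freeYoneda_smul X.ringCatSheaf.obj r fun W i c hc => ?_
    exact (mul_right_mem_nonZeroDivisors_eq_zero_iff (hr _ i.le)).1 hc
  obtain ⟨f, hf⟩ := exists_hom_of_section s
  let g := Injective.factorThru f ((sheafify X).map m)
  refine ⟨g.app V (sheafifyUnit _ V (ModuleCat.freeMk (𝟙 V))), ?_⟩
  have h1 : (sheafify X).map m ≫ g = f := Injective.comp_factorThru _ _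
  have h2 : ((sheafify X).map m).app V (sheafifyUnit Fr V (ModuleCat.freeMk (𝟙 V))) =
      r • (show Γ((sheafify X).obj Fr, V) from sheafifyUnit Fr V (ModuleCat.freeMk (𝟙 V))) := by
    have h3 := (sheafifyAdj X).unit.naturality m
    have h4 := ConcreteCategory.congr_hom
      (congr_arg (fun k => PresheafOfModules.Hom.app k (.op V)) h3) (ModuleCat.freeMk (𝟙 V))
    refine h4.symm.trans ?_
    refine (congr_arg (sheafifyUnit Fr V)
      (PresheafOfModules.freeYonedaEquiv_symm_app _ _ _)).trans ?_
    exact map_smul (sheafifyUnit Fr V) _ _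
  rw [← hf, ← h1, Scheme.Modules.Hom.comp_app]
  exact (g.app_smul r _).symm.trans (congr_arg (g.app V) h2).symm

end Divisible

/-! ### Sections of the sheaf `ℰxt¹` -/

section Ext

variable {X : Scheme.{u}}

/-- A description of `ℰxt¹(F, G)` in terms of sections: the start `0 ⟶ G ⟶ I₀ ⟶ I₁ ⟶ I₂` of an
injective resolution of `G`, and the presentation of `ℰxt¹(F, G)` as the quotient of the sheaf `Z`
of morphisms `F ⟶ I₁` killed by `d₁` by the subsheaf of those which locally lift to `I₀`. -/
structure ExtPresentation (F G : X.Modules) where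
  /-- The terms of the injective resolution. -/
  (I₀ I₁ I₂ : X.Modules)
  /-- The augmentation. -/
  η : G ⟶ I₀
  /-- The first differential. -/
  d₀ : I₀ ⟶ I₁
  /-- The second differential. -/
  d₁ : I₁ ⟶ I₂
  /-- The sheaf of cocycles. -/
  Z : X.Modules
  /-- The inclusion of the cocycles. -/
  i : Z ⟶ sheafHom F I₁
  /-- The class of a cocycle. -/
  p : Z ⟶ sheafExt F G 1
  injective : Injective I₀
  η_injective (V : X.Opens) : Function.Injective (η.app V)
  d₀_η (V : X.Opens) (s : Γ(G, V)) : d₀.app V (η.app V s) = 0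
  exact₀ (V : X.Opens) (s : Γ(I₀, V)) : d₀.app V s = 0 → ∃ t, η.app V t = s
  d₁_d₀ (V : X.Opens) (s : Γ(I₀, V)) : d₁.app V (d₀.app V s) = 0
  exact₁ (V : X.Opens) (s : Γ(I₁, V)) : d₁.app V s = 0 → ∀ q ∈ V,
    ∃ (W : X.Opens) (h : W ≤ V) (_ : q ∈ W) (t : Γ(I₀, W)),
      d₀.app W t = I₁.presheaf.map (homOfLE h).op s
  exists_i_eq (V : X.Opens) (φ : LocalHom F I₁ V) : φ.postcomp d₁ = 0 → ∃ c, i.app V c = φ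
  i_closed (V : X.Opens) (c : Γ(Z, V)) : LocalHom.postcomp d₁ (i.app V c : LocalHom F I₁ V) = 0
  p_surjective (V : X.Opens) (e : Γ(sheafExt F G 1, V)) : ∀ q ∈ V,
    ∃ (W : X.Opens) (h : W ≤ V) (_ : q ∈ W) (c : Γ(Z, W)),
      p.app W c = (sheafExt F G 1).presheaf.map (homOfLE h).op e
  exists_lift (V : X.Opens) (c : Γ(Z, V)) : p.app V c = 0 → ∀ q ∈ V,
    ∃ (W : X.Opens) (h : W ≤ V) (_ : q ∈ W) (ψ : LocalHom F I₀ W),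
      ψ.postcomp d₀ = LocalHom.res h (i.app V c : LocalHom F I₁ V)
  p_eq_zero (V : X.Opens) (c : Γ(Z, V)) (ψ : LocalHom F I₀ V) :
    i.app V c = ψ.postcomp d₀ → p.app V c = 0

lemma nonempty_extPresentation (F G : X.Modules) : Nonempty (ExtPresentation F G) := by
  let I : InjectiveResolution G := (HasInjectiveResolution.out (Z := G)).some
  let K := ((sheafHomFunctor F).mapHomologicalComplex _).obj I.cocomplex
  let S := K.sc' 0 1 2
  let e : sheafExt F G 1 ≅ S.homology := I.isoRightDerivedObj (sheafHomFunctor F) 1 ≪≫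
    ShortComplex.homologyMapIso (K.isoSc' 0 1 2 (by simp) (by simp))
  have hker : (ShortComplex.mk S.iCycles S.g (by simp)).Exact :=
    ShortComplex.exact_of_f_is_kernel _ S.cyclesIsKernel
  have hcok : (ShortComplex.mk S.toCycles S.homologyπ (by simp)).Exact :=
    ShortComplex.exact_of_g_is_cokernel _ S.homologyIsCokernel
  let η : G ⟶ I.cocomplex.X 0 := I.ι.f 0
  have hη : η ≫ I.cocomplex.d 0 1 = 0 := I.ι_f_zero_comp_complex_d
  have : Mono η := inferInstanceAs (Mono (I.ι.f 0))
  have h0 : (ShortComplex.mk η (I.cocomplex.d 0 1) hη).Exact :=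
    ShortComplex.exact_of_f_is_kernel _ I.isLimitKernelFork
  have h1 : (ShortComplex.mk (I.cocomplex.d 0 1) (I.cocomplex.d 1 2) (by simp)).Exact :=
    I.exact_succ 0
  have toCycles_apply {V : X.Opens} (ψ : LocalHom F (I.cocomplex.X 0) V) :
      (S.iCycles.app V (S.toCycles.app V ψ) : LocalHom F (I.cocomplex.X 1) V) =
        ψ.postcomp (I.cocomplex.d 0 1) :=
    ConcreteCategory.congr_hom (congr_arg (fun k => Scheme.Modules.Hom.app k V) S.toCycles_i) ψ
  have comp_apply_eq_zero {L M N : X.Modules} {f : L ⟶ M} {g : M ⟶ N} (h : f ≫ g = 0)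
      {V : X.Opens} (s : Γ(L, V)) : g.app V (f.app V s) = 0 :=
    ConcreteCategory.congr_hom (congr_arg (fun k => Scheme.Modules.Hom.app k V) h) s
  have e_inv {V : X.Opens} (s : Γ(S.homology, V)) : e.inv.app V s = 0 ↔ s = 0 :=
    ⟨fun h => injective_app_of_mono e.inv V (h.trans (map_zero _).symm),
      fun h => by rw [h, map_zero]⟩
  exact ⟨{
    I₀ := I.cocomplex.X 0
    I₁ := I.cocomplex.X 1
    I₂ := I.cocomplex.X 2
    η := η
    d₀ := I.cocomplex.d 0 1
    d₁ := I.cocomplex.d 1 2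
    Z := S.cycles
    i := S.iCycles
    p := S.homologyπ ≫ e.inv
    injective := I.injective 0
    η_injective := injective_app_of_mono η
    d₀_η V s := comp_apply_eq_zero hη s
    exact₀ V s hs := (sections_exact_of_mono_of_exact h0 V).2 s hs
    d₁_d₀ V s := comp_apply_eq_zero (I.cocomplex.d_comp_d 0 1 2) s
    exact₁ V s hs q hq := exists_app_eq_of_exact h1 s hs q hq
    exists_i_eq V φ hφ := (sections_exact_of_mono_of_exact hker V).2 φ hφ
    i_closed V c := comp_apply_eq_zero S.iCycles_g c
    p_surjective V s q hq := exists_app_eq_of_epi (S.homologyπ ≫ e.inv) s q hq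
    exists_lift V c hc q hq := by
      obtain ⟨W, h, hqW, ψ, hψ⟩ := exists_app_eq_of_exact hcok c ((e_inv _).1 hc) q hq
      refine ⟨W, h, hqW, ψ, (toCycles_apply ψ).symm.trans ?_⟩
      exact (congr_arg (S.iCycles.app W) hψ).trans (hom_app_res S.iCycles h c)
    p_eq_zero V c ψ h := by
      have hc : c = S.toCycles.app V ψ :=
        injective_app_of_mono S.iCycles V (h.trans (toCycles_apply ψ).symm)
      rw [hc]
      exact (e_inv _).2 (comp_apply_eq_zero S.toCycles_comp_homologyπ ψ) }⟩

end Ext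

/-! ### Morphisms out of the sheaf of relative differentials -/

section Differentials

variable {S Y : Scheme.{u}} (π : Y ⟶ S)

/-- The universal derivation `𝒪_Y ⟶ Ω¹_{Y/S}` on sections over `V`. -/
def relD (V : Y.Opens) : Γ(Y, V) →+ Γ(relativeDifferentials π, V) :=
  (sheafifyUnit (PresheafOfModules.DifferentialsConstruction.relativeDifferentials'
    (inverseImageToStructure π)) V).toAddMonoidHom.comp
    ((PresheafOfModules.DifferentialsConstruction.derivation' (inverseImageToStructure π)).d
      (X := .op V))

lemma relD_mul (V : Y.Opens) (a b : Γ(Y, V)) :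
    relD π V (a * b) = a • relD π V b + b • relD π V a := by
  refine (congr_arg (sheafifyUnit _ V) (PresheafOfModules.Derivation.d_mul _ a b)).trans ?_
  refine (map_add (sheafifyUnit _ V) _ _).trans ?_
  exact congr_arg₂ (· + ·) (map_smul (sheafifyUnit _ V) _ _) (map_smul (sheafifyUnit _ V) _ _)

lemma relD_map {V W : Y.Opens} (h : W ≤ V) (a : Γ(Y, V)) :
    relD π W (Y.presheaf.map (homOfLE h).op a) =
      (relativeDifferentials π).presheaf.map (homOfLE h).op (relD π V a) := by
  refine Eq.trans ?_ (map_sheafifyUnit _ h _).symm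
  exact congr_arg (sheafifyUnit _ W) (PresheafOfModules.Derivation.d_map _ (homOfLE h).op a)

/-- The morphism `π⁻¹𝒪_S ⟶ 𝒪_Y` extends the morphism `𝒪_S ⟶ π_* 𝒪_Y`. -/
lemma inverseImageToStructure_unit (U : S.Opens) (s : Γ(S, U)) :
    (inverseImageToStructure π).app (.op (π ⁻¹ᵁ U))
      (((TopCat.Presheaf.pullbackPushforwardAdjunction CommRingCat.{u} π.base).unit.app
        S.presheaf).app (.op U) s) = π.app U s := by
  have h := ((TopCat.Presheaf.pullbackPushforwardAdjunction CommRingCat.{u} π.base).homEquiv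
    S.presheaf Y.presheaf).apply_symm_apply π.c
  rw [Adjunction.homEquiv_unit] at h
  exact ConcreteCategory.congr_hom (NatTrans.congr_app h (.op U)) s

lemma relD_app {U : S.Opens} {V : Y.Opens} (hV : V ≤ π ⁻¹ᵁ U) (s : Γ(S, U)) :
    relD π V (Y.presheaf.map (homOfLE hV).op (π.app U s)) = 0 := by
  rw [relD_map, ← inverseImageToStructure_unit]
  have h : relD π (π ⁻¹ᵁ U) ((inverseImageToStructure π).app (.op (π ⁻¹ᵁ U))
      (((TopCat.Presheaf.pullbackPushforwardAdjunction CommRingCat.{u} π.base).unit.app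
        S.presheaf).app (.op U) s)) = 0 :=
    (congr_arg (sheafifyUnit _ _) (PresheafOfModules.Derivation'.d_app _ _)).trans (map_zero _)
  rw [h, map_zero]

variable {π} {G : Y.Modules} {U : Y.Opens}

/-- The sheaf `Ω¹_{Y/S}` is generated by the differentials of functions. -/
lemma localHom_relativeDifferentials_ext {φ ψ : LocalHom (relativeDifferentials π) G U}
    (h : ∀ V (hV : V ≤ U) (r : Γ(Y, V)), φ.app V hV (relD π V r) = ψ.app V hV (relD π V r)) :
    φ = ψ := by
  refine localHom_sheafify_ext fun V hV s => ?_
  let u := sheafifyUnit (PresheafOfModules.DifferentialsConstruction.relativeDifferentials'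
    (inverseImageToStructure π)) V
  let toHom (θ : LocalHom (relativeDifferentials π) G U) :
      CommRingCat.KaehlerDifferential ((inverseImageToStructure π).app (.op V)) ⟶
        ModuleCat.of Γ(Y, V) Γ(G, V) :=
    ModuleCat.ofHom (X := CommRingCat.KaehlerDifferential _)
      { toFun s := θ.app V hV (u s)
        map_add' s t := (congr_arg (θ.app V hV) (u.map_add s t)).trans
          ((θ.app V hV).map_add _ _)
        map_smul' r s := (congr_arg (θ.app V hV) (u.map_smul r s)).trans
          ((θ.app V hV).map_smul _ _) }
  have : toHom φ = toHom ψ := CommRingCat.KaehlerDifferential.ext fun r => h V hV r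
  exact ConcreteCategory.congr_hom this s

variable (π G U) in
/-- A derivation `𝒪_Y|_U ⟶ G|_U` relative to `S`. -/
structure LocalDerivation where
  /-- The component on an open subset `V` of `U`. -/
  d (V : Y.Opens) (hV : V ≤ U) : Γ(Y, V) →+ Γ(G, V)
  d_mul (V : Y.Opens) (hV : V ≤ U) (a b : Γ(Y, V)) : d V hV (a * b) = a • d V hV b + b • d V hV a
  d_map (V W : Y.Opens) (hV : V ≤ U) (hW : W ≤ V) (a : Γ(Y, V)) :
    d W (hW.trans hV) (Y.presheaf.map (homOfLE hW).op a) =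
      G.presheaf.map (homOfLE hW).op (d V hV a)
  d_app (V : Y.Opens) (hV : V ≤ U) (U' : S.Opens) (hU' : V ≤ π ⁻¹ᵁ U') (s : Γ(S, U')) :
    d V hV (Y.presheaf.map (homOfLE hU').op (π.app U' s)) = 0

namespace LocalDerivation

variable (D : LocalDerivation π G U)

/-- The subring of the sections which are killed, together with their restrictions, by a derivation
which is only defined on the open subsets of `U`. -/
def constants (V : Y.Opens) : Subring Γ(Y, V) where
  carrier := {r | ∀ W (hW : W ≤ V) (hU : W ≤ U), D.d W hU (Y.presheaf.map (homOfLE hW).op r) = 0}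
  zero_mem' W hW hU := by rw [map_zero, map_zero]
  add_mem' ha hb W hW hU := by rw [map_add, map_add, ha, hb, add_zero]
  neg_mem' ha W hW hU := by rw [map_neg, map_neg, ha, neg_zero]
  one_mem' W hW hU := by
    rw [map_one]
    simpa using D.d_mul W hU 1 1
  mul_mem' ha hb W hW hU := by rw [map_mul, D.d_mul, ha, hb, smul_zero, smul_zero, add_zero]

/-- The presheaf of the rings of locally constant sections. -/
def constantsPresheaf : TopCat.Presheaf CommRingCat.{u} Y where
  obj V := .of (D.constants V.unop)
  map {V W} i := CommRingCat.ofHom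
    (((Y.presheaf.map i).hom.comp (D.constants V.unop).subtype).codRestrict (D.constants W.unop)
      fun r W' hW' hU => by
      have := r.2 W' (hW'.trans i.unop.le) hU
      refine Eq.trans ?_ this
      congr 1
      exact structure_map_map i.unop.le hW' r.1)
  map_id V := by
    refine CommRingCat.hom_ext (RingHom.ext fun r => Subtype.ext ?_)
    exact (ConcreteCategory.congr_hom (Y.presheaf.map_id V) r.1)
  map_comp f g := by
    refine CommRingCat.hom_ext (RingHom.ext fun r => Subtype.ext ?_)
    exact (ConcreteCategory.congr_hom (Y.presheaf.map_comp f g) r.1)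

/-- The inclusion of the locally constant sections in the structure sheaf. -/
def constantsι : D.constantsPresheaf ⟶ Y.presheaf where
  app V := CommRingCat.ofHom (D.constants V.unop).subtype

/-- The map from the structure sheaf of the base to the locally constant sections. -/
def toConstants : S.presheaf ⟶ (TopCat.Presheaf.pushforward CommRingCat.{u} π.base).obj
    D.constantsPresheaf where
  app U := CommRingCat.ofHom ((π.app U.unop).hom.codRestrict _ fun s W hW hU => D.d_app W hU _ hW s)
  naturality U V i := by
    ext s
    exact Subtype.ext (ConcreteCategory.congr_hom (π.c.naturality i) s)

/-- A derivation which kills the functions on open subsets of `S` kills the presheaf `π⁻¹𝒪_S`,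
because `𝒪_S ⟶ π_* 𝒪_Y` factors through the pushforward of the presheaf of locally constant sections. -/
lemma d_inverseImageToStructure (V : Y.Opens) (hV : V ≤ U)
    (s : ((TopCat.Presheaf.pullback CommRingCat.{u} π.base).obj S.presheaf).obj (.op V)) :
    D.d V hV ((inverseImageToStructure π).app (.op V) s) = 0 := by
  let adj := TopCat.Presheaf.pullbackPushforwardAdjunction CommRingCat.{u} π.base
  have h : inverseImageToStructure π =
      (adj.homEquiv _ _).symm D.toConstants ≫ D.constantsι := by
    rw [← Adjunction.homEquiv_naturality_right_symm]
    rfl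
  rw [h]
  have := (((adj.homEquiv _ _).symm D.toConstants).app (.op V) s).2 V le_rfl hV
  rwa [structure_map_self] at this

/-- The universal property of `Ω¹_{Y/S}`, over an open subset. -/
lemma exists_localHom : ∃ φ : LocalHom (relativeDifferentials π) G U,
    ∀ V (hV : V ≤ U) (r : Γ(Y, V)), φ.app V hV (relD π V r) = D.d V hV r := by
  let D' (V : Y.Opens) (hV : V ≤ U) : (ModuleCat.of Γ(Y, V) Γ(G, V)).Derivation
      ((inverseImageToStructure π).app (.op V)) :=
    ModuleCat.Derivation.mk (D.d V hV) (map_add _) (D.d_mul V hV)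
      (D.d_inverseImageToStructure V hV)
  have hD' (V : Y.Opens) (hV : V ≤ U) (r : Γ(Y, V)) :
      (D' V hV).desc (CommRingCat.KaehlerDifferential.d r) = D.d V hV r :=
    ModuleCat.Derivation.desc_d _ r
  obtain ⟨φ, hφ⟩ := exists_localHom_sheafify (G := G) (U := U)
    (P := PresheafOfModules.DifferentialsConstruction.relativeDifferentials'
      (inverseImageToStructure π)) (fun V hV => (D' V hV).desc.hom.toAddMonoidHom)
    (fun V hV r s => (D' V hV).desc.hom.map_smul r s) (fun V W hV hW s => by
      let ρ := Y.presheaf.map (homOfLE hW).op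
      let f₁ : CommRingCat.KaehlerDifferential ((inverseImageToStructure π).app (.op V)) ⟶
          (ModuleCat.restrictScalars ρ.hom).obj (ModuleCat.of Γ(Y, W) Γ(G, W)) :=
        (PresheafOfModules.DifferentialsConstruction.relativeDifferentials'
          (inverseImageToStructure π)).map (homOfLE hW).op ≫
          (ModuleCat.restrictScalars ρ.hom).map (D' W (hW.trans hV)).desc
      let f₂ : ModuleCat.of Γ(Y, V) Γ(G, V) ⟶
          (ModuleCat.restrictScalars ρ.hom).obj (ModuleCat.of Γ(Y, W) Γ(G, W)) :=
        ModuleCat.ofHom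
          (Y := (ModuleCat.restrictScalars ρ.hom).obj (ModuleCat.of Γ(Y, W) Γ(G, W)))
          { toFun s := G.presheaf.map (homOfLE hW).op s
            map_add' := map_add _
            map_smul' r s := G.map_smul (homOfLE hW) r s }
      have : f₁ = (D' V hV).desc ≫ f₂ := CommRingCat.KaehlerDifferential.ext fun r => by
        refine (congr_arg (D' W (hW.trans hV)).desc
          (PresheafOfModules.DifferentialsConstruction.relativeDifferentials'_map_d _ _ r)).trans ?_
        refine (hD' W _ _).trans ((D.d_map V W hV hW r).trans ?_)
        exact congr_arg (G.presheaf.map (homOfLE hW).op) (hD' V hV r).symm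
      exact ConcreteCategory.congr_hom this s)
  exact ⟨φ, fun V hV r => (hφ V hV _).trans (hD' V hV r)⟩

end LocalDerivation

end Differentials

/-! ### The algebra `A[x, y, z] / (x y - z ^ (n + 1))` -/

section AnAlgebra

/-- The `A`-algebra `R`, with structure map `ρ`, is presented by the generators `x`, `y`, `z` and
the relation `x y = z ^ (n + 1)`. -/
structure IsAnAlgebra (n : ℕ) {A R : Type u} [CommRing A] [CommRing R] (ρ : A →+* R) (x y z : R) :
    Prop where
  surjective : Function.Surjective (MvPolynomial.eval₂Hom ρ ![x, y, z])
  ker : RingHom.ker (MvPolynomial.eval₂Hom ρ ![x, y, z]) = anIdeal n A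

namespace IsAnAlgebra

variable {n : ℕ} {A R : Type u} [CommRing A] [CommRing R] {ρ : A →+* R} {x y z : R}

section

variable (h : IsAnAlgebra n ρ x y z)
include h

lemma rel : x * y = z ^ (n + 1) := by
  have h1 : (MvPolynomial.X 0 * MvPolynomial.X 1 - MvPolynomial.X 2 ^ (n + 1) :
      MvPolynomial (Fin 3) A) ∈ RingHom.ker (MvPolynomial.eval₂Hom ρ ![x, y, z]) := by
    rw [h.ker]
    exact Ideal.subset_span rfl
  simpa [RingHom.mem_ker, sub_eq_zero] using h1

lemma exists_of_eval_eq_zero {p : MvPolynomial (Fin 3) A}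
    (hp : MvPolynomial.eval₂Hom ρ ![x, y, z] p = 0) :
    ∃ q, p = (MvPolynomial.X 0 * MvPolynomial.X 1 - MvPolynomial.X 2 ^ (n + 1)) * q := by
  have h1 : p ∈ RingHom.ker (MvPolynomial.eval₂Hom ρ ![x, y, z]) := hp
  rw [h.ker, anIdeal, Ideal.mem_span_singleton] at h1
  exact h1

@[elab_as_elim]
lemma induction {P : R → Prop} (C : ∀ a, P (ρ a)) (add : ∀ r s, P r → P s → P (r + s))
    (mul_x : ∀ r, P r → P (r * x)) (mul_y : ∀ r, P r → P (r * y)) (mul_z : ∀ r, P r → P (r * z))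
    (r : R) : P r := by
  obtain ⟨p, rfl⟩ := h.surjective r
  induction p using MvPolynomial.induction_on with
  | C a => simpa using C a
  | add p q hp hq => rw [map_add]; exact add _ _ hp hq
  | mul_X p i hp =>
    rw [map_mul]
    fin_cases i
    · simpa using mul_x _ hp
    · simpa using mul_y _ hp
    · simpa using mul_z _ hp

lemma eq_zero_of_mul_pow (a : A) (ha : ρ a * z ^ (n + 1) = 0) : a = 0 := by
  obtain ⟨q, hq⟩ := h.exists_of_eval_eq_zero (p := MvPolynomial.C a * MvPolynomial.X 2 ^ (n + 1))
    (by simpa using ha)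
  -- The section `x = z ^ (n + 1)`, `y = 1` of the projection to the `z`-axis.
  have := congr_arg (MvPolynomial.eval₂Hom (Polynomial.C (R := A))
    ![Polynomial.X ^ (n + 1), 1, Polynomial.X]) hq
  simp only [map_mul, map_sub, map_pow, MvPolynomial.eval₂Hom_C, MvPolynomial.eval₂Hom_X',
    Matrix.cons_val, mul_one, sub_self, zero_mul] at this
  simpa using congr_arg (fun p => Polynomial.coeff p (n + 1)) this

lemma mem_nonZeroDivisors : y ∈ nonZeroDivisors R := by
  rw [mem_nonZeroDivisors_iff_right]
  intro r hr
  obtain ⟨p, rfl⟩ := h.surjective r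
  obtain ⟨q, hq⟩ := h.exists_of_eval_eq_zero (p := p * MvPolynomial.X 1) (by simpa using hr)
  -- The substitution `y = 0` kills exactly the multiples of `y`.
  let s := MvPolynomial.eval₂Hom (MvPolynomial.C (R := A))
    ![MvPolynomial.X 0, 0, (MvPolynomial.X 2 : MvPolynomial (Fin 3) A)]
  have hs (f : MvPolynomial (Fin 3) A) : MvPolynomial.X 1 ∣ f - s f := by
    induction f using MvPolynomial.induction_on with
    | C a => simp [s]
    | add p q hp hq =>
      rw [map_add, add_sub_add_comm]
      exact dvd_add hp hq
    | mul_X p i hp =>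
      rw [map_mul]
      fin_cases i
      · simpa [s, sub_mul] using hp.mul_right (MvPolynomial.X 0)
      · simp [s]
      · simpa [s, sub_mul] using hp.mul_right (MvPolynomial.X 2)
  have h1 := congr_arg s hq
  have h2 : s q = 0 := by
    simp only [s, map_mul, map_sub, map_pow, MvPolynomial.eval₂Hom_X', Matrix.cons_val, mul_zero,
      zero_sub, neg_mul, zero_eq_neg] at h1
    exact (MvPolynomial.isRegular_X_pow (n + 1)).left.mul_left_eq_zero_iff.1 h1
  obtain ⟨q', hq'⟩ : MvPolynomial.X 1 ∣ q := by simpa [h2] using hs q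
  have h3 : p = (MvPolynomial.X 0 * MvPolynomial.X 1 - MvPolynomial.X 2 ^ (n + 1)) * q' := by
    rw [← MvPolynomial.X_mul_cancel_left_iff (i := 1), mul_comm _ p, hq, hq']
    ring
  rw [h3, map_mul]
  simp [h.rel]

/-- Together with `eq_zero_of_mem_span`: the quotient of `R` by the ideal `(x, y, z ^ n)` is free
over `A` with basis `1`, `z`, …, `z ^ (n - 1)`. -/
lemma exists_sub_mem_span (hn : 1 ≤ n) (r : R) : ∃ a : Fin n → A,
    r - ∑ k, ρ (a k) * z ^ (k : ℕ) ∈ Ideal.span {x, y, z ^ n} := by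
  obtain ⟨m, rfl⟩ : ∃ m, n = m + 1 := ⟨n - 1, by omega⟩
  have hx : x ∈ Ideal.span {x, y, z ^ (m + 1)} := Ideal.subset_span (by simp)
  have hy : y ∈ Ideal.span {x, y, z ^ (m + 1)} := Ideal.subset_span (by simp)
  have hz : z ^ (m + 1) ∈ Ideal.span {x, y, z ^ (m + 1)} := Ideal.subset_span (by simp)
  induction r using h.induction with
  | C a => exact ⟨Fin.cons a 0, by simp [Fin.sum_univ_succ]⟩
  | add r s hr hs =>
    obtain ⟨a, ha⟩ := hr
    obtain ⟨b, hb⟩ := hs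
    refine ⟨a + b, ?_⟩
    convert add_mem ha hb using 1
    simp only [Pi.add_apply, map_add, add_mul, Finset.sum_add_distrib]
    ring
  | mul_x r hr => exact ⟨0, by simpa using Ideal.mul_mem_left _ r hx⟩
  | mul_y r hr => exact ⟨0, by simpa using Ideal.mul_mem_left _ r hy⟩
  | mul_z r hr =>
    obtain ⟨a, ha⟩ := hr
    refine ⟨Fin.cons 0 fun k => a k.castSucc, ?_⟩
    convert add_mem (Ideal.mul_mem_right z _ ha) (Ideal.mul_mem_left _ (ρ (a (Fin.last m))) hz)
      using 1
    rw [Fin.sum_univ_succ, Fin.sum_univ_castSucc, sub_mul, add_mul, Finset.sum_mul]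
    simp only [Fin.cons_zero, Fin.cons_succ, Fin.val_succ, Fin.val_castSucc, Fin.val_last, map_zero,
      zero_mul, pow_succ, mul_assoc]
    ring

lemma eq_zero_of_mem_span (a : Fin n → A)
    (ha : ∑ k, ρ (a k) * z ^ (k : ℕ) ∈ Ideal.span {x, y, z ^ n}) : a = 0 := by
  let ev := MvPolynomial.eval₂Hom ρ ![x, y, z]
  -- The section `x = y = 0` of the projection to the `z`-axis.
  let s := MvPolynomial.eval₂Hom (Polynomial.C (R := A)) ![0, 0, Polynomial.X]
  rw [Ideal.mem_span_insert] at ha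
  obtain ⟨c₁, _, ha, e₁⟩ := ha
  rw [Ideal.mem_span_pair] at ha
  obtain ⟨c₂, c₃, rfl⟩ := ha
  obtain ⟨p₁, rfl⟩ := h.surjective c₁
  obtain ⟨p₂, rfl⟩ := h.surjective c₂
  obtain ⟨p₃, rfl⟩ := h.surjective c₃
  obtain ⟨q, hq⟩ := h.exists_of_eval_eq_zero
    (p := ∑ k : Fin n, MvPolynomial.C (a k) * MvPolynomial.X 2 ^ (k : ℕ) -
      (p₁ * MvPolynomial.X 0 + (p₂ * MvPolynomial.X 1 + p₃ * MvPolynomial.X 2 ^ n))) (by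
    simp only [map_sub, map_sum, map_add, map_mul, map_pow, MvPolynomial.eval₂Hom_C,
      MvPolynomial.eval₂Hom_X', Matrix.cons_val]
    rw [e₁, sub_self])
  have h1 := congr_arg s hq
  simp only [s, map_sub, map_sum, map_add, map_mul, map_pow, MvPolynomial.eval₂Hom_C,
    MvPolynomial.eval₂Hom_X', Matrix.cons_val, mul_zero, zero_add, zero_sub] at h1
  have h2 : Polynomial.X ^ n ∣ ∑ k : Fin n, Polynomial.C (a k) * Polynomial.X ^ (k : ℕ) := by
    rw [eq_add_of_sub_eq h1]
    exact dvd_add (((dvd_refl _).trans (pow_dvd_pow _ n.le_succ)).neg_right.mul_right _)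
      (dvd_mul_left _ _)
  rw [Polynomial.X_pow_dvd_iff] at h2
  funext k
  have h3 := h2 k k.2
  simpa [Polynomial.finsetSum_coeff, Polynomial.coeff_C_mul, Polynomial.coeff_X_pow,
    Fin.val_inj] using h3

/-- A derivation on a localization `B` of `R` is determined by its values on `ρ(A)`, `x`, `y`, `z`.
The ring `B'` allows for derivations into a module of sections over a smaller open subset. -/
lemma derivation_eq_zero {B B' M : Type*} [CommRing B] [CommRing B'] [AddCommGroup M] [Module B' M]
    (θ : R →+* B) (hθ : ∀ b, ∃ r s, IsUnit (θ s) ∧ θ s * b = θ r) (σ : B →+* B') (D : B →+ M)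
    (hD : ∀ a b, D (a * b) = σ a • D b + σ b • D a) (hA : ∀ a, D (θ (ρ a)) = 0)
    (hx : D (θ x) = 0) (hy : D (θ y) = 0) (hz : D (θ z) = 0) (b : B) : D b = 0 := by
  have key (r : R) : D (θ r) = 0 := by
    induction r using h.induction with
    | C a => exact hA a
    | add r s hr hs => rw [map_add, map_add, hr, hs, add_zero]
    | mul_x r hr => rw [map_mul, hD, hr, hx, smul_zero, smul_zero, add_zero]
    | mul_y r hr => rw [map_mul, hD, hr, hy, smul_zero, smul_zero, add_zero]
    | mul_z r hr => rw [map_mul, hD, hr, hz, smul_zero, smul_zero, add_zero]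
  obtain ⟨r, s, hs, hb⟩ := hθ b
  have := congr_arg D hb
  rw [key, hD, key, smul_zero, add_zero] at this
  exact ((hs.map σ).smul_eq_zero).1 this

/-- The derivation on a localization `B` of `R` with prescribed values on `x`, `y`, `z` is
constructed as a homomorphism to the square zero extension of `B` by `M`. -/
lemma exists_derivation {B M : Type*} [CommRing B] [AddCommGroup M] [Module B M] [Algebra R B]
    (f : R) [IsLocalization.Away f B] (m₁ m₂ m₃ : M)
    (hm : algebraMap R B y • m₁ + algebraMap R B x • m₂ -
      ((n + 1 : ℕ) * algebraMap R B z ^ n) • m₃ = 0) :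
    ∃ D : B →+ M, (∀ a b, D (a * b) = a • D b + b • D a) ∧
      (∀ a, D (algebraMap R B (ρ a)) = 0) ∧ D (algebraMap R B x) = m₁ ∧
      D (algebraMap R B y) = m₂ ∧ D (algebraMap R B z) = m₃ := by
  let : Module Bᵐᵒᵖ M := Module.compHom M ((RingHom.id B).fromOpposite fun _ _ => mul_comm _ _)
  have : IsCentralScalar B M := ⟨fun _ _ => rfl⟩
  let ev := MvPolynomial.eval₂Hom ρ ![x, y, z]
  let θ := algebraMap R B
  let g : MvPolynomial (Fin 3) A →+* TrivSqZeroExt B M :=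
    MvPolynomial.eval₂Hom ((TrivSqZeroExt.inlHom B M).comp (θ.comp ρ))
      ![TrivSqZeroExt.inl (θ x) + TrivSqZeroExt.inr m₁,
        TrivSqZeroExt.inl (θ y) + TrivSqZeroExt.inr m₂,
        TrivSqZeroExt.inl (θ z) + TrivSqZeroExt.inr m₃]
  have hg : RingHom.ker ev ≤ RingHom.ker g := by
    rw [h.ker, anIdeal, Ideal.span_le, Set.singleton_subset_iff]
    change g _ = 0
    ext
    · simp [g, ← map_mul, h.rel]
    · have e : θ y • m₁ + θ x • m₂ - (n + 1) • θ z ^ n • m₃ = 0 := by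
        rw [← hm, ← Nat.cast_smul_eq_nsmul B, smul_smul]
      simpa [g, TrivSqZeroExt.snd_pow, add_comm] using e
  let g₁ : R →+* TrivSqZeroExt B M := RingHom.liftOfSurjective ev h.surjective ⟨g, hg⟩
  have hg₁ (p) : g₁ (ev p) = g p := RingHom.liftOfRightInverse_comp_apply _ _ _ ⟨g, hg⟩ p
  have hfst (r : R) : (g₁ r).fst = θ r := by
    obtain ⟨p, rfl⟩ := h.surjective r
    change (g₁ (ev p)).fst = θ (ev p)
    rw [hg₁]
    change ((TrivSqZeroExt.fstHom B B M).toRingHom.comp g) p = (θ.comp ev) p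
    congr 1
    refine MvPolynomial.ringHom_ext (fun a => ?_) fun i => ?_
    · simp [g, ev]
    · fin_cases i <;> simp [g, ev]
  have hu : IsUnit (g₁ f) := by
    rw [TrivSqZeroExt.isUnit_iff_isUnit_fst, hfst]
    exact IsLocalization.Away.algebraMap_isUnit f
  let g₂ : B →+* TrivSqZeroExt B M := IsLocalization.Away.lift f hu
  have hg₂ (r : R) : g₂ (algebraMap R B r) = g₁ r := IsLocalization.Away.lift_eq f hu r
  have hfst₂ (b : B) : (g₂ b).fst = b := by
    change ((TrivSqZeroExt.fstHom B B M).toRingHom.comp g₂) b = RingHom.id B b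
    congr 1
    refine IsLocalization.ringHom_ext (Submonoid.powers f) (RingHom.ext fun r => ?_)
    exact (congr_arg TrivSqZeroExt.fst (hg₂ r)).trans (hfst r)
  refine ⟨⟨⟨fun b => (g₂ b).snd, by simp⟩, by simp⟩, fun a b => ?_, fun a => ?_, ?_, ?_, ?_⟩
  · change (g₂ (a * b)).snd = a • (g₂ b).snd + b • (g₂ a).snd
    rw [map_mul, TrivSqZeroExt.snd_mul, hfst₂, hfst₂, op_smul_eq_smul]
  · change (g₂ _).snd = 0
    have := hg₁ (MvPolynomial.C a)
    simp only [ev, g, MvPolynomial.eval₂Hom_C] at this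
    rw [hg₂, this]
    simp
  · change (g₂ _).snd = m₁
    have := hg₁ (MvPolynomial.X 0)
    simp only [ev, g, MvPolynomial.eval₂Hom_X', Matrix.cons_val] at this
    rw [hg₂, this]
    simp
  · change (g₂ _).snd = m₂
    have := hg₁ (MvPolynomial.X 1)
    simp only [ev, g, MvPolynomial.eval₂Hom_X', Matrix.cons_val] at this
    rw [hg₂, this]
    simp
  · change (g₂ _).snd = m₃
    have := hg₁ (MvPolynomial.X 2)
    simp only [ev, g, MvPolynomial.eval₂Hom_X', Matrix.cons_val] at this
    rw [hg₂, this]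
    simp

/-- The presentation is compatible with localization at an element of `A`. -/
lemma localization {A' R' : Type u} [CommRing A'] [CommRing R'] (a : A) [Algebra A A']
    [Algebra R R'] [IsLocalization.Away a A'] [IsLocalization.Away (ρ a) R'] (ρ' : A' →+* R')
    (hρ : ∀ b, ρ' (algebraMap A A' b) = algebraMap R R' (ρ b)) :
    IsAnAlgebra n ρ' (algebraMap R R' x) (algebraMap R R' y) (algebraMap R R' z) := by
  let F (B : Type u) [CommRing B] : MvPolynomial (Fin 3) B :=
    MvPolynomial.X 0 * MvPolynomial.X 1 - MvPolynomial.X 2 ^ (n + 1)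
  let ev := MvPolynomial.eval₂Hom ρ ![x, y, z]
  let ev' := MvPolynomial.eval₂Hom ρ' ![algebraMap R R' x, algebraMap R R' y, algebraMap R R' z]
  let μ := MvPolynomial.map (σ := Fin 3) (algebraMap A A')
  have hev (p) : ev' (μ p) = algebraMap R R' (ev p) := by
    change (ev'.comp μ) p = ((algebraMap R R').comp ev) p
    congr 1
    refine MvPolynomial.ringHom_ext (fun a => ?_) fun i => ?_
    · simp [ev, ev', μ, hρ]
    · fin_cases i <;> simp [ev, ev', μ]
  have hF : ev' (F A') = 0 := by
    simp [ev', F, ← map_mul, ← map_pow, h.rel]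
  constructor
  · intro r'
    obtain ⟨k, r, hr⟩ := IsLocalization.Away.surj (ρ a) r'
    obtain ⟨p, rfl⟩ := h.surjective r
    obtain ⟨b, hb⟩ := (IsLocalization.Away.algebraMap_isUnit (S := A') a).exists_right_inv
    refine ⟨MvPolynomial.C (b ^ k) * μ p, ?_⟩
    change ev' _ = r'
    rw [map_mul, hev]
    change _ * algebraMap R R' (MvPolynomial.eval₂Hom ρ ![x, y, z] p) = _
    rw [← hr, ← hρ]
    simp only [ev', MvPolynomial.eval₂Hom_C, map_pow]
    rw [mul_left_comm, ← mul_pow, ← map_mul, mul_comm b, hb, map_one, one_pow, mul_one]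
  · refine le_antisymm (fun p' hp' => ?_) ?_
    · replace hp' : ev' p' = 0 := hp'
      let := MvPolynomial.algebraMvPolynomial (R := A) (S := A') (σ := Fin 3)
      obtain ⟨⟨p, s⟩, hp⟩ := IsLocalization.surj (S := MvPolynomial (Fin 3) A')
        ((Submonoid.powers a).map (MvPolynomial.C (σ := Fin 3))) p'
      obtain ⟨_, _, ⟨k, rfl⟩, rfl⟩ := s
      replace hp : p' * MvPolynomial.C (algebraMap A A' a) ^ k = μ p := by
        rw [← map_pow, ← map_pow, ← MvPolynomial.map_C]
        exact hp
      have h0 : algebraMap R R' (ev p) = 0 := by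
        rw [← hev, ← hp, map_mul, hp', zero_mul]
      rw [IsLocalization.map_eq_zero_iff (Submonoid.powers (ρ a)) R'] at h0
      obtain ⟨⟨_, m, rfl⟩, hm⟩ := h0
      obtain ⟨q, hq⟩ := h.exists_of_eval_eq_zero (p := MvPolynomial.C (a ^ m) * p) (by
        rw [map_mul, MvPolynomial.eval₂Hom_C, map_pow]
        exact hm)
      have hq' := congr_arg μ hq
      rw [map_mul, ← hp] at hq'
      have hu : IsUnit (MvPolynomial.C (σ := Fin 3) (algebraMap A A' a)) :=
        (IsLocalization.Away.algebraMap_isUnit a).map _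
      have h3 : p' * MvPolynomial.C (algebraMap A A' a) ^ (m + k) ∈ anIdeal n A' := by
        rw [anIdeal, Ideal.mem_span_singleton]
        refine ⟨μ q, ?_⟩
        rw [pow_add, mul_left_comm]
        simpa [μ] using hq'
      exact (Ideal.mul_unit_mem_iff_mem _ (hu.pow _)).1 h3
    · rw [anIdeal, Ideal.span_le, Set.singleton_subset_iff]
      exact hF

end

end IsAnAlgebra

end AnAlgebra

/-! ### Charts -/

section AffineLocal

variable {X : Scheme.{u}} {U : X.Opens}

lemma exists_basicOpen_le (hU : IsAffineOpen U) {V : X.Opens} (hV : V ≤ U) {p : X} (hp : p ∈ V) :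
    ∃ f : Γ(X, U), X.basicOpen f ≤ V ∧ p ∈ X.basicOpen f :=
  hU.exists_basicOpen_le ⟨p, hp⟩ (hV hp)

lemma exists_num_denom (hU : IsAffineOpen U) (f : Γ(X, U)) {V : X.Opens} (hV : V ≤ U)
    (e : V = X.basicOpen f) (b : Γ(X, V)) :
    ∃ r s : Γ(X, U), IsUnit (X.presheaf.map (homOfLE hV).op s) ∧
      X.presheaf.map (homOfLE hV).op s * b = X.presheaf.map (homOfLE hV).op r := by
  let := (X.presheaf.map (homOfLE hV).op).hom.toAlgebra
  have := hU.isLocalization_of_eq_basicOpen f (homOfLE hV) e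
  obtain ⟨k, r, hr⟩ := IsLocalization.Away.surj f b
  refine ⟨r, f ^ k, ?_, ?_⟩
  · rw [map_pow]
    exact (IsLocalization.Away.algebraMap_isUnit (S := Γ(X, V)) f).pow k
  · rw [map_pow, mul_comm]
    exact hr

lemma exists_pow_mul_eq_zero (hU : IsAffineOpen U) (f : Γ(X, U)) {V : X.Opens} (hV : V ≤ U)
    (e : V = X.basicOpen f) (r : Γ(X, U)) (hr : X.presheaf.map (homOfLE hV).op r = 0) :
    ∃ k : ℕ, f ^ k * r = 0 := by
  let := (X.presheaf.map (homOfLE hV).op).hom.toAlgebra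
  have := hU.isLocalization_of_eq_basicOpen f (homOfLE hV) e
  obtain ⟨⟨_, k, rfl⟩, hk⟩ := (IsLocalization.map_eq_zero_iff (Submonoid.powers f) Γ(X, V) r).1 hr
  exact ⟨k, hk⟩

lemma isUnit_map_basicOpen (f : Γ(X, U)) {V : X.Opens} (hV : V ≤ X.basicOpen f) :
    IsUnit (X.presheaf.map (homOfLE (hV.trans (X.basicOpen_le f))).op f) := by
  have := (X.toRingedSpace.isUnit_res_basicOpen f).map (X.presheaf.map (homOfLE hV).op).hom
  rw [← structure_map_map (X.basicOpen_le f) hV]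
  exact this

lemma map_mem_nonZeroDivisors (hU : IsAffineOpen U) {y : Γ(X, U)} (hy : y ∈ nonZeroDivisors Γ(X, U))
    {V : X.Opens} (hV : V ≤ U) : X.presheaf.map (homOfLE hV).op y ∈ nonZeroDivisors Γ(X, V) := by
  rw [mem_nonZeroDivisors_iff_right]
  intro r hr
  refine eq_of_locally_eq (structureModule X) (s := r) (t := 0) fun p hp => ?_
  obtain ⟨f, hf, hpf⟩ := exists_basicOpen_le hU hV hp
  refine ⟨X.basicOpen f, hf, hpf, ?_⟩
  rw [map_zero]
  change X.presheaf.map (homOfLE hf).op r = 0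
  obtain ⟨a, s, hs, ha⟩ := exists_num_denom hU f (X.basicOpen_le f) rfl
    (X.presheaf.map (homOfLE hf).op r)
  have h0 : X.presheaf.map (homOfLE (X.basicOpen_le f)).op (a * y) = 0 := by
    rw [map_mul, ← ha, mul_assoc, ← structure_map_map hV hf y, ← map_mul, hr, map_zero, mul_zero]
  obtain ⟨k, hk⟩ := exists_pow_mul_eq_zero hU f _ rfl _ h0
  rw [← mul_assoc] at hk
  have h1 := congr_arg (X.presheaf.map (homOfLE (X.basicOpen_le f)).op)
    ((mul_right_mem_nonZeroDivisors_eq_zero_iff hy).1 hk)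
  rw [map_mul, map_pow, map_zero,
    ((isUnit_map_basicOpen f le_rfl).pow k).mul_right_eq_zero, ← ha, hs.mul_right_eq_zero] at h1
  exact h1

end AffineLocal

section Chart

variable {n : ℕ} {S Y : Scheme.{u}} {π : Y ⟶ S}

variable (n π) in
/-- Functions `x`, `y`, `z` on `π⁻¹V`, for an affine open subset `V` of `S`, which identify `π⁻¹V`
with the spectrum of `Γ(S, V)[x, y, z] / (x y - z ^ (n + 1))`. -/
structure IsAnChart (V : S.Opens) (x y z : Γ(Y, π ⁻¹ᵁ V)) : Prop where
  isAffineOpen : IsAffineOpen V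
  isAffineOpen_preimage : IsAffineOpen (π ⁻¹ᵁ V)
  isAnAlgebra : IsAnAlgebra n (π.app V).hom x y z

lemma app_res (π : Y ⟶ S) {V W : S.Opens} (h : W ≤ V) (s : Γ(S, V)) :
    π.app W (S.presheaf.map (homOfLE h).op s) =
      Y.presheaf.map (homOfLE (π.preimage_mono h)).op (π.app V s) :=
  ConcreteCategory.congr_hom (π.naturality (homOfLE h).op) s

namespace IsAnChart

variable {V : S.Opens} {x y z : Γ(Y, π ⁻¹ᵁ V)}

/-- A chart over `V` restricts to a chart over the basic open subsets of `V`. -/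
lemma basicOpen (h : IsAnChart n π V x y z) (a : Γ(S, V)) :
    IsAnChart n π (S.basicOpen a)
      (Y.presheaf.map (homOfLE (π.preimage_mono (S.basicOpen_le a))).op x)
      (Y.presheaf.map (homOfLE (π.preimage_mono (S.basicOpen_le a))).op y)
      (Y.presheaf.map (homOfLE (π.preimage_mono (S.basicOpen_le a))).op z) where
  isAffineOpen := h.isAffineOpen.basicOpen a
  isAffineOpen_preimage := by
    rw [Scheme.preimage_basicOpen]
    exact h.isAffineOpen_preimage.basicOpen _
  isAnAlgebra := by
    let := (S.presheaf.map (homOfLE (S.basicOpen_le a)).op).hom.toAlgebra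
    let := (Y.presheaf.map (homOfLE (π.preimage_mono (S.basicOpen_le a))).op).hom.toAlgebra
    have := h.isAffineOpen.isLocalization_of_eq_basicOpen a (homOfLE (S.basicOpen_le a)) rfl
    have := h.isAffineOpen_preimage.isLocalization_of_eq_basicOpen (π.app V a)
      (homOfLE (π.preimage_mono (S.basicOpen_le a))) (Scheme.preimage_basicOpen _ _)
    exact h.isAnAlgebra.localization a (π.app (S.basicOpen a)).hom
      fun b => app_res π (S.basicOpen_le a) b

section

variable (h : IsAnChart n π V x y z) {G : Y.Modules} {U : Y.Opens} (hU : U ≤ π ⁻¹ᵁ V)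
include h

lemma y_mem_nonZeroDivisors : Y.presheaf.map (homOfLE hU).op y ∈ nonZeroDivisors Γ(Y, U) :=
  map_mem_nonZeroDivisors h.isAffineOpen_preimage h.isAnAlgebra.mem_nonZeroDivisors hU

lemma derivation_eq_zero {W W' : Y.Opens} (f : Γ(Y, π ⁻¹ᵁ V)) (hW : W = Y.basicOpen f)
    (hWV : W ≤ π ⁻¹ᵁ V) (hW' : W' ≤ W) (D : Γ(Y, W) →+ Γ(G, W'))
    (hD : ∀ a b, D (a * b) = Y.presheaf.map (homOfLE hW').op a • D b +
      Y.presheaf.map (homOfLE hW').op b • D a)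
    (hA : ∀ a, D (Y.presheaf.map (homOfLE hWV).op (π.app V a)) = 0)
    (hx : D (Y.presheaf.map (homOfLE hWV).op x) = 0)
    (hy : D (Y.presheaf.map (homOfLE hWV).op y) = 0)
    (hz : D (Y.presheaf.map (homOfLE hWV).op z) = 0) (b : Γ(Y, W)) : D b = 0 :=
  h.isAnAlgebra.derivation_eq_zero (Y.presheaf.map (homOfLE hWV).op).hom
    (exists_num_denom h.isAffineOpen_preimage f hWV hW) (Y.presheaf.map (homOfLE hW').op).hom
    D hD hA hx hy hz b

/-- A morphism `Ω¹_{Y/S}|_U ⟶ G|_U` is determined by its values on `dx`, `dy` and `dz`. -/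
lemma localHom_eq_zero (φ : LocalHom (relativeDifferentials π) G U)
    (hx : φ.app U le_rfl (relD π U (Y.presheaf.map (homOfLE hU).op x)) = 0)
    (hy : φ.app U le_rfl (relD π U (Y.presheaf.map (homOfLE hU).op y)) = 0)
    (hz : φ.app U le_rfl (relD π U (Y.presheaf.map (homOfLE hU).op z)) = 0) : φ = 0 := by
  refine localHom_relativeDifferentials_ext fun W hW r => ?_
  refine eq_of_locally_eq G fun p hp => ?_
  obtain ⟨f, hf, hpf⟩ := exists_basicOpen_le h.isAffineOpen_preimage (hW.trans hU) hp
  refine ⟨Y.basicOpen f, hf, hpf, ?_⟩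
  rw [← φ.naturality, ← relD_map, LocalHom.zero_app, LinearMap.zero_apply, map_zero]
  have key (g : Γ(Y, π ⁻¹ᵁ V))
      (hg : φ.app U le_rfl (relD π U (Y.presheaf.map (homOfLE hU).op g)) = 0) :
      φ.app (Y.basicOpen f) (hf.trans hW) (relD π (Y.basicOpen f)
        (Y.presheaf.map (homOfLE (Y.basicOpen_le f)).op g)) = 0 := by
    rw [← structure_map_map hU (hf.trans hW), relD_map, φ.naturality le_rfl, hg, map_zero]
  refine h.derivation_eq_zero f rfl (Y.basicOpen_le f) le_rfl
    ((φ.app _ (hf.trans hW)).toAddMonoidHom.comp (relD π (Y.basicOpen f)))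
    (fun a b => ?_) (fun a => ?_) (key x hx) (key y hy) (key z hz) _
  · change φ.app _ _ (relD π _ (a * b)) = _ • φ.app _ _ (relD π _ b) + _ • φ.app _ _ (relD π _ a)
    rw [structure_map_self, structure_map_self, relD_mul, map_add, map_smul, map_smul]
  · change φ.app _ _ (relD π _ _) = 0
    rw [relD_app, map_zero]

end

end IsAnChart

end Chart

/-! ### Differentials in a chart -/

section Relation

variable {S Y : Scheme.{u}} (π : Y ⟶ S)

lemma relD_pow {U : Y.Opens} (z : Γ(Y, U)) (n : ℕ) :
    relD π U (z ^ (n + 1)) = ((n + 1 : ℕ) * z ^ n) • relD π U z := by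
  induction n with
  | zero => simp
  | succ n ih =>
    rw [pow_succ, relD_mul, ih, smul_smul, ← add_smul]
    congr 1
    push_cast
    ring

lemma relD_rel {U : Y.Opens} {x y z : Γ(Y, U)} {n : ℕ} (h : x * y = z ^ (n + 1)) :
    y • relD π U x + x • relD π U y - ((n + 1 : ℕ) * z ^ n) • relD π U z = 0 := by
  rw [← relD_pow, ← h, relD_mul, add_comm, sub_self]

end Relation

namespace IsAnChart

variable {n : ℕ} {S Y : Scheme.{u}} {π : Y ⟶ S} {V : S.Opens} {x y z : Γ(Y, π ⁻¹ᵁ V)}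
  (h : IsAnChart n π V x y z) {G : Y.Modules} {U : Y.Opens} (hU : U ≤ π ⁻¹ᵁ V)
include h

lemma exists_derivation_basicOpen (m₁ m₂ m₃ : Γ(G, U))
    (hm : Y.presheaf.map (homOfLE hU).op y • m₁ + Y.presheaf.map (homOfLE hU).op x • m₂ -
      ((n + 1 : ℕ) * Y.presheaf.map (homOfLE hU).op z ^ n) • m₃ = 0)
    (f : Γ(Y, π ⁻¹ᵁ V)) (hf : Y.basicOpen f ≤ U) :
    ∃ D : Γ(Y, Y.basicOpen f) →+ Γ(G, Y.basicOpen f),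
      (∀ a b, D (a * b) = a • D b + b • D a) ∧
      (∀ a, D (Y.presheaf.map (homOfLE (Y.basicOpen_le f)).op (π.app V a)) = 0) ∧
      D (Y.presheaf.map (homOfLE (Y.basicOpen_le f)).op x) = G.presheaf.map (homOfLE hf).op m₁ ∧
      D (Y.presheaf.map (homOfLE (Y.basicOpen_le f)).op y) = G.presheaf.map (homOfLE hf).op m₂ ∧
      D (Y.presheaf.map (homOfLE (Y.basicOpen_le f)).op z) = G.presheaf.map (homOfLE hf).op m₃ := by
  let := (Y.presheaf.map (homOfLE (Y.basicOpen_le f)).op).hom.toAlgebra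
  have := h.isAffineOpen_preimage.isLocalization_of_eq_basicOpen f
    (homOfLE (Y.basicOpen_le f)) rfl
  refine h.isAnAlgebra.exists_derivation f (G.presheaf.map (homOfLE hf).op m₁)
    (G.presheaf.map (homOfLE hf).op m₂) (G.presheaf.map (homOfLE hf).op m₃) ?_
  have := congr_arg (G.presheaf.map (homOfLE hf).op) hm
  rw [map_sub, map_add, Scheme.Modules.map_smul, Scheme.Modules.map_smul,
    Scheme.Modules.map_smul, map_mul, map_pow, map_natCast, structure_map_map, structure_map_map,
    structure_map_map, map_zero] at this
  exact this

/-- A morphism `Ω¹_{Y/S}|_U ⟶ G|_U` can take any values on `dx`, `dy`, `dz` which satisfy the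
relation obtained by differentiating `x y = z ^ (n + 1)`. -/
lemma exists_localHom (m₁ m₂ m₃ : Γ(G, U))
    (hm : Y.presheaf.map (homOfLE hU).op y • m₁ + Y.presheaf.map (homOfLE hU).op x • m₂ -
      ((n + 1 : ℕ) * Y.presheaf.map (homOfLE hU).op z ^ n) • m₃ = 0) :
    ∃ φ : LocalHom (relativeDifferentials π) G U,
      φ.app U le_rfl (relD π U (Y.presheaf.map (homOfLE hU).op x)) = m₁ ∧
      φ.app U le_rfl (relD π U (Y.presheaf.map (homOfLE hU).op y)) = m₂ ∧
      φ.app U le_rfl (relD π U (Y.presheaf.map (homOfLE hU).op z)) = m₃ := by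
  have hW := h.isAffineOpen_preimage
  -- The derivations on the basic open subsets are compatible, hence glue.
  choose D D_mul D_app D_x D_y D_z using h.exists_derivation_basicOpen hU m₁ m₂ m₃ hm
  have compat (f g : Γ(Y, π ⁻¹ᵁ V)) (hf : Y.basicOpen f ≤ U) (hg : Y.basicOpen g ≤ U)
      (hgf : Y.basicOpen g ≤ Y.basicOpen f) (b : Γ(Y, Y.basicOpen f)) :
      D g hg (Y.presheaf.map (homOfLE hgf).op b) = G.presheaf.map (homOfLE hgf).op (D f hf b) := by
    have key (w : Γ(Y, π ⁻¹ᵁ V)) (m : Γ(G, U))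
        (e₁ : D f hf (Y.presheaf.map (homOfLE (Y.basicOpen_le f)).op w) =
          G.presheaf.map (homOfLE hf).op m)
        (e₂ : D g hg (Y.presheaf.map (homOfLE (Y.basicOpen_le g)).op w) =
          G.presheaf.map (homOfLE hg).op m) :
        D g hg (Y.presheaf.map (homOfLE hgf).op
          (Y.presheaf.map (homOfLE (Y.basicOpen_le f)).op w)) - G.presheaf.map (homOfLE hgf).op
            (D f hf (Y.presheaf.map (homOfLE (Y.basicOpen_le f)).op w)) = 0 := by
      rw [structure_map_map, e₁, e₂, map_map, sub_self]
    refine sub_eq_zero.1 (h.derivation_eq_zero (G := G) f rfl (Y.basicOpen_le f) hgf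
      (((D g hg).comp (Y.presheaf.map (homOfLE hgf).op).hom.toAddMonoidHom) -
        ((G.presheaf.map (homOfLE hgf).op).hom.comp (D f hf))) (fun a b => ?_) (fun a => ?_)
      (key x m₁ (D_x _ _) (D_x _ _)) (key y m₂ (D_y _ _) (D_y _ _))
      (key z m₃ (D_z _ _) (D_z _ _)) b)
    · change D g hg (Y.presheaf.map (homOfLE hgf).op (a * b)) -
        G.presheaf.map (homOfLE hgf).op (D f hf (a * b)) =
        _ • (D g hg (Y.presheaf.map (homOfLE hgf).op b) -
          G.presheaf.map (homOfLE hgf).op (D f hf b)) +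
        _ • (D g hg (Y.presheaf.map (homOfLE hgf).op a) -
          G.presheaf.map (homOfLE hgf).op (D f hf a))
      rw [map_mul, D_mul, D_mul, map_add, Scheme.Modules.map_smul, Scheme.Modules.map_smul,
        smul_sub, smul_sub]
      abel
    · change D g hg (Y.presheaf.map (homOfLE hgf).op _) - G.presheaf.map (homOfLE hgf).op (D f hf _)
        = 0
      rw [structure_map_map, D_app, D_app, map_zero, sub_self]
  obtain ⟨d, d_map, d_basicOpen⟩ : ∃ d : ∀ W : Y.Opens, W ≤ U → (Γ(Y, W) →+ Γ(G, W)),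
      (∀ W W' (hWU : W ≤ U) (hW' : W' ≤ W) (r : Γ(Y, W)),
        d W' (hW'.trans hWU) (Y.presheaf.map (homOfLE hW').op r) =
          G.presheaf.map (homOfLE hW').op (d W hWU r)) ∧
      ∀ (f : Γ(Y, π ⁻¹ᵁ V)) (hf : Y.basicOpen f ≤ U) (b : Γ(Y, Y.basicOpen f)),
        d _ hf b = D f hf b := by
    obtain ⟨d, d_map, hd⟩ := exists_hom_of_rel (F := structureModule Y) (G := G) U
      (fun W r t => ∀ f (hfW : Y.basicOpen f ≤ W) (hf : Y.basicOpen f ≤ U),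
        G.presheaf.map (homOfLE hfW).op t =
          D f hf (show Γ(Y, Y.basicOpen f) from Y.presheaf.map (homOfLE hfW).op r))
      (fun W t hW' ht => eq_of_locally_eq G fun p hp => by
        obtain ⟨f, hf, hpf⟩ := exists_basicOpen_le hW (hW'.trans hU) hp
        refine ⟨_, hf, hpf, ?_⟩
        rw [ht f hf (hf.trans hW'), map_zero]
        exact (congr_arg (D f _) (map_zero _)).trans (map_zero _))
      (fun W r t r' t' hW' ht ht' f hfW hf => by
        rw [map_sub, ht f hfW hf, ht' f hfW hf, ← map_sub]
        exact congr_arg (D f _) (map_sub _ _ _).symm)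
      (fun W W' hW' r t hW ht f hfW hf => by
        rw [map_map, ht f (hfW.trans hW') hf]
        exact congr_arg (D f _) (structure_map_map hW' hfW r).symm)
      (fun W r hWU p hp => by
        obtain ⟨f, hf, hpf⟩ := exists_basicOpen_le hW (hWU.trans hU) hp
        refine ⟨_, hf, hpf, D f (hf.trans hWU) (show Γ(Y, Y.basicOpen f) from
          Y.presheaf.map (homOfLE hf).op r), fun g hgf hg => ?_⟩
        exact (compat f g (hf.trans hWU) hg hgf _).symm)
    exact ⟨d, d_map, fun f hf b => hd _ hf b _ fun g hgf hg => (compat f g hf hg hgf b).symm⟩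
  have d_res (W : Y.Opens) (hWU : W ≤ U) (f : Γ(Y, π ⁻¹ᵁ V)) (hf : Y.basicOpen f ≤ W)
      (b : Γ(Y, W)) : G.presheaf.map (homOfLE hf).op (d W hWU b) =
        D f (hf.trans hWU) (Y.presheaf.map (homOfLE hf).op b) :=
    (d_map W _ hWU hf b).symm.trans (d_basicOpen f _ _)
  have d_gen (w : Γ(Y, π ⁻¹ᵁ V)) (m : Γ(G, U)) (e : ∀ f (hf : Y.basicOpen f ≤ U),
      D f hf (Y.presheaf.map (homOfLE (Y.basicOpen_le f)).op w) =
        G.presheaf.map (homOfLE hf).op m) :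
      d U le_rfl (Y.presheaf.map (homOfLE hU).op w) = m := by
    refine eq_of_locally_eq G fun p hp => ?_
    obtain ⟨f, hf, hpf⟩ := exists_basicOpen_le hW hU hp
    refine ⟨_, hf, hpf, ?_⟩
    rw [d_res, structure_map_map, e]
  let Dl : LocalDerivation π G U :=
    { d := d
      d_mul W hWU a b := by
        refine eq_of_locally_eq G fun p hp => ?_
        obtain ⟨f, hf, hpf⟩ := exists_basicOpen_le hW (hWU.trans hU) hp
        refine ⟨_, hf, hpf, ?_⟩
        rw [map_add, Scheme.Modules.map_smul, Scheme.Modules.map_smul, d_res, d_res, d_res, map_mul,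
          D_mul]
      d_map W W' hWU hW' a := d_map W W' hWU hW' a
      d_app W hWU U' hU' s := by
        refine eq_of_locally_eq G fun p hp => ?_
        obtain ⟨a, ha, hpa⟩ := exists_basicOpen_le h.isAffineOpen (V := U' ⊓ V) inf_le_right
          (p := π p) ⟨hU' hp, hU (hWU hp)⟩
        obtain ⟨f, hf, hpf⟩ := exists_basicOpen_le hW (V := W ⊓ π ⁻¹ᵁ (S.basicOpen a))
          (inf_le_left.trans (hWU.trans hU)) (p := p) ⟨hp, hpa⟩
        refine ⟨_, hf.trans inf_le_left, hpf, ?_⟩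
        rw [d_res, structure_map_map, map_zero]
        have hfa := hf.trans inf_le_right
        obtain ⟨t, s', hs', ht⟩ := exists_num_denom h.isAffineOpen a (S.basicOpen_le a) rfl
          (S.presheaf.map (homOfLE (ha.trans inf_le_left)).op s)
        have e := congr_arg (fun r => Y.presheaf.map (homOfLE hfa).op (π.app _ r)) ht
        simp only [map_mul] at e
        rw [app_res, app_res, app_res, structure_map_map, structure_map_map,
          structure_map_map] at e
        have e' := congr_arg (D f ((hf.trans inf_le_left).trans hWU)) e
        rw [D_mul, D_app, D_app, smul_zero, add_zero] at e'
        have hu := (hs'.map (π.app _).hom).map (Y.presheaf.map (homOfLE hfa).op).hom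
        change IsUnit (Y.presheaf.map (homOfLE hfa).op (π.app _ _)) at hu
        rw [app_res, structure_map_map] at hu
        exact hu.smul_eq_zero.1 e' }
  obtain ⟨φ, hφ⟩ := Dl.exists_localHom
  exact ⟨φ, (hφ _ _ _).trans (d_gen x m₁ fun f hf => D_x f hf),
    (hφ _ _ _).trans (d_gen y m₂ fun f hf => D_y f hf),
    (hφ _ _ _).trans (d_gen z m₃ fun f hf => D_z f hf)⟩

end IsAnChart

/-! ### The generator of `ℰxt¹(Ω¹_{Y/S}, 𝒪_Y)` and its relations -/

namespace ExtPresentation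

variable {X : Scheme.{u}} {F : X.Modules} (E : ExtPresentation F (structureModule X))

/-- The image of the section `1` of the structure sheaf in the first term of its injective
resolution. -/
def one (U : X.Opens) : Γ(E.I₀, U) := E.η.app U (show Γ(structureModule X, U) from (1 : Γ(X, U)))

variable {U : X.Opens}

lemma η_app (r : Γ(X, U)) : E.η.app U (show Γ(structureModule X, U) from r) = r • E.one U := by
  refine Eq.trans ?_ (E.η.app_smul r (show Γ(structureModule X, U) from (1 : Γ(X, U))))
  exact congr_arg (E.η.app U) (mul_one r).symm

lemma eq_zero_of_smul_one_eq_zero {r : Γ(X, U)} (h : r • E.one U = 0) : r = 0 :=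
  E.η_injective U (((E.η_app r).trans h).trans (map_zero _).symm)

lemma d₀_one : E.d₀.app U (E.one U) = 0 := E.d₀_η U _

lemma exists_smul_one_eq (s : Γ(E.I₀, U)) (h : E.d₀.app U s = 0) :
    ∃ r : Γ(X, U), r • E.one U = s := by
  obtain ⟨r, hr⟩ := E.exact₀ U s h
  exact ⟨r, (E.η_app r).symm.trans hr⟩

lemma map_one {U' : X.Opens} (h : U' ≤ U) :
    E.I₀.presheaf.map (homOfLE h).op (E.one U) = E.one U' :=
  (hom_app_res E.η h _).symm.trans
    (congr_arg (E.η.app U') (_root_.map_one (X.presheaf.map (homOfLE h).op).hom))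

/-- The morphism `F|_U ⟶ I₁|_U` underlying a cocycle. -/
def cocycle : Γ(E.Z, U) →ₗ[Γ(X, U)] LocalHom F E.I₁ U where
  toFun c := E.i.app U c
  map_add' c c' := map_add (E.i.app U).hom c c'
  map_smul' r c := E.i.app_smul r c

lemma cocycle_map {U' : X.Opens} (h : U' ≤ U) (c : Γ(E.Z, U)) :
    E.cocycle (E.Z.presheaf.map (homOfLE h).op c) = LocalHom.res h (E.cocycle c) :=
  hom_app_res E.i h c

end ExtPresentation

section Generator

variable {S Y : Scheme.{u}} (n : ℕ) (π : Y ⟶ S)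

/-- Functions `x`, `y`, `z` on `U` with `x y = z ^ (n + 1)` such that `Ω¹_{Y/S}` is generated on `U`
by `dx`, `dy`, `dz` subject to the single relation obtained by differentiating this equation. -/
structure IsDifferentialCoordinates (U : Y.Opens) (x y z : Γ(Y, U)) : Prop where
  y_mem_nonZeroDivisors (U' : Y.Opens) (h : U' ≤ U) :
    Y.presheaf.map (homOfLE h).op y ∈ nonZeroDivisors Γ(Y, U')
  rel : x * y = z ^ (n + 1)
  localHom_eq_zero (G : Y.Modules) (U' : Y.Opens) (h : U' ≤ U)
    (φ : LocalHom (relativeDifferentials π) G U')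
    (hx : φ.app U' le_rfl (relD π U' (Y.presheaf.map (homOfLE h).op x)) = 0)
    (hy : φ.app U' le_rfl (relD π U' (Y.presheaf.map (homOfLE h).op y)) = 0)
    (hz : φ.app U' le_rfl (relD π U' (Y.presheaf.map (homOfLE h).op z)) = 0) : φ = 0
  exists_localHom (G : Y.Modules) (U' : Y.Opens) (h : U' ≤ U) (m₁ m₂ m₃ : Γ(G, U'))
    (hm : Y.presheaf.map (homOfLE h).op y • m₁ + Y.presheaf.map (homOfLE h).op x • m₂ -
      ((n + 1 : ℕ) * Y.presheaf.map (homOfLE h).op z ^ n) • m₃ = 0) :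
    ∃ φ : LocalHom (relativeDifferentials π) G U',
      φ.app U' le_rfl (relD π U' (Y.presheaf.map (homOfLE h).op x)) = m₁ ∧
      φ.app U' le_rfl (relD π U' (Y.presheaf.map (homOfLE h).op y)) = m₂ ∧
      φ.app U' le_rfl (relD π U' (Y.presheaf.map (homOfLE h).op z)) = m₃

variable {n π}

lemma IsAnChart.isDifferentialCoordinates {V : S.Opens} {x y z : Γ(Y, π ⁻¹ᵁ V)}
    (h : IsAnChart n π V x y z) : IsDifferentialCoordinates n π (π ⁻¹ᵁ V) x y z where
  y_mem_nonZeroDivisors _ h' := h.y_mem_nonZeroDivisors h'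
  rel := h.isAnAlgebra.rel
  localHom_eq_zero _ _ h' φ := h.localHom_eq_zero h' φ
  exists_localHom _ _ h' := h.exists_localHom h'

/-- `e` is the class of the cocycle `Ω¹_{Y/S} ⟶ I₁` with `dx ↦ d₀ (y⁻¹)`, `dy ↦ 0`, `dz ↦ 0`, where
`y⁻¹` is a section of `I₀` with `y • y⁻¹ = 1`. -/
def IsGenerator (E : ExtPresentation (relativeDifferentials π) (structureModule Y)) (U : Y.Opens)
    (x y z : Γ(Y, U)) (e : Γ(sheafExt (relativeDifferentials π) (structureModule Y) 1, U)) : Prop :=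
  ∃ (i : Γ(E.I₀, U)) (c : Γ(E.Z, U)), y • i = E.one U ∧ E.p.app U c = e ∧
    (E.cocycle c).app U le_rfl (relD π U x) =
      E.d₀.app U i ∧
    (E.cocycle c).app U le_rfl (relD π U y) = 0 ∧
    (E.cocycle c).app U le_rfl (relD π U z) = 0

variable {E : ExtPresentation (relativeDifferentials π) (structureModule Y)} {U : Y.Opens}

lemma ExtPresentation.cocycle_map_app {U' : Y.Opens} (hU : U' ≤ U) (c : Γ(E.Z, U)) (w : Γ(Y, U)) :
    (E.cocycle (E.Z.presheaf.map (homOfLE hU).op c)).app U' le_rfl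
        (relD π U' (Y.presheaf.map (homOfLE hU).op w)) =
      E.I₁.presheaf.map (homOfLE hU).op ((E.cocycle c).app U le_rfl (relD π U w)) := by
  rw [relD_map, ← LocalHom.naturality, E.cocycle_map]
  rfl

lemma IsGenerator.res {x y z : Γ(Y, U)}
    {e : Γ(sheafExt (relativeDifferentials π) (structureModule Y) 1, U)}
    (he : IsGenerator E U x y z e) {U' : Y.Opens} (hU : U' ≤ U) :
    IsGenerator E U' (Y.presheaf.map (homOfLE hU).op x) (Y.presheaf.map (homOfLE hU).op y)
      (Y.presheaf.map (homOfLE hU).op z)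
      ((sheafExt (relativeDifferentials π) (structureModule Y) 1).presheaf.map
        (homOfLE hU).op e) := by
  obtain ⟨i, c, hi, hc, hx, hy, hz⟩ := he
  refine ⟨E.I₀.presheaf.map (homOfLE hU).op i, E.Z.presheaf.map (homOfLE hU).op c, ?_, ?_, ?_, ?_,
    ?_⟩
  · rw [← Scheme.Modules.map_smul, hi, E.map_one]
  · rw [hom_app_res, hc]
  · rw [E.cocycle_map_app, hx, hom_app_res]
  · rw [E.cocycle_map_app, hy, map_zero]
  · rw [E.cocycle_map_app, hz, map_zero]

namespace IsDifferentialCoordinates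

variable {x y z : Γ(Y, U)} (h : IsDifferentialCoordinates n π U x y z)
include h

lemma res {U' : Y.Opens} (hU : U' ≤ U) : IsDifferentialCoordinates n π U'
    (Y.presheaf.map (homOfLE hU).op x) (Y.presheaf.map (homOfLE hU).op y)
    (Y.presheaf.map (homOfLE hU).op z) where
  y_mem_nonZeroDivisors U'' h' := by
    rw [structure_map_map]
    exact h.y_mem_nonZeroDivisors _ _
  rel := by rw [← map_mul, h.rel, map_pow]
  localHom_eq_zero G U'' h' φ hx hy hz := by
    rw [structure_map_map] at hx hy hz
    exact h.localHom_eq_zero G U'' _ φ hx hy hz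
  exists_localHom G U'' h' m₁ m₂ m₃ hm := by
    rw [structure_map_map, structure_map_map, structure_map_map] at hm ⊢
    exact h.exists_localHom G U'' _ m₁ m₂ m₃ hm

lemma localHom_ext {G : Y.Modules} (φ ψ : LocalHom (relativeDifferentials π) G U)
    (hx : φ.app U le_rfl (relD π U x) = ψ.app U le_rfl (relD π U x))
    (hy : φ.app U le_rfl (relD π U y) = ψ.app U le_rfl (relD π U y))
    (hz : φ.app U le_rfl (relD π U z) = ψ.app U le_rfl (relD π U z)) : φ = ψ := by
  have key (w : Γ(Y, U)) (hw : φ.app U le_rfl (relD π U w) = ψ.app U le_rfl (relD π U w)) :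
      (φ + -ψ).app U le_rfl (relD π U (Y.presheaf.map (homOfLE le_rfl).op w)) = 0 := by
    rw [structure_map_self]
    exact (congr_arg (· + -ψ.app U le_rfl (relD π U w)) hw).trans (add_neg_cancel _)
  rw [← sub_eq_zero, sub_eq_add_neg]
  exact h.localHom_eq_zero G U le_rfl _ (key x hx) (key y hy) (key z hz)

lemma exists_localHom_self {G : Y.Modules} (m₁ m₂ m₃ : Γ(G, U))
    (hm : y • m₁ + x • m₂ - ((n + 1 : ℕ) * z ^ n) • m₃ = 0) :
    ∃ φ : LocalHom (relativeDifferentials π) G U, φ.app U le_rfl (relD π U x) = m₁ ∧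
      φ.app U le_rfl (relD π U y) = m₂ ∧ φ.app U le_rfl (relD π U z) = m₃ := by
  have := h.exists_localHom G U le_rfl m₁ m₂ m₃
  rw [structure_map_self, structure_map_self, structure_map_self] at this
  exact this hm

lemma localHom_rel {G : Y.Modules} (φ : LocalHom (relativeDifferentials π) G U) :
    y • φ.app U le_rfl (relD π U x) + x • φ.app U le_rfl (relD π U y) -
      ((n + 1 : ℕ) * z ^ n) • φ.app U le_rfl (relD π U z) = 0 := by
  rw [← (φ.app U _).map_smul, ← (φ.app U _).map_smul, ← (φ.app U _).map_smul,
    ← (φ.app U _).map_add, ← (φ.app U _).map_sub, relD_rel π h.rel, map_zero]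

/-- A cocycle has class zero if its values on `dx`, `dy`, `dz` lift to `I₀` compatibly with the
relation between them. -/
lemma p_eq_zero (c : Γ(E.Z, U)) (u₁ u₂ u₃ : Γ(E.I₀, U))
    (hu : y • u₁ + x • u₂ - ((n + 1 : ℕ) * z ^ n) • u₃ = 0)
    (hx : (E.cocycle c).app U le_rfl (relD π U x) =
      E.d₀.app U u₁)
    (hy : (E.cocycle c).app U le_rfl (relD π U y) =
      E.d₀.app U u₂)
    (hz : (E.cocycle c).app U le_rfl (relD π U z) =
      E.d₀.app U u₃) : E.p.app U c = 0 := by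
  obtain ⟨ψ, ψx, ψy, ψz⟩ := h.exists_localHom_self u₁ u₂ u₃ hu
  refine E.p_eq_zero U c ψ (h.localHom_ext _ _ (hx.trans ?_) (hy.trans ?_) (hz.trans ?_))
  · exact congr_arg (E.d₀.app U) ψx.symm
  · exact congr_arg (E.d₀.app U) ψy.symm
  · exact congr_arg (E.d₀.app U) ψz.symm

variable (E) in
/-- The section `y⁻¹` of `I₀` exists because `y` is a nonzerodivisor and `I₀` is injective. -/
lemma exists_isGenerator : ∃ e, IsGenerator E U x y z e := by
  have := E.injective
  obtain ⟨i, hi⟩ := exists_smul_eq_of_injective E.I₀ y h.y_mem_nonZeroDivisors (E.one U)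
  obtain ⟨φ, φx, φy, φz⟩ := h.exists_localHom_self (E.d₀.app U i) 0 0 (by
    rw [← E.d₀.app_smul, hi, E.d₀_one, smul_zero, smul_zero, add_zero, sub_zero])
  obtain ⟨c, hc⟩ := E.exists_i_eq U φ (h.localHom_ext _ _
    ((congr_arg (E.d₁.app U) φx).trans (E.d₁_d₀ U i))
    ((congr_arg (E.d₁.app U) φy).trans (map_zero _))
    ((congr_arg (E.d₁.app U) φz).trans (map_zero _)))
  refine ⟨_, i, c, hi, rfl, ?_⟩
  rw [show E.cocycle c = φ from hc]
  exact ⟨φx, φy, φz⟩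

variable {e : Γ(sheafExt (relativeDifferentials π) (structureModule Y) 1, U)}

/-- The morphism `Ω¹_{Y/S} ⟶ I₀` with `dx ↦ x y⁻¹`, `dy ↦ -1`, `dz ↦ 0` lifts `x` times the
cocycle of the generator. -/
lemma x_smul_eq_zero (he : IsGenerator E U x y z e) : x • e = 0 := by
  obtain ⟨i, c, hi, rfl, hx, hy, hz⟩ := he
  rw [← E.p.app_smul]
  refine h.p_eq_zero (x • c) (x • i) (-E.one U) 0 ?_ ?_ ?_ ?_
  · rw [smul_comm, hi, smul_neg, add_neg_cancel, smul_zero, sub_zero]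
  · rw [map_smul, E.d₀.app_smul, ← hx]
    simp
  · rw [map_smul, map_neg, E.d₀_one]
    simp [hy]
  · rw [map_smul, map_zero]
    simp [hz]

lemma y_smul_eq_zero (he : IsGenerator E U x y z e) : y • e = 0 := by
  obtain ⟨i, c, hi, rfl, hx, hy, hz⟩ := he
  rw [← E.p.app_smul]
  refine h.p_eq_zero (y • c) 0 0 0 (by simp) ?_ ?_ ?_
  · rw [map_smul, map_zero]
    simp [hx, ← E.d₀.app_smul, hi, E.d₀_one]
  · rw [map_smul, map_zero]
    simp [hy]
  · rw [map_smul, map_zero]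
    simp [hz]

/-- The morphism `Ω¹_{Y/S} ⟶ I₀` with `dx ↦ z ^ n y⁻¹`, `dy ↦ 0`, `dz ↦ 1 / (n + 1)` lifts `z ^ n`
times the cocycle of the generator. It is here that `n + 1` has to be invertible. -/
lemma z_pow_smul_eq_zero (hn : IsUnit ((n + 1 : ℕ) : Γ(Y, U))) (he : IsGenerator E U x y z e) :
    z ^ n • e = 0 := by
  obtain ⟨i, c, hi, rfl, hx, hy, hz⟩ := he
  obtain ⟨v, hv⟩ := hn.exists_right_inv
  rw [← E.p.app_smul]
  refine h.p_eq_zero (z ^ n • c) (z ^ n • i) 0 (v • E.one U) ?_ ?_ ?_ ?_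
  · rw [smul_comm, hi, smul_zero, add_zero, smul_smul, mul_right_comm, hv, one_mul, sub_self]
  · rw [map_smul, E.d₀.app_smul, ← hx]
    simp
  · rw [map_smul, map_zero]
    simp [hy]
  · rw [map_smul, E.d₀.app_smul, E.d₀_one]
    simp [hz]

/-- The annihilator of the generator is contained, locally, in the ideal `(x, y, z ^ n)`:
the values of a lift of `g` times the cocycle are `g y⁻¹ + r₁`, `r₂`, `r₃` for functions `r₁`, `r₂`,
`r₃`, and the relation between `dx`, `dy`, `dz` says that
`g + y r₁ + x r₂ = (n + 1) z ^ n r₃`. -/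
lemma exists_mem_span (he : IsGenerator E U x y z e) {g : Γ(Y, U)} (hg : g • e = 0) (q : Y)
    (hq : q ∈ U) : ∃ (W : Y.Opens) (hW : W ≤ U), q ∈ W ∧ Y.presheaf.map (homOfLE hW).op g ∈
      Ideal.span {Y.presheaf.map (homOfLE hW).op x, Y.presheaf.map (homOfLE hW).op y,
        Y.presheaf.map (homOfLE hW).op z ^ n} := by
  obtain ⟨i, c, hi, rfl, hx, hy, hz⟩ := he
  rw [← E.p.app_smul] at hg
  obtain ⟨W, hW, hqW, ψ, hψ⟩ := E.exists_lift U (g • c) hg q hq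
  refine ⟨W, hW, hqW, ?_⟩
  have hψ' (w : Γ(Y, U)) :
      E.d₀.app W (ψ.app W le_rfl (relD π W (Y.presheaf.map (homOfLE hW).op w))) =
        Y.presheaf.map (homOfLE hW).op g •
          E.I₁.presheaf.map (homOfLE hW).op ((E.cocycle c).app U le_rfl (relD π U w)) := by
    have : ψ.postcomp E.d₀ = Y.presheaf.map (homOfLE hW).op g •
        E.cocycle (E.Z.presheaf.map (homOfLE hW).op c) := by
      rw [← map_smul, ← Scheme.Modules.map_smul, E.cocycle_map]
      exact hψ
    rw [← E.cocycle_map_app]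
    refine (DFunLike.congr_fun (congr_fun (congr_fun (congr_arg LocalHom.app this) W) le_rfl)
      _).trans ?_
    simp
  have h' := h.res hW
  have hi' := congr_arg (E.I₀.presheaf.map (homOfLE hW).op) hi
  rw [Scheme.Modules.map_smul, E.map_one] at hi'
  obtain ⟨r₁, hr₁⟩ := E.exists_smul_one_eq (_ - Y.presheaf.map (homOfLE hW).op g •
    E.I₀.presheaf.map (homOfLE hW).op i) (by
      rw [map_sub, hψ' x, hx, E.d₀.app_smul, hom_app_res, sub_self])
  obtain ⟨r₂, hr₂⟩ := E.exists_smul_one_eq _ ((hψ' y).trans (by rw [hy, map_zero, smul_zero]))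
  obtain ⟨r₃, hr₃⟩ := E.exists_smul_one_eq _ ((hψ' z).trans (by rw [hz, map_zero, smul_zero]))
  have := h'.localHom_rel ψ
  rw [eq_sub_iff_add_eq] at hr₁
  rw [← hr₁, ← hr₂, ← hr₃, smul_add, smul_comm _ _ (E.I₀.presheaf.map _ i), hi', smul_smul,
    smul_smul, smul_smul, ← add_smul, ← add_smul, ← sub_smul] at this
  have := E.eq_zero_of_smul_one_eq_zero this
  rw [Ideal.mem_span_insert]
  refine ⟨-r₂, (n + 1 : ℕ) * r₃ * Y.presheaf.map (homOfLE hW).op z ^ n -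
    r₁ * Y.presheaf.map (homOfLE hW).op y, ?_, ?_⟩
  · rw [Ideal.mem_span_pair]
    exact ⟨-r₁, (n + 1 : ℕ) * r₃, by ring⟩
  · linear_combination this

/-- Locally, every section of `ℰxt¹(Ω¹_{Y/S}, 𝒪_Y)` is a multiple of the generator: if
`u₁`, `u₂`, `u₃` are local lifts to `I₀` of the values of a cocycle on `dx`, `dy`, `dz`, the
multiplier is the function `y u₁ + x u₂ - (n + 1) z ^ n u₃`. -/
lemma exists_eq_smul (he : IsGenerator E U x y z e)
    (s : Γ(sheafExt (relativeDifferentials π) (structureModule Y) 1, U)) (q : Y) (hq : q ∈ U) :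
    ∃ (W : Y.Opens) (hW : W ≤ U) (g : Γ(Y, W)), q ∈ W ∧
      (sheafExt (relativeDifferentials π) (structureModule Y) 1).presheaf.map (homOfLE hW).op s =
      g • (sheafExt (relativeDifferentials π) (structureModule Y) 1).presheaf.map
        (homOfLE hW).op e := by
  obtain ⟨i, c₀, hi, rfl, hx, hy, hz⟩ := he
  obtain ⟨W₀, hW₀, hq₀, c, hc⟩ := E.p_surjective U s q hq
  obtain ⟨W₁, hW₁, hq₁, u₁, hu₁⟩ := E.exact₁ W₀ ((E.cocycle c).app W₀ le_rfl
    (relD π W₀ (Y.presheaf.map (homOfLE hW₀).op x))) (DFunLike.congr_fun (congr_fun (congr_fun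
      (congr_arg LocalHom.app (E.i_closed W₀ c)) W₀) le_rfl) _) q hq₀
  obtain ⟨W₂, hW₂, hq₂, u₂, hu₂⟩ := E.exact₁ W₀ ((E.cocycle c).app W₀ le_rfl
    (relD π W₀ (Y.presheaf.map (homOfLE hW₀).op y))) (DFunLike.congr_fun (congr_fun (congr_fun
      (congr_arg LocalHom.app (E.i_closed W₀ c)) W₀) le_rfl) _) q hq₀
  obtain ⟨W₃, hW₃, hq₃, u₃, hu₃⟩ := E.exact₁ W₀ ((E.cocycle c).app W₀ le_rfl
    (relD π W₀ (Y.presheaf.map (homOfLE hW₀).op z))) (DFunLike.congr_fun (congr_fun (congr_fun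
      (congr_arg LocalHom.app (E.i_closed W₀ c)) W₀) le_rfl) _) q hq₀
  let W : Y.Opens := W₁ ⊓ (W₂ ⊓ W₃)
  have h₁ : W ≤ W₁ := inf_le_left
  have h₂ : W ≤ W₂ := inf_le_right.trans inf_le_left
  have h₃ : W ≤ W₃ := inf_le_right.trans inf_le_right
  have hW : W ≤ W₀ := h₁.trans hW₁
  have lift (w : Γ(Y, U)) {W' : Y.Opens} (hW' : W' ≤ W₀) (hWW' : W ≤ W') (u : Γ(E.I₀, W'))
      (hu : E.d₀.app W' u = E.I₁.presheaf.map (homOfLE hW').op ((E.cocycle c).app W₀ le_rfl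
        (relD π W₀ (Y.presheaf.map (homOfLE hW₀).op w)))) :
      (E.cocycle (E.Z.presheaf.map (homOfLE hW).op c)).app W le_rfl
        (relD π W (Y.presheaf.map (homOfLE (hW.trans hW₀)).op w)) =
        E.d₀.app W (E.I₀.presheaf.map (homOfLE hWW').op u) := by
    rw [hom_app_res, hu, map_map, ← structure_map_map hW₀ hW, E.cocycle_map_app]
  have hx' := lift x hW₁ h₁ u₁ hu₁
  have hy' := lift y hW₂ h₂ u₂ hu₂
  have hz' := lift z hW₃ h₃ u₃ hu₃
  have h' := h.res (hW.trans hW₀)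
  obtain ⟨g, hg⟩ := E.exists_smul_one_eq (Y.presheaf.map (homOfLE (hW.trans hW₀)).op y •
      E.I₀.presheaf.map (homOfLE h₁).op u₁ + Y.presheaf.map (homOfLE (hW.trans hW₀)).op x •
      E.I₀.presheaf.map (homOfLE h₂).op u₂ -
      ((n + 1 : ℕ) * Y.presheaf.map (homOfLE (hW.trans hW₀)).op z ^ n) •
      E.I₀.presheaf.map (homOfLE h₃).op u₃) (by
    rw [map_sub, map_add, E.d₀.app_smul, E.d₀.app_smul, E.d₀.app_smul, ← hx', ← hy', ← hz']
    exact h'.localHom_rel _)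
  have hi' := congr_arg (E.I₀.presheaf.map (homOfLE (hW.trans hW₀)).op) hi
  rw [Scheme.Modules.map_smul, E.map_one] at hi'
  refine ⟨W, hW.trans hW₀, g, ⟨hq₁, hq₂, hq₃⟩, ?_⟩
  rw [← map_map _ hW₀ hW, ← hc, ← hom_app_res, ← hom_app_res, ← E.p.app_smul, ← sub_eq_zero,
    ← map_sub]
  refine h'.p_eq_zero _ (E.I₀.presheaf.map (homOfLE h₁).op u₁ -
    g • E.I₀.presheaf.map (homOfLE (hW.trans hW₀)).op i) (E.I₀.presheaf.map (homOfLE h₂).op u₂)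
    (E.I₀.presheaf.map (homOfLE h₃).op u₃) ?_ ?_ ?_ ?_
  · rw [smul_sub, smul_comm _ g, hi', hg]
    abel
  · rw [map_sub, map_smul, map_sub, ← hx', E.d₀.app_smul, hom_app_res, ← hx, ← E.cocycle_map_app,
      sub_eq_add_neg, sub_eq_add_neg]
    simp
  · rw [map_sub, map_smul, ← hy', sub_eq_add_neg]
    simp [E.cocycle_map_app, hy]
  · rw [map_sub, map_smul, ← hz', sub_eq_add_neg]
    simp [E.cocycle_map_app, hz]

/-- The dependence of the generator on the coordinates: `dx ↦ y⁻¹ - b y'⁻¹`, `dy ↦ 0`, `dz ↦ 0`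
lifts the difference of the cocycles of `e` and `a b • e'`. -/
lemma generator_eq_smul {a b t : Γ(Y, U)} (hab : a * b = t ^ (n + 1)) (hb : IsUnit b)
    (ht : IsUnit t) (da : relD π U a = 0) (db : relD π U b = 0) (dt : relD π U t = 0)
    {e' : Γ(sheafExt (relativeDifferentials π) (structureModule Y) 1, U)}
    (he : IsGenerator E U x y z e) (he' : IsGenerator E U (a * x) (b * y) (t * z) e') :
    e = t ^ (n + 1) • e' := by
  obtain ⟨i, c, hi, rfl, hx, hy, hz⟩ := he
  obtain ⟨i', c', hi', rfl, hx', hy', hz'⟩ := he'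
  rw [relD_mul, da, smul_zero, add_zero, map_smul] at hx'
  rw [relD_mul, db, smul_zero, add_zero, map_smul, hb.smul_eq_zero] at hy'
  rw [relD_mul, dt, smul_zero, add_zero, map_smul, ht.smul_eq_zero] at hz'
  rw [← E.p.app_smul, ← sub_eq_zero, ← map_sub, ← hab]
  refine h.p_eq_zero _ (i - b • i') 0 0 ?_ ?_ ?_ ?_
  · rw [smul_sub, hi, smul_smul, mul_comm y b, hi', sub_self, smul_zero, smul_zero, add_zero,
      sub_zero]
  · rw [map_sub, map_smul, map_sub, E.d₀.app_smul, ← hx', ← hx, smul_smul, sub_eq_add_neg,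
      sub_eq_add_neg]
    simp [mul_comm]
  · rw [map_sub, map_smul, map_zero, sub_eq_add_neg]
    simp [hy, hy']
  · rw [map_sub, map_smul, map_zero, sub_eq_add_neg]
    simp [hz, hz']

end IsDifferentialCoordinates

end Generator

/-! ### Sections of `ℰxt¹(Ω¹_{Y/S}, 𝒪_Y)` over affine open subsets -/

section AffineLocal

variable {X : Scheme.{u}} {U : X.Opens}

/-- Membership in a submodule can be checked after multiplication with powers of functions `f` whose
basic open subsets cover `U`. -/
lemma mem_submodule_of_locally (hU : IsAffineOpen U) {N : Type*} [AddCommGroup N]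
    [Module Γ(X, U) N] (N' : Submodule Γ(X, U) N) (m : N)
    (H : ∀ q ∈ U, ∃ f : Γ(X, U), q ∈ X.basicOpen f ∧ ∃ k : ℕ, f ^ k • m ∈ N') : m ∈ N' := by
  let s : Set Γ(X, U) := {f | ∃ k : ℕ, f ^ k • m ∈ N'}
  refine Submodule.mem_of_span_eq_top_of_smul_pow_mem N' s ?_ m fun f => f.2
  refine hU.self_le_iSup_basicOpen_iff.1 fun q hq => ?_
  obtain ⟨f, hqf, hf⟩ := H q hq
  exact Opens.mem_iSup.2 ⟨⟨f, hf⟩, hqf⟩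

lemma exists_pow_mul_eq_map (hU : IsAffineOpen U) (f : Γ(X, U))
    (b : Γ(X, X.basicOpen f)) :
    ∃ (k : ℕ) (r : Γ(X, U)), X.presheaf.map (homOfLE (X.basicOpen_le f)).op (f ^ k) * b =
      X.presheaf.map (homOfLE (X.basicOpen_le f)).op r := by
  let := (X.presheaf.map (homOfLE (X.basicOpen_le f)).op).hom.toAlgebra
  have := hU.isLocalization_of_eq_basicOpen f (homOfLE (X.basicOpen_le f)) rfl
  obtain ⟨k, r, hr⟩ := IsLocalization.Away.surj f b
  refine ⟨k, r, ?_⟩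
  rw [map_pow, mul_comm]
  exact hr

lemma exists_pow_mul_mem (hU : IsAffineOpen U) (f : Γ(X, U)) {V : X.Opens} (hV : V ≤ U)
    (e : V = X.basicOpen f) (J : Ideal Γ(X, U)) (r : Γ(X, U))
    (hr : X.presheaf.map (homOfLE hV).op r ∈ J.map (X.presheaf.map (homOfLE hV).op).hom) :
    ∃ k : ℕ, f ^ k * r ∈ J := by
  let := (X.presheaf.map (homOfLE hV).op).hom.toAlgebra
  have := hU.isLocalization_of_eq_basicOpen f (homOfLE hV) e
  obtain ⟨_, ⟨k, rfl⟩, hk⟩ :=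
    (IsLocalization.algebraMap_mem_map_algebraMap_iff (Submonoid.powers f) Γ(X, V) J r).1 hr
  exact ⟨k, hk⟩

lemma exists_finset_basicOpen (hU : IsAffineOpen U) (P : Γ(X, U) → Prop)
    (H : ∀ q ∈ U, ∃ f : Γ(X, U), q ∈ X.basicOpen f ∧ P f) :
    ∃ t : Finset Γ(X, U), (∀ f ∈ t, P f) ∧ ∀ q ∈ U, ∃ f ∈ t, q ∈ X.basicOpen f := by
  have : Ideal.span {f | P f} = ⊤ := by
    refine hU.self_le_iSup_basicOpen_iff.1 fun q hq => ?_
    obtain ⟨f, hqf, hf⟩ := H q hq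
    exact Opens.mem_iSup.2 ⟨⟨f, hf⟩, hqf⟩
  obtain ⟨t, ht, ht'⟩ := (Ideal.span_eq_top_iff_finite _).1 this
  refine ⟨t, fun f hf => ht hf, fun q hq => ?_⟩
  obtain ⟨⟨f, hf⟩, hqf⟩ := Opens.mem_iSup.1 (hU.self_le_iSup_basicOpen_iff.2 ht' hq)
  exact ⟨f, hf, hqf⟩

end AffineLocal

section Cyclic

variable {n : ℕ} {S Y : Scheme.{u}} {π : Y ⟶ S}
  {E : ExtPresentation (relativeDifferentials π) (structureModule Y)} {U : Y.Opens}
  {e : Γ(sheafExt (relativeDifferentials π) (structureModule Y) 1, U)} {x y z : Γ(Y, U)}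

lemma map_span_coordinates (n : ℕ) (x y z : Γ(Y, U)) {W : Y.Opens} (hW : W ≤ U) :
    (Ideal.span {x, y, z ^ n}).map (Y.presheaf.map (homOfLE hW).op).hom =
      Ideal.span {Y.presheaf.map (homOfLE hW).op x, Y.presheaf.map (homOfLE hW).op y,
        Y.presheaf.map (homOfLE hW).op z ^ n} := by
  rw [Ideal.map_span, Set.image_insert_eq, Set.image_pair, map_pow]

namespace IsDifferentialCoordinates

variable (h : IsDifferentialCoordinates n π U x y z)
include h

/-- On an affine open subset, the annihilator of the generator is the ideal `(x, y, z ^ n)`. -/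
lemma smul_eq_zero_iff (hn : IsUnit ((n + 1 : ℕ) : Γ(Y, U))) (he : IsGenerator E U x y z e)
    (hU : IsAffineOpen U) (g : Γ(Y, U)) : g • e = 0 ↔ g ∈ Ideal.span {x, y, z ^ n} := by
  constructor
  · intro hg
    refine mem_submodule_of_locally hU _ g fun q hq => ?_
    obtain ⟨W, hW, hqW, hgW⟩ := h.exists_mem_span he hg q hq
    obtain ⟨f, hf, hqf⟩ := exists_basicOpen_le hU hW hqW
    refine ⟨f, hqf, exists_pow_mul_mem hU f (hf.trans hW) rfl _ _ ?_⟩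
    have := Ideal.mem_map_of_mem (Y.presheaf.map (homOfLE hf).op).hom hgW
    rw [map_span_coordinates, structure_map_map hW hf, structure_map_map hW hf,
      structure_map_map hW hf] at this
    rw [map_span_coordinates]
    convert this using 1
    exact (structure_map_map hW hf g).symm
  · have : Ideal.span {x, y, z ^ n} ≤ LinearMap.ker (LinearMap.toSpanSingleton Γ(Y, U) _ e) := by
      rw [Ideal.span_le]
      rintro _ (rfl | rfl | rfl)
      · exact h.x_smul_eq_zero he
      · exact h.y_smul_eq_zero he
      · exact h.z_pow_smul_eq_zero hn he
    exact fun hg => this hg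

/-- A section which vanishes on the basic open subset of `f` is killed by a power of `f`, a property
which `ℰxt¹(Ω¹_{Y/S}, 𝒪_Y)` would have as a quasi-coherent sheaf and which follows here from the
description of the annihilator of the generator on affine open subsets. -/
lemma exists_pow_smul_eq_zero (hn : IsUnit ((n + 1 : ℕ) : Γ(Y, U))) (he : IsGenerator E U x y z e)
    (hU : IsAffineOpen U) (f : Γ(Y, U))
    (t : Γ(sheafExt (relativeDifferentials π) (structureModule Y) 1, U))
    (ht : (sheafExt (relativeDifferentials π) (structureModule Y) 1).presheaf.map
      (homOfLE (Y.basicOpen_le f)).op t = 0) : ∃ k : ℕ, f ^ k • t = 0 := by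
  obtain ⟨T, hT, hTU⟩ := exists_finset_basicOpen hU (fun f₁ => ∃ k : ℕ,
    Y.presheaf.map (homOfLE (Y.basicOpen_le f₁)).op (f ^ k) •
      (sheafExt (relativeDifferentials π) (structureModule Y) 1).presheaf.map
        (homOfLE (Y.basicOpen_le f₁)).op t = 0) fun q hq => by
    obtain ⟨W, hW, g, hqW, hg⟩ := h.exists_eq_smul he t q hq
    obtain ⟨f₁, hf₁, hqf₁⟩ := exists_basicOpen_le hU hW hqW
    refine ⟨f₁, hqf₁, ?_⟩
    have hg' := congr_arg ((sheafExt (relativeDifferentials π) (structureModule Y) 1).presheaf.map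
      (homOfLE hf₁).op) hg
    rw [Scheme.Modules.map_smul, map_map, map_map] at hg'
    have hV : Y.basicOpen f₁ ⊓ Y.basicOpen f =
        Y.basicOpen (Y.presheaf.map (homOfLE (Y.basicOpen_le f₁)).op f) :=
      (Y.basicOpen_res f (homOfLE (Y.basicOpen_le f₁)).op).symm
    have hV₁ : Y.basicOpen f₁ ⊓ Y.basicOpen f ≤ Y.basicOpen f₁ := inf_le_left
    have hV₂ : Y.basicOpen f₁ ⊓ Y.basicOpen f ≤ Y.basicOpen f := inf_le_right
    have hVU : Y.basicOpen f₁ ⊓ Y.basicOpen f ≤ U := hV₁.trans (Y.basicOpen_le f₁)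
    have hg'' := congr_arg ((sheafExt (relativeDifferentials π) (structureModule Y) 1).presheaf.map
      (homOfLE hV₁).op) hg'
    rw [Scheme.Modules.map_smul, map_map, map_map, ← map_map _ (Y.basicOpen_le f) hV₂, ht,
      map_zero] at hg''
    have hnV : IsUnit ((n + 1 : ℕ) : Γ(Y, Y.basicOpen f₁ ⊓ Y.basicOpen f)) := by
      simpa using hn.map (Y.presheaf.map (homOfLE hVU).op).hom
    have hn₁ : IsUnit ((n + 1 : ℕ) : Γ(Y, Y.basicOpen f₁)) := by
      simpa using hn.map (Y.presheaf.map (homOfLE (Y.basicOpen_le f₁)).op).hom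
    have hU₁ := hU.basicOpen f₁
    have := ((h.res hVU).smul_eq_zero_iff hnV (he.res hVU) (hV ▸ hU₁.basicOpen _) _).1 hg''.symm
    obtain ⟨k, hk⟩ := exists_pow_mul_mem hU₁
      (Y.presheaf.map (homOfLE (Y.basicOpen_le f₁)).op f) hV₁ hV
      (Ideal.span {Y.presheaf.map (homOfLE (Y.basicOpen_le f₁)).op x,
        Y.presheaf.map (homOfLE (Y.basicOpen_le f₁)).op y,
        Y.presheaf.map (homOfLE (Y.basicOpen_le f₁)).op z ^ n})
      (Y.presheaf.map (homOfLE hf₁).op g) (by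
          rw [map_span_coordinates, structure_map_map, structure_map_map, structure_map_map]
          exact this)
    refine ⟨k, ?_⟩
    rw [hg', smul_smul, map_pow]
    exact ((h.res _).smul_eq_zero_iff hn₁ (he.res _) hU₁ _).2 hk
  choose! k hk using hT
  refine ⟨T.sup k, eq_of_locally_eq _ fun q hq => ?_⟩
  obtain ⟨f₁, hf₁, hqf₁⟩ := hTU q hq
  refine ⟨_, Y.basicOpen_le f₁, hqf₁, ?_⟩
  rw [Scheme.Modules.map_smul, map_zero, ← Nat.sub_add_cancel (Finset.le_sup (f := k) hf₁),
    pow_add, map_mul, mul_smul, hk f₁ hf₁, smul_zero]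

/-- On an affine open subset, every section of `ℰxt¹(Ω¹_{Y/S}, 𝒪_Y)` is a multiple of the
generator. -/
lemma exists_smul_eq (hn : IsUnit ((n + 1 : ℕ) : Γ(Y, U))) (he : IsGenerator E U x y z e)
    (hU : IsAffineOpen U) (s : Γ(sheafExt (relativeDifferentials π) (structureModule Y) 1, U)) :
    ∃ g : Γ(Y, U), g • e = s := by
  rw [← Submodule.mem_span_singleton]
  refine mem_submodule_of_locally hU _ s fun q hq => ?_
  obtain ⟨W, hW, g, hqW, hg⟩ := h.exists_eq_smul he s q hq
  obtain ⟨f, hf, hqf⟩ := exists_basicOpen_le hU hW hqW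
  refine ⟨f, hqf, ?_⟩
  have hg' := congr_arg ((sheafExt (relativeDifferentials π) (structureModule Y) 1).presheaf.map
      (homOfLE hf).op) hg
  rw [Scheme.Modules.map_smul, map_map, map_map] at hg'
  obtain ⟨k, r, hr⟩ := exists_pow_mul_eq_map hU f (Y.presheaf.map (homOfLE hf).op g)
  obtain ⟨l, hl⟩ := h.exists_pow_smul_eq_zero hn he hU f (f ^ k • s - r • e) (by
    rw [map_sub, Scheme.Modules.map_smul, Scheme.Modules.map_smul, hg', smul_smul, hr, sub_self])
  refine ⟨l + k, Submodule.mem_span_singleton.2 ⟨f ^ l * r, ?_⟩⟩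
  rw [smul_sub, sub_eq_zero, smul_smul, smul_smul, ← pow_add] at hl
  exact hl.symm

end IsDifferentialCoordinates

/-- In a chart, the sections `e`, `z • e`, …, `z ^ (n - 1) • e` form a basis of
`Γ(π⁻¹V, ℰxt¹(Ω¹_{Y/S}, 𝒪_Y))` over `Γ(S, V)`. -/
lemma IsAnChart.bijective_sum {V : S.Opens} {x y z : Γ(Y, π ⁻¹ᵁ V)}
    {e : Γ(sheafExt (relativeDifferentials π) (structureModule Y) 1, π ⁻¹ᵁ V)}
    (h : IsAnChart n π V x y z) (hn : 1 ≤ n) (hn' : IsUnit ((n + 1 : ℕ) : Γ(Y, π ⁻¹ᵁ V)))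
    (he : IsGenerator E (π ⁻¹ᵁ V) x y z e) :
    Function.Bijective fun a : Fin n → Γ(S, V) => ∑ k, (π.app V (a k) * z ^ (k : ℕ)) • e := by
  have h' := h.isDifferentialCoordinates
  have hU := h.isAffineOpen_preimage
  constructor
  · intro a b hab
    rw [← sub_eq_zero]
    refine h.isAnAlgebra.eq_zero_of_mem_span (a - b) ((h'.smul_eq_zero_iff hn' he hU _).1 ?_)
    rw [Finset.sum_smul, ← sub_eq_zero.2 hab, ← Finset.sum_sub_distrib]
    refine Finset.sum_congr rfl fun k _ => ?_
    rw [← sub_smul, ← sub_mul, Pi.sub_apply, map_sub]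
  · intro s
    obtain ⟨g, rfl⟩ := h'.exists_smul_eq hn' he hU s
    obtain ⟨a, ha⟩ := h.isAnAlgebra.exists_sub_mem_span hn g
    refine ⟨a, ?_⟩
    have := (h'.smul_eq_zero_iff hn' he hU _).2 ha
    rw [sub_smul, sub_eq_zero, Finset.sum_smul] at this
    exact this.symm

end Cyclic

/-! ### Powers of trivializations of a line bundle -/

section TensorPower

variable {X : Scheme.{u}} {M N : X.Modules} {U : X.Opens}

/-- The values of a linear form, as functions. -/
def LocalHom.value (φ : LocalHom M (structureModule X) U) (V : X.Opens) (hV : V ≤ U) :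
    Γ(M, V) →ₗ[Γ(X, V)] Γ(X, V) :=
  φ.app V hV

lemma LocalHom.value_map (φ : LocalHom M (structureModule X) U) {V W : X.Opens} (hV : V ≤ U)
    (hW : W ≤ V) (m : Γ(M, V)) : φ.value W (hW.trans hV) (M.presheaf.map (homOfLE hW).op m) =
      X.presheaf.map (homOfLE hW).op (φ.value V hV m) :=
  φ.naturality hV hW m

lemma LocalHom.value_smul (a : Γ(X, U)) (φ : LocalHom M (structureModule X) U) {V : X.Opens}
    (hV : V ≤ U) (m : Γ(M, V)) :
    (a • φ).value V hV m = X.presheaf.map (homOfLE hV).op a * φ.value V hV m := rfl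

lemma LocalHom.ext_value {φ ψ : LocalHom M (structureModule X) U}
    (h : ∀ V hV m, φ.value V hV m = ψ.value V hV m) : φ = ψ :=
  LocalHom.ext (funext fun V => funext fun hV => LinearMap.ext (h V hV))

/-- A trivialization is determined by the section with value `1`, and every section is a multiple of
this one. -/
lemma LocalHom.IsIsomorphism.exists_value_eq_one {φ : LocalHom M (structureModule X) U}
    (hφ : φ.IsIsomorphism) : ∃ s : Γ(M, U), φ.value U le_rfl s = 1 ∧
      ∀ V (hV : V ≤ U) (t : Γ(M, V)), t = φ.value V hV t • M.presheaf.map (homOfLE hV).op s := by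
  obtain ⟨s, hs⟩ : ∃ s : Γ(M, U), φ.value U le_rfl s = 1 := (hφ U le_rfl).2 _
  refine ⟨s, hs, fun V hV t => ?_⟩
  have hinj : Function.Injective (φ.value V hV) := (hφ V hV).1
  refine hinj ?_
  rw [map_smul, φ.value_map le_rfl hV, hs, map_one, smul_eq_mul, mul_one]

/-- The product `m ⊗ n ↦ φ m * ψ n` of two linear forms. -/
def tensorValue (φ : LocalHom M (structureModule X) U) (ψ : LocalHom N (structureModule X) U)
    (V : X.Opens) (hV : V ≤ U) :
    TensorProduct Γ(X, V) Γ(M, V) Γ(N, V) →ₗ[Γ(X, V)] Γ(X, V) :=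
  (TensorProduct.lid Γ(X, V) Γ(X, V)).toLinearMap.comp
    (TensorProduct.map (φ.value V hV) (ψ.value V hV))

lemma tensorValue_tmul (φ : LocalHom M (structureModule X) U)
    (ψ : LocalHom N (structureModule X) U) (V : X.Opens) (hV : V ≤ U) (m : Γ(M, V)) (n : Γ(N, V)) :
    tensorValue φ ψ V hV (m ⊗ₜ n) = φ.value V hV m * ψ.value V hV n :=
  rfl

lemma bijective_tensorValue {φ : LocalHom M (structureModule X) U}
    {ψ : LocalHom N (structureModule X) U} (hφ : φ.IsIsomorphism) (hψ : ψ.IsIsomorphism)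
    (V : X.Opens) (hV : V ≤ U) : Function.Bijective (tensorValue φ ψ V hV) := by
  refine (TensorProduct.lid Γ(X, V) Γ(X, V)).bijective.comp ?_
  exact (TensorProduct.congr (LinearEquiv.ofBijective (φ.value V hV) (hφ V hV))
    (LinearEquiv.ofBijective (ψ.value V hV) (hψ V hV))).bijective

/-- The section `m ⊗ n` of `M ⊗ N`. -/
def tmulSection {V : X.Opens} (w : TensorProduct Γ(X, V) Γ(M, V) Γ(N, V)) :
    Γ(tensorObj M N, V) :=
  sheafifyUnit (PresheafOfModules.Monoidal.tensorObj (R := X.presheaf) M.val N.val) V w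

lemma exists_tensorHom (φ : LocalHom M (structureModule X) U)
    (ψ : LocalHom N (structureModule X) U) :
    ∃ θ : LocalHom (tensorObj M N) (structureModule X) U, ∀ V (hV : V ≤ U)
      (w : TensorProduct Γ(X, V) Γ(M, V) Γ(N, V)),
      θ.app V hV (tmulSection w) = tensorValue φ ψ V hV w := by
  refine exists_localHom_sheafify (G := structureModule X)
    (P := PresheafOfModules.Monoidal.tensorObj (R := X.presheaf) M.val N.val)
    (fun V hV => (tensorValue φ ψ V hV).toAddMonoidHom) (fun V hV r s => ?_)
    (fun V W hV hW s => ?_)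
  · exact (tensorValue φ ψ V hV).map_smul r s
  · induction s using TensorProduct.induction_on with
    | zero =>
      exact (map_zero (X.presheaf.map (homOfLE hW).op).hom).symm
    | tmul m n =>
      exact (congr_arg₂ (fun a b : Γ(X, W) => a * b) (φ.value_map hV hW m)
        (ψ.value_map hV hW n)).trans
          (map_mul (X.presheaf.map (homOfLE hW).op).hom (φ.value V hV m) (ψ.value V hV n)).symm
    | add a b ha hb =>
      refine (congr_arg (tensorValue φ ψ W (hW.trans hV)) (map_add
        ((PresheafOfModules.Monoidal.tensorObj (R := X.presheaf) M.val N.val).map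
          (homOfLE hW).op).hom a b)).trans ?_
      refine (map_add (tensorValue φ ψ W (hW.trans hV)) _ _).trans ?_
      refine (congr_arg₂ (fun a b : Γ(X, W) => a + b) ha hb).trans ?_
      refine (map_add (X.presheaf.map (homOfLE hW).op).hom (tensorValue φ ψ V hV a)
        (tensorValue φ ψ V hV b)).symm.trans ?_
      exact congr_arg _ (map_add (tensorValue φ ψ V hV) a b).symm

/-- The product of linear forms `φ` on `M|_U` and `ψ` on `N|_U`, a linear form on `M ⊗ N|_U`. -/
def tensorHom (φ : LocalHom M (structureModule X) U) (ψ : LocalHom N (structureModule X) U) :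
    LocalHom (tensorObj M N) (structureModule X) U :=
  (exists_tensorHom φ ψ).choose

lemma tensorHom_tmulSection (φ : LocalHom M (structureModule X) U)
    (ψ : LocalHom N (structureModule X) U) {V : X.Opens} (hV : V ≤ U)
    (w : TensorProduct Γ(X, V) Γ(M, V) Γ(N, V)) :
    (tensorHom φ ψ).app V hV (tmulSection w) = tensorValue φ ψ V hV w :=
  (exists_tensorHom φ ψ).choose_spec V hV w

lemma localHom_tensorObj_ext {G : X.Modules} {θ θ' : LocalHom (tensorObj M N) G U}
    (h : ∀ V (hV : V ≤ U) (w : TensorProduct Γ(X, V) Γ(M, V) Γ(N, V)),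
      θ.app V hV (tmulSection w) = θ'.app V hV (tmulSection w)) : θ = θ' :=
  localHom_sheafify_ext h

lemma isIsomorphism_tensorHom {φ : LocalHom M (structureModule X) U}
    {ψ : LocalHom N (structureModule X) U} (hφ : φ.IsIsomorphism) (hψ : ψ.IsIsomorphism) :
    (tensorHom φ ψ).IsIsomorphism := by
  refine fun V hV => ⟨(injective_iff_map_eq_zero _).2 fun s hs => ?_, fun r => ?_⟩
  · refine eq_of_locally_eq _ fun p hp => ?_
    obtain ⟨W, hW, hpW, w, hw⟩ := exists_sheafifyUnit_eq
      (PresheafOfModules.Monoidal.tensorObj (R := X.presheaf) M.val N.val) s p hp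
    refine ⟨W, hW, hpW, ?_⟩
    have h0 : tensorValue φ ψ W (hW.trans hV) w = 0 := by
      refine (tensorHom_tmulSection φ ψ (hW.trans hV) w).symm.trans ?_
      refine (congr_arg ((tensorHom φ ψ).app W _) hw).trans ?_
      refine ((tensorHom φ ψ).naturality hV hW s).trans ?_
      exact (congr_arg _ hs).trans (map_zero _)
    rw [map_zero]
    refine hw.symm.trans ?_
    have : w = 0 := (bijective_tensorValue hφ hψ W _).1 (h0.trans (map_zero _).symm)
    exact (congr_arg _ this).trans (map_zero _)
  · obtain ⟨w, hw⟩ := (bijective_tensorValue hφ hψ V hV).2 r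
    exact ⟨tmulSection w, (tensorHom_tmulSection φ ψ hV w).trans hw⟩

lemma res_tensorHom (φ : LocalHom M (structureModule X) U) (ψ : LocalHom N (structureModule X) U)
    {V : X.Opens} (hV : V ≤ U) :
    (tensorHom φ ψ).res hV = tensorHom (φ.res hV) (ψ.res hV) :=
  localHom_tensorObj_ext fun _ hW w => (tensorHom_tmulSection φ ψ (hW.trans hV) w).trans
    (tensorHom_tmulSection (φ.res hV) (ψ.res hV) hW w).symm

lemma tensorHom_smul (a b : Γ(X, U)) (φ : LocalHom M (structureModule X) U)
    (ψ : LocalHom N (structureModule X) U) :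
    tensorHom (a • φ) (b • ψ) = (a * b) • tensorHom φ ψ := by
  refine localHom_tensorObj_ext fun V hV w => ?_
  refine (tensorHom_tmulSection _ _ hV w).trans ?_
  refine Eq.trans ?_ (congr_arg (X.presheaf.map (homOfLE hV).op (a * b) * ·)
    (tensorHom_tmulSection φ ψ hV w).symm)
  induction w using TensorProduct.induction_on with
  | zero => rw [map_zero, map_zero, mul_zero]
  | tmul m n =>
    rw [tensorValue_tmul, tensorValue_tmul, LocalHom.value_smul, LocalHom.value_smul, map_mul]
    exact mul_mul_mul_comm (X.presheaf.map (homOfLE hV).op a) (φ.value V hV m) _ _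
  | add c d hc hd => rw [map_add, map_add, hc, hd, mul_add]

variable {L : X.Modules}

/-- The identity of the structure sheaf. -/
def idHom (X : Scheme.{u}) (U : X.Opens) :
    LocalHom (structureModule X) (structureModule X) U where
  app _ _ := LinearMap.id
  naturality _ _ _ := rfl

/-- The `j`-th power of a linear form on `L|_U`, a linear form on `L^{⊗ j}|_U`. -/
def powHom (φ : LocalHom L (structureModule X) U) :
    ∀ j : ℕ, LocalHom (tensorPow L j) (structureModule X) U
  | 0 => idHom X U
  | j + 1 => tensorHom (powHom φ j) φ

lemma isIsomorphism_powHom {φ : LocalHom L (structureModule X) U} (hφ : φ.IsIsomorphism) (j : ℕ) :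
    (powHom φ j).IsIsomorphism := by
  induction j with
  | zero => exact fun _ _ => Function.bijective_id
  | succ j ih => exact isIsomorphism_tensorHom ih hφ

lemma res_powHom (φ : LocalHom L (structureModule X) U) {V : X.Opens} (hV : V ≤ U) (j : ℕ) :
    (powHom φ j).res hV = powHom (φ.res hV) j := by
  induction j with
  | zero => rfl
  | succ j ih => exact (res_tensorHom _ _ hV).trans (congr_arg (tensorHom · _) ih)

lemma powHom_smul (a : Γ(X, U)) (φ : LocalHom L (structureModule X) U) (j : ℕ) :
    powHom (a • φ) j = a ^ j • powHom φ j := by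
  induction j with
  | zero => exact (pow_zero a ▸ one_smul _ _).symm
  | succ j ih =>
    rw [pow_succ]
    exact (congr_arg (tensorHom · _) ih).trans (tensorHom_smul _ _ _ _)

/-- Two trivializations differ by a unit. -/
lemma exists_isUnit_smul_eq {φ ψ : LocalHom L (structureModule X) U} (hφ : φ.IsIsomorphism)
    (hψ : ψ.IsIsomorphism) : ∃ a : Γ(X, U), IsUnit a ∧ ψ = a • φ := by
  obtain ⟨s, hs, hs'⟩ := hφ.exists_value_eq_one
  obtain ⟨t, ht, -⟩ := hψ.exists_value_eq_one
  have h : ψ = ψ.value U le_rfl s • φ := LocalHom.ext_value fun V hV m => by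
    rw [LocalHom.value_smul, ← ψ.value_map le_rfl hV, mul_comm, ← smul_eq_mul, ← map_smul, ← hs']
  refine ⟨_, IsUnit.of_mul_eq_one (φ.value U le_rfl t) ?_, h⟩
  rw [← ht]
  conv_rhs => rw [h, LocalHom.value_smul, structure_map_self]

end TensorPower

/-! ### Linear coordinates on an `A_n`-bundle -/

section Atlas

variable {S Y : Scheme.{u}}

/-- An `𝒪_S`-linear map `L^∨ ⟶ π_* 𝒪_Y`: the functions on `Y` given by the linear forms on `L`. -/
structure LinearFunctions (π : Y ⟶ S) (L : S.Modules) where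
  /-- The function on `π⁻¹U` given by a linear form on `L|_U`. -/
  toFun {U : S.Opens} (φ : LocalHom L (structureModule S) U) : Γ(Y, π ⁻¹ᵁ U)
  toFun_smul {U : S.Opens} (a : Γ(S, U)) (φ : LocalHom L (structureModule S) U) :
    toFun (a • φ) = π.app U a * toFun φ
  toFun_res {U V : S.Opens} (h : V ≤ U) (φ : LocalHom L (structureModule S) U) :
    toFun (φ.res h) = Y.presheaf.map (homOfLE (π.preimage_mono h)).op (toFun φ)

/-- The linear functions on `Y ⊆ E` coming from a direct factor of the vector bundle `M` with total
space `E`. -/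
def TotalSpace.linearFunctions {M L : S.Modules} (T : TotalSpace M) (ι : Y ⟶ T.E) (p : M ⟶ L) :
    LinearFunctions (ι ≫ T.proj) L where
  toFun {U} φ := ι.app (T.proj ⁻¹ᵁ U) (T.linearFunction (φ.precomp p))
  toFun_smul {U} a φ := by
    have h1 : (a • φ).precomp p = a • φ.precomp p := rfl
    have h2 : T.linearFunction (a • φ.precomp p) =
        T.proj.app U a * T.linearFunction (φ.precomp p) := T.lin.app_smul a (φ.precomp p)
    rw [h1, h2, map_mul, Scheme.Hom.comp_app]
    rfl
  toFun_res {U V} h φ := by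
    have h1 : (φ.res h).precomp p = (φ.precomp p).res h := rfl
    have h2 : T.linearFunction ((φ.precomp p).res h) =
        T.E.presheaf.map (homOfLE (T.proj.preimage_mono h)).op
          (T.linearFunction (φ.precomp p)) := hom_app_res T.lin h (φ.precomp p)
    rw [h1, h2]
    exact ConcreteCategory.congr_hom (ι.naturality (homOfLE (T.proj.preimage_mono h)).op) _

/-- Linear forms `x`, `y`, `z` which trivialize the three line bundles over `U` and whose associated
functions form a chart of `Y`. -/
structure IsLinearChart (n : ℕ) {π : Y ⟶ S} {Lx Ly Lz : S.Modules} (κx : LinearFunctions π Lx)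
    (κy : LinearFunctions π Ly) (κz : LinearFunctions π Lz) {U : S.Opens}
    (x : LocalHom Lx (structureModule S) U) (y : LocalHom Ly (structureModule S) U)
    (z : LocalHom Lz (structureModule S) U) : Prop where
  isIsomorphism_x : x.IsIsomorphism
  isIsomorphism_y : y.IsIsomorphism
  isIsomorphism_z : z.IsIsomorphism
  isAnChart : IsAnChart n π U (κx.toFun x) (κy.toFun y) (κz.toFun z)

/-- An isomorphism of `W` with the closed subscheme `x y = z ^ (n + 1)` of affine space, compatible
with the maps to affine space, gives a presentation of the ring of functions on `W`. -/
lemma isAnAlgebra_of_iso {Z : Scheme.{u}} (n : ℕ) {A : Type u} [CommRing A] (W : Z.Opens)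
    (ρ : A →+* Γ(Z, W)) (x y z : Γ(Z, W))
    (e : W.toScheme ≅ Spec (.of (MvPolynomial (Fin 3) A ⧸ anIdeal n A)))
    (he : e.hom ≫ anEmbedding n A = W.toSpecΓ ≫ Spec.map (CommRingCat.ofHom
      (MvPolynomial.eval₂Hom ρ ![x, y, z]))) :
    IsAffineOpen W ∧ IsAnAlgebra n ρ x y z := by
  have hW : IsAffineOpen W := IsAffine.of_isIso e.hom
  refine ⟨hW, ?_⟩
  let α := Spec.preimage (hW.isoSpec.inv ≫ e.hom)
  have hα : Function.Bijective α.hom := by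
    rw [← isIso_SpecMap_iff, Spec.map_preimage]
    infer_instance
  have key : CommRingCat.ofHom (Ideal.Quotient.mk (anIdeal n A)) ≫ α =
      CommRingCat.ofHom (MvPolynomial.eval₂Hom ρ ![x, y, z]) := by
    apply Spec.map_injective
    rw [Spec.map_comp, Spec.map_preimage, Category.assoc]
    refine (congr_arg (hW.isoSpec.inv ≫ ·) he).trans ?_
    exact hW.isoSpec_inv_toSpecΓ_assoc _
  have key' : MvPolynomial.eval₂Hom ρ ![x, y, z] =
      α.hom.comp (Ideal.Quotient.mk (anIdeal n A)) := congr_arg CommRingCat.Hom.hom key.symm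
  constructor
  · rw [key']
    exact hα.2.comp Ideal.Quotient.mk_surjective
  · rw [key', RingHom.ker_comp_of_injective _ hα.1, Ideal.mk_ker]

/-- The embedding of an `A_n`-bundle provides linear functions on it, and charts consisting of such
functions. -/
lemma IsAnBundle.exists_linearFunctions {n : ℕ} {π : Y ⟶ S} {Lx Ly Lz : S.Modules}
    (h : IsAnBundle n π Lx Ly Lz) :
    ∃ (κx : LinearFunctions π Lx) (κy : LinearFunctions π Ly) (κz : LinearFunctions π Lz),
      ∀ p : S, ∃ (U : S.Opens) (_ : p ∈ U) (x : LocalHom Lx (structureModule S) U)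
        (y : LocalHom Ly (structureModule S) U) (z : LocalHom Lz (structureModule S) U),
        IsLinearChart n κx κy κz x y z := by
  obtain ⟨T, ι, -, rfl, hT⟩ := h.exists_embedding
  refine ⟨T.linearFunctions ι biprod.fst, T.linearFunctions ι (biprod.snd ≫ biprod.fst),
    T.linearFunctions ι (biprod.snd ≫ biprod.snd), fun p => ?_⟩
  obtain ⟨U, hp, hU, x, y, z, hx, hy, hz, -, e, he⟩ := hT p
  have key : CommRingCat.ofHom (MvPolynomial.eval₂Hom (T.proj.app U).hom
      ![T.linearFunction (x.precomp biprod.fst),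
        T.linearFunction (y.precomp (biprod.snd ≫ biprod.fst)),
        T.linearFunction (z.precomp (biprod.snd ≫ biprod.snd))]) ≫ ι.app (T.proj ⁻¹ᵁ U) =
      CommRingCat.ofHom (MvPolynomial.eval₂Hom ((ι ≫ T.proj).app U).hom
        ![(T.linearFunctions ι biprod.fst).toFun x,
          (T.linearFunctions ι (biprod.snd ≫ biprod.fst)).toFun y,
          (T.linearFunctions ι (biprod.snd ≫ biprod.snd)).toFun z]) := by
    refine CommRingCat.hom_ext (MvPolynomial.ringHom_ext (fun a => ?_) fun i => ?_)
    · refine (congr_arg (ι.app (T.proj ⁻¹ᵁ U)).hom (MvPolynomial.eval₂Hom_C _ _ a)).trans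
        (Eq.trans ?_ (MvPolynomial.eval₂Hom_C _ _ a).symm)
      rw [Scheme.Hom.comp_app]
      rfl
    · refine (congr_arg (ι.app (T.proj ⁻¹ᵁ U)).hom (MvPolynomial.eval₂Hom_X' _ _ i)).trans
        (Eq.trans ?_ (MvPolynomial.eval₂Hom_X' _ _ i).symm)
      fin_cases i <;> rfl
  obtain ⟨h₁, h₂⟩ := isAnAlgebra_of_iso n ((ι ≫ T.proj) ⁻¹ᵁ U) ((ι ≫ T.proj).app U).hom _ _ _
      e <| by
    refine he.trans (Eq.trans ?_ (congr_arg (fun k => (ι ⁻¹ᵁ T.proj ⁻¹ᵁ U).toSpecΓ ≫ Spec.map k)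
      key))
    rw [Spec.map_comp]
    exact (Scheme.Opens.toSpecΓ_naturality_assoc ι (T.proj ⁻¹ᵁ U) _).symm
  exact ⟨U, hp, x, y, z, hx, hy, hz, hU, h₁, h₂⟩

variable {n : ℕ} {π : Y ⟶ S} {Lx Ly Lz : S.Modules} {κx : LinearFunctions π Lx}
  {κy : LinearFunctions π Ly} {κz : LinearFunctions π Lz} {U : S.Opens}

namespace IsLinearChart

lemma basicOpen {x : LocalHom Lx (structureModule S) U} {y : LocalHom Ly (structureModule S) U}
    {z : LocalHom Lz (structureModule S) U} (h : IsLinearChart n κx κy κz x y z) (a : Γ(S, U)) :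
    IsLinearChart n κx κy κz (x.res (S.basicOpen_le a)) (y.res (S.basicOpen_le a))
      (z.res (S.basicOpen_le a)) where
  isIsomorphism_x V hV := h.isIsomorphism_x V (hV.trans (S.basicOpen_le a))
  isIsomorphism_y V hV := h.isIsomorphism_y V (hV.trans (S.basicOpen_le a))
  isIsomorphism_z V hV := h.isIsomorphism_z V (hV.trans (S.basicOpen_le a))
  isAnChart := by
    rw [κx.toFun_res, κy.toFun_res, κz.toFun_res]
    exact h.isAnChart.basicOpen a

end IsLinearChart

lemma relD_app_self (a : Γ(S, U)) : relD π (π ⁻¹ᵁ U) (π.app U a) = 0 := by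
  have := relD_app π (le_refl (π ⁻¹ᵁ U)) a
  rwa [structure_map_self] at this

variable (n κx κy κz) in
/-- The properties of a chart which are preserved by restriction to arbitrary open subsets. -/
structure IsLinearCoordinates (x : LocalHom Lx (structureModule S) U)
    (y : LocalHom Ly (structureModule S) U) (z : LocalHom Lz (structureModule S) U) : Prop where
  isIsomorphism_x : x.IsIsomorphism
  isIsomorphism_y : y.IsIsomorphism
  isIsomorphism_z : z.IsIsomorphism
  isDifferentialCoordinates :
    IsDifferentialCoordinates n π (π ⁻¹ᵁ U) (κx.toFun x) (κy.toFun y) (κz.toFun z)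
  eq_zero_of_mul_pow (V : S.Opens) (h : V ≤ U) (a : Γ(S, V))
    (ha : π.app V a * κz.toFun (z.res h) ^ (n + 1) = 0) : a = 0

variable {x x' : LocalHom Lx (structureModule S) U} {y y' : LocalHom Ly (structureModule S) U}
  {z z' : LocalHom Lz (structureModule S) U}

lemma IsLinearChart.isLinearCoordinates (h : IsLinearChart n κx κy κz x y z) :
    IsLinearCoordinates n κx κy κz x y z where
  isIsomorphism_x := h.isIsomorphism_x
  isIsomorphism_y := h.isIsomorphism_y
  isIsomorphism_z := h.isIsomorphism_z
  isDifferentialCoordinates := h.isAnChart.isDifferentialCoordinates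
  eq_zero_of_mul_pow V hV a ha := by
    refine eq_of_locally_eq (structureModule S) (s := a) (t := 0) fun p hp => ?_
    obtain ⟨f, hf, hpf⟩ := exists_basicOpen_le h.isAnChart.isAffineOpen hV hp
    refine ⟨_, hf, hpf, ?_⟩
    rw [map_zero]
    refine (h.basicOpen f).isAnChart.isAnAlgebra.eq_zero_of_mul_pow
      (S.presheaf.map (homOfLE hf).op a) ?_
    have h1 := congr_arg (Y.presheaf.map (homOfLE (π.preimage_mono hf)).op) ha
    rw [map_mul, map_pow, map_zero, ← app_res, ← κz.toFun_res hf] at h1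
    exact h1

namespace IsLinearCoordinates

lemma res (h : IsLinearCoordinates n κx κy κz x y z) {V : S.Opens} (hV : V ≤ U) :
    IsLinearCoordinates n κx κy κz (x.res hV) (y.res hV) (z.res hV) where
  isIsomorphism_x W hW := h.isIsomorphism_x W (hW.trans hV)
  isIsomorphism_y W hW := h.isIsomorphism_y W (hW.trans hV)
  isIsomorphism_z W hW := h.isIsomorphism_z W (hW.trans hV)
  isDifferentialCoordinates := by
    rw [κx.toFun_res, κy.toFun_res, κz.toFun_res]
    exact h.isDifferentialCoordinates.res _
  eq_zero_of_mul_pow W hW := h.eq_zero_of_mul_pow W (hW.trans hV)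

/-- Two systems of coordinates on the same open subset differ by units `a`, `b`, `c` with
`a b = c ^ (n + 1)`. -/
lemma exists_units (h : IsLinearCoordinates n κx κy κz x y z)
    (h' : IsLinearCoordinates n κx κy κz x' y' z') :
    ∃ a b c : Γ(S, U), IsUnit b ∧ IsUnit c ∧ a * b = c ^ (n + 1) ∧
      x' = a • x ∧ y' = b • y ∧ z' = c • z := by
  obtain ⟨a, -, ha⟩ := exists_isUnit_smul_eq h.isIsomorphism_x h'.isIsomorphism_x
  obtain ⟨b, hb, hb'⟩ := exists_isUnit_smul_eq h.isIsomorphism_y h'.isIsomorphism_y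
  obtain ⟨c, hc, hc'⟩ := exists_isUnit_smul_eq h.isIsomorphism_z h'.isIsomorphism_z
  refine ⟨a, b, c, hb, hc, ?_, ha, hb', hc'⟩
  have h₁ := h.isDifferentialCoordinates.rel
  have h₂ := h'.isDifferentialCoordinates.rel
  rw [ha, hb', hc', κx.toFun_smul, κy.toFun_smul, κz.toFun_smul] at h₂
  rw [← sub_eq_zero]
  refine h.eq_zero_of_mul_pow U le_rfl _ ?_
  rw [map_sub, map_mul, map_pow, κz.toFun_res, structure_map_self]
  linear_combination h₂ - π.app U a * π.app U b * h₁

end IsLinearCoordinates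

end Atlas

/-! ### The comparison morphism -/

section Morphisms

variable {X : Scheme.{u}} {F G : X.Modules}

lemma exists_hom_of_app (φ : ∀ V : X.Opens, Γ(F, V) →+ Γ(G, V))
    (φ_smul : ∀ V (r : Γ(X, V)) s, φ V (r • s) = r • φ V s)
    (φ_map : ∀ V W (hW : W ≤ V) s, φ W (F.presheaf.map (homOfLE hW).op s) =
      G.presheaf.map (homOfLE hW).op (φ V s)) :
    ∃ f : F ⟶ G, ∀ V s, f.app V s = φ V s :=
  ⟨⟨PresheafOfModules.homMk
    { app U := AddCommGrpCat.ofHom (φ U.unop)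
      naturality U V i := by
        ext s
        exact φ_map U.unop V.unop i.unop.le s } fun U r s => φ_smul U.unop r s⟩, fun _ _ => rfl⟩

/-- A morphism of sheaves which is bijective on sections over arbitrarily small open subsets is an
isomorphism. -/
lemma isIso_of_locally_bijective (f : F ⟶ G)
    (h : ∀ (V : X.Opens), ∀ p ∈ V, ∃ W ≤ V, p ∈ W ∧ Function.Bijective (f.app W)) : IsIso f := by
  have inj (V : X.Opens) (s t : Γ(F, V)) (hst : f.app V s = f.app V t) : s = t := by
    refine eq_of_locally_eq F fun p hp => ?_
    obtain ⟨W, hW, hpW, hf⟩ := h V p hp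
    exact ⟨W, hW, hpW, hf.1 (by rw [hom_app_res, hom_app_res, hst])⟩
  refine Scheme.Modules.Hom.isIso_iff_isIso_app.2 fun V => ?_
  rw [ConcreteCategory.isIso_iff_bijective]
  refine ⟨inj V, fun t => ?_⟩
  have (p : V) : ∃ (W : X.Opens) (hW : W ≤ V) (_ : p.1 ∈ W) (s : Γ(F, W)),
      f.app W s = G.presheaf.map (homOfLE hW).op t := by
    obtain ⟨W, hW, hpW, hf⟩ := h V p p.2
    obtain ⟨s, hs⟩ := hf.2 (G.presheaf.map (homOfLE hW).op t)
    exact ⟨W, hW, hpW, s, hs⟩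
  choose W hW hp s hs using this
  obtain ⟨s', hs'⟩ := exists_glue_sections F W hW hp s fun p q => inj _ _ _ (by
    rw [hom_app_res, hom_app_res, hs, hs, map_map, map_map])
  refine ⟨s', eq_of_locally_eq G fun p hpV => ⟨W ⟨p, hpV⟩, hW _, hp _, ?_⟩⟩
  rw [← hom_app_res, hs', hs]

lemma sum_app {ι : Type*} (T : Finset ι) (f : ι → (F ⟶ G)) (V : X.Opens) (s : Γ(F, V)) :
    (∑ i ∈ T, f i).app V s = ∑ i ∈ T, (f i).app V s := by
  classical
  induction T using Finset.induction_on with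
  | empty => rfl
  | insert a T ha ih =>
    rw [Finset.sum_insert ha, Finset.sum_insert ha, ← ih]
    rfl

variable {ι : Type} [Fintype ι] (M : ι → X.Modules)

lemma biproduct_desc_app (f : ∀ j, M j ⟶ G) (V : X.Opens) (s : Γ(⨁ M, V)) :
    (biproduct.desc f).app V s = ∑ j, (f j).app V ((biproduct.π M j).app V s) := by
  classical
  rw [biproduct.desc_eq, sum_app]
  rfl

/-- The sections of a finite direct sum are the families of sections. -/
lemma bijective_biproduct_π_app (V : X.Opens) :
    Function.Bijective fun (s : Γ(⨁ M, V)) (j : ι) => (biproduct.π M j).app V s := by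
  classical
  constructor
  · intro s t hst
    have key (s : Γ(⨁ M, V)) :
        s = ∑ j, (biproduct.ι M j).app V ((biproduct.π M j).app V s) := by
      refine Eq.trans ?_ (sum_app Finset.univ (fun j => biproduct.π M j ≫ biproduct.ι M j) V s)
      rw [biproduct.total]
      rfl
    rw [key s, key t]
    exact Finset.sum_congr rfl fun j _ => congr_arg _ (congr_fun hst j)
  · intro t
    refine ⟨∑ j, (biproduct.ι M j).app V (t j), funext fun j => ?_⟩
    refine (map_sum ((biproduct.π M j).app V).hom _ _).trans ?_
    rw [Finset.sum_eq_single j]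
    · exact ConcreteCategory.congr_hom
        (congr_arg (fun k => Scheme.Modules.Hom.app k V) (biproduct.ι_π_self M j)) _
    · intro i _ hij
      exact ConcreteCategory.congr_hom
        (congr_arg (fun k => Scheme.Modules.Hom.app k V) (biproduct.ι_π_ne M hij)) _
    · exact fun h => (h (Finset.mem_univ j)).elim

end Morphisms

section Glue

variable {S Y : Scheme.{u}} {n : ℕ} {π : Y ⟶ S} {Lx Ly Lz : S.Modules} {κx : LinearFunctions π Lx}
  {κy : LinearFunctions π Ly} {κz : LinearFunctions π Lz} {U : S.Opens}
  {E : ExtPresentation (relativeDifferentials π) (structureModule Y)}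

/-- The map `s ↦ z ^ {⊗ j}(s) z ^ m e` from sections of `L_z^{⊗ j}` to sections of
`ℰxt¹(Ω¹_{Y/S}, 𝒪_Y)`, where the linear form `z` is used as a trivialization of `L_z` in the first
factor and as a function on `Y` in the second. -/
def monomialClass (κz : LinearFunctions π Lz) (j m : ℕ) (z : LocalHom Lz (structureModule S) U)
    (e : Γ(sheafExt (relativeDifferentials π) (structureModule Y) 1, π ⁻¹ᵁ U)) :
    Γ(tensorPow Lz j, U) →+
      Γ(sheafExt (relativeDifferentials π) (structureModule Y) 1, π ⁻¹ᵁ U) where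
  toFun s := (π.app U ((powHom z j).value U le_rfl s) * κz.toFun z ^ m) • e
  map_zero' := by rw [map_zero, map_zero, zero_mul, zero_smul]
  map_add' s t := by rw [map_add, map_add, add_mul, add_smul]

lemma monomialClass_apply (j m : ℕ) (z : LocalHom Lz (structureModule S) U)
    (e : Γ(sheafExt (relativeDifferentials π) (structureModule Y) 1, π ⁻¹ᵁ U))
    (s : Γ(tensorPow Lz j, U)) : monomialClass κz j m z e s =
      (π.app U ((powHom z j).value U le_rfl s) * κz.toFun z ^ m) • e := rfl

lemma monomialClass_res (j m : ℕ) (z : LocalHom Lz (structureModule S) U)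
    (e : Γ(sheafExt (relativeDifferentials π) (structureModule Y) 1, π ⁻¹ᵁ U))
    (s : Γ(tensorPow Lz j, U)) {V : S.Opens} (hV : V ≤ U) :
    monomialClass κz j m (z.res hV) ((sheafExt (relativeDifferentials π) (structureModule Y)
      1).presheaf.map (homOfLE (π.preimage_mono hV)).op e)
      ((tensorPow Lz j).presheaf.map (homOfLE hV).op s) =
      (sheafExt (relativeDifferentials π) (structureModule Y) 1).presheaf.map
        (homOfLE (π.preimage_mono hV)).op (monomialClass κz j m z e s) := by
  rw [monomialClass_apply, monomialClass_apply, Scheme.Modules.map_smul, map_mul, map_pow,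
    ← κz.toFun_res hV, ← app_res π hV, ← res_powHom, ← (powHom z j).value_map le_rfl hV]
  rfl

variable {x x' : LocalHom Lx (structureModule S) U} {y y' : LocalHom Ly (structureModule S) U}
  {z z' : LocalHom Lz (structureModule S) U}

/-- The map `s ↦ z ^ {⊗ j}(s) z ^ (n + 1 - j) e` does not depend on the chart: if
`z` is replaced by `c z`, the first factor is multiplied by `c ^ j`, the second by `c ^ (n + 1 - j)`
and the generator `e` by `c ^ (-(n + 1))`. -/
lemma monomialClass_eq (h : IsLinearCoordinates n κx κy κz x y z)
    (h' : IsLinearCoordinates n κx κy κz x' y' z')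
    {e e' : Γ(sheafExt (relativeDifferentials π) (structureModule Y) 1, π ⁻¹ᵁ U)}
    (he : IsGenerator E (π ⁻¹ᵁ U) (κx.toFun x) (κy.toFun y) (κz.toFun z) e)
    (he' : IsGenerator E (π ⁻¹ᵁ U) (κx.toFun x') (κy.toFun y') (κz.toFun z') e')
    {j m : ℕ} (hjm : j + m = n + 1) (s : Γ(tensorPow Lz j, U)) :
    monomialClass κz j m z e s = monomialClass κz j m z' e' s := by
  obtain ⟨a, b, c, hb, hc, habc, rfl, rfl, rfl⟩ := h.exists_units h'
  rw [κx.toFun_smul, κy.toFun_smul, κz.toFun_smul] at he'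
  have := h.isDifferentialCoordinates.generator_eq_smul
    (by rw [← map_mul, habc, map_pow]) (hb.map (π.app U).hom) (hc.map (π.app U).hom)
    (relD_app_self a) (relD_app_self b) (relD_app_self c) he he'
  rw [monomialClass_apply, monomialClass_apply, this, powHom_smul, κz.toFun_smul, smul_smul,
    LocalHom.value_smul, structure_map_self, map_mul, map_pow, mul_pow, ← hjm, pow_add]
  congr 1
  ring

/-- The morphism `L_z^{⊗ j} ⟶ π_* ℰxt¹(Ω¹_{Y/S}, 𝒪_Y)` given by `s ↦ z ^ {⊗ j}(s) z ^ (n + 1 - j) e`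
in every chart. -/
lemma exists_monomialHom
    (cover : ∀ p : S, ∃ (U : S.Opens) (_ : p ∈ U) (x : LocalHom Lx (structureModule S) U)
      (y : LocalHom Ly (structureModule S) U) (z : LocalHom Lz (structureModule S) U),
      IsLinearCoordinates n κx κy κz x y z) {j m : ℕ} (hjm : j + m = n + 1) :
    ∃ f : tensorPow Lz j ⟶ (Scheme.Modules.pushforward π).obj
        (sheafExt (relativeDifferentials π) (structureModule Y) 1),
      ∀ (U : S.Opens) (x : LocalHom Lx (structureModule S) U)
        (y : LocalHom Ly (structureModule S) U) (z : LocalHom Lz (structureModule S) U),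
        IsLinearCoordinates n κx κy κz x y z → ∀ e,
          IsGenerator E (π ⁻¹ᵁ U) (κx.toFun x) (κy.toFun y) (κz.toFun z) e →
          ∀ s : Γ(tensorPow Lz j, U), f.app U s = monomialClass κz j m z e s := by
  have local_data (V : S.Opens) (p : S) (hp : p ∈ V) : ∃ (W : S.Opens) (_ : W ≤ V) (_ : p ∈ W)
      (x : LocalHom Lx (structureModule S) W) (y : LocalHom Ly (structureModule S) W)
      (z : LocalHom Lz (structureModule S) W)
      (e : Γ(sheafExt (relativeDifferentials π) (structureModule Y) 1, π ⁻¹ᵁ W)),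
      IsLinearCoordinates n κx κy κz x y z ∧
        IsGenerator E (π ⁻¹ᵁ W) (κx.toFun x) (κy.toFun y) (κz.toFun z) e := by
    obtain ⟨U, hpU, x, y, z, h⟩ := cover p
    have h' := h.res (inf_le_right : V ⊓ U ≤ U)
    obtain ⟨e, he⟩ := h'.isDifferentialCoordinates.exists_isGenerator E
    exact ⟨V ⊓ U, inf_le_left, ⟨hp, hpU⟩, _, _, _, e, h', he⟩
  let G := (Scheme.Modules.pushforward π).obj
    (sheafExt (relativeDifferentials π) (structureModule Y) 1)
  have res_monomialClass {U V : S.Opens} (hV : V ≤ U) {x : LocalHom Lx (structureModule S) U}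
      {y : LocalHom Ly (structureModule S) U} {z : LocalHom Lz (structureModule S) U}
      (h : IsLinearCoordinates n κx κy κz x y z)
      {e : Γ(sheafExt (relativeDifferentials π) (structureModule Y) 1, π ⁻¹ᵁ U)}
      (he : IsGenerator E (π ⁻¹ᵁ U) (κx.toFun x) (κy.toFun y) (κz.toFun z) e)
      {x' : LocalHom Lx (structureModule S) V}
      {y' : LocalHom Ly (structureModule S) V} {z' : LocalHom Lz (structureModule S) V}
      (h' : IsLinearCoordinates n κx κy κz x' y' z')
      {e' : Γ(sheafExt (relativeDifferentials π) (structureModule Y) 1, π ⁻¹ᵁ V)}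
      (he' : IsGenerator E (π ⁻¹ᵁ V) (κx.toFun x') (κy.toFun y') (κz.toFun z') e')
      (s : Γ(tensorPow Lz j, U)) :
      G.presheaf.map (homOfLE hV).op (monomialClass κz j m z e s) =
        monomialClass κz j m z' e' ((tensorPow Lz j).presheaf.map (homOfLE hV).op s) := by
    have he₁ := he.res (π.preimage_mono hV)
    rw [← κx.toFun_res hV, ← κy.toFun_res hV, ← κz.toFun_res hV] at he₁
    exact (monomialClass_res j m z e s hV).symm.trans
      (monomialClass_eq (h.res hV) h' he₁ he' hjm _)
  obtain ⟨φ, φ_map, hφ⟩ := exists_hom_of_rel (F := tensorPow Lz j) (G := G) ⊤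
    (fun V s t => ∀ (W : S.Opens) (hW : W ≤ V) (x : LocalHom Lx (structureModule S) W)
      (y : LocalHom Ly (structureModule S) W) (z : LocalHom Lz (structureModule S) W),
      IsLinearCoordinates n κx κy κz x y z → ∀ e,
        IsGenerator E (π ⁻¹ᵁ W) (κx.toFun x) (κy.toFun y) (κz.toFun z) e →
          G.presheaf.map (homOfLE hW).op t =
            monomialClass κz j m z e ((tensorPow Lz j).presheaf.map (homOfLE hW).op s))
    (fun V t _ ht => eq_of_locally_eq G fun p hp => by
      obtain ⟨W, hW, hpW, x, y, z, e, h, he⟩ := local_data V p hp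
      refine ⟨W, hW, hpW, (ht W hW x y z h e he).trans ?_⟩
      rw [map_zero, map_zero, map_zero]
      rfl)
    (fun V s t s' t' _ hs ht W hW x y z h e he => by
      rw [map_sub, map_sub, map_sub]
      exact congr_arg₂ (· - ·) (hs W hW x y z h e he) (ht W hW x y z h e he))
    (fun V W hW s t _ ht W' hW' x y z h e he => by
      rw [map_map, map_map]
      exact ht W' (hW'.trans hW) x y z h e he)
    (fun V s _ p hp => by
      obtain ⟨W, hW, hpW, x, y, z, e, h, he⟩ := local_data V p hp
      exact ⟨W, hW, hpW, monomialClass κz j m z e ((tensorPow Lz j).presheaf.map (homOfLE hW).op s),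
        fun W' hW' x' y' z' h' e' he' => res_monomialClass hW' h he h' he' _⟩)
  have φ_eq (U : S.Opens) (x : LocalHom Lx (structureModule S) U)
      (y : LocalHom Ly (structureModule S) U) (z : LocalHom Lz (structureModule S) U)
      (h : IsLinearCoordinates n κx κy κz x y z) (e)
      (he : IsGenerator E (π ⁻¹ᵁ U) (κx.toFun x) (κy.toFun y) (κz.toFun z) e)
      (s : Γ(tensorPow Lz j, U)) : φ U le_top s = monomialClass κz j m z e s :=
    hφ U le_top s _ fun W hW x' y' z' h' e' he' => res_monomialClass hW h he h' he' s
  obtain ⟨f, hf⟩ := exists_hom_of_app (fun V => φ V le_top) (fun V r s => by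
    refine eq_of_locally_eq G fun p hp => ?_
    obtain ⟨W, hW, hpW, x, y, z, e, h, he⟩ := local_data V p hp
    refine ⟨W, hW, hpW, ?_⟩
    rw [Scheme.Modules.map_smul, ← φ_map _ _ le_top, ← φ_map _ _ le_top, Scheme.Modules.map_smul,
      φ_eq W x y z h e he, φ_eq W x y z h e he, monomialClass_apply, map_smul, smul_eq_mul, map_mul,
      mul_assoc, mul_smul]
    rfl) (fun V W hW s => φ_map V W le_top hW s)
  exact ⟨f, fun U x y z h e he s => (hf U s).trans (φ_eq U x y z h e he s)⟩

variable (E) in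
/-- In a chart, the classes of the monomials `z ^ (n + 1 - j) e`, for `2 ≤ j ≤ n + 1`, form a basis
of `ℰxt¹(Ω¹_{Y/S}, 𝒪_Y)`. -/
lemma bijective_sum_monomialClass (hn : 1 ≤ n) (hn' : ∀ W : Y.Opens, IsUnit ((n + 1 : ℕ) : Γ(Y, W)))
    (h : IsLinearChart n κx κy κz x y z)
    {e : Γ(sheafExt (relativeDifferentials π) (structureModule Y) 1, π ⁻¹ᵁ U)}
    (he : IsGenerator E (π ⁻¹ᵁ U) (κx.toFun x) (κy.toFun y) (κz.toFun z) e) :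
    Function.Bijective fun s : ∀ j : Finset.Icc 2 (n + 1), Γ(tensorPow Lz j, U) =>
      ∑ j : Finset.Icc 2 (n + 1), monomialClass κz j (n + 1 - j) z e (s j) := by
  -- The exponent `k = n + 1 - j` runs from `0` to `n - 1`.
  let idx : Fin n ≃ Finset.Icc 2 (n + 1) :=
    { toFun k := ⟨n + 1 - k, Finset.mem_Icc.2 ⟨by omega, by omega⟩⟩
      invFun j := ⟨n + 1 - j, by have := Finset.mem_Icc.1 j.2; omega⟩
      left_inv k := by ext; simp; omega
      right_inv j := by have := Finset.mem_Icc.1 j.2; ext; simp; omega }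
  have hb := h.isAnChart.bijective_sum hn (hn' _) he
  let v (s : ∀ j : Finset.Icc 2 (n + 1), Γ(tensorPow Lz j, U)) (k : Fin n) : Γ(S, U) :=
    (powHom z (idx k)).value U le_rfl (s (idx k))
  have hv : Function.Bijective v := by
    have hz (j : Finset.Icc 2 (n + 1)) : Function.Bijective ((powHom z j).value U le_rfl) :=
      isIsomorphism_powHom h.isIsomorphism_z j U le_rfl
    constructor
    · intro s t hst
      funext j
      obtain ⟨k, rfl⟩ := idx.surjective j
      exact (hz _).1 (congr_fun hst k)
    · intro a
      choose s hs using fun j => (hz j).2 (a (idx.symm j))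
      refine ⟨s, funext fun k => (hs (idx k)).trans ?_⟩
      rw [idx.symm_apply_apply]
  convert hb.comp hv using 2 with s
  rw [← idx.sum_comp]
  refine Finset.sum_congr rfl fun k _ => ?_
  rw [monomialClass_apply]
  congr 3
  change n + 1 - (n + 1 - (k : ℕ)) = k
  omega

end Glue

lemma isUnit_natCast_of_hom {S Y : Scheme.{u}} (π : Y ⟶ S)
    (s : S ⟶ Spec (CommRingCat.of (ULift.{u} ℂ))) (n : ℕ) (W : Y.Opens) :
    IsUnit ((n + 1 : ℕ) : Γ(Y, W)) := by
  let f : CommRingCat.of (ULift.{u} ℂ) ⟶ Γ(Y, W) := (Scheme.ΓSpecIso _).inv ≫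
    (π ≫ s).appTop ≫ Y.presheaf.map (homOfLE le_top).op
  have h : IsUnit ((n + 1 : ℕ) : ULift.{u} ℂ) := by
    have h0 : IsUnit ((n + 1 : ℕ) : ℂ) := (Nat.cast_ne_zero.2 n.succ_ne_zero).isUnit
    simpa using h0.map (ULift.ringEquiv (R := ℂ)).symm
  simpa using h.map f.hom

end AnBundle

theorem proposition2p3 (n : ℕ) (hn : 1 ≤ n)
    {S Y : Scheme.{u}}
    (sS : S ⟶ Spec (CommRingCat.of (ULift.{u} ℂ)))
    (π : Y ⟶ S) (Lx Ly Lz : S.Modules) (h : AnBundle.IsAnBundle n π Lx Ly Lz) :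
    Nonempty ((Scheme.Modules.pushforward π).obj
        (AnBundle.sheafExt (AnBundle.relativeDifferentials π) (AnBundle.structureModule Y) 1) ≅
      ⨁ fun j : Finset.Icc 2 (n + 1) => AnBundle.tensorPow Lz j) := by
  open AnBundle in
  obtain ⟨κx, κy, κz, cover⟩ := h.exists_linearFunctions
  obtain ⟨E⟩ := nonempty_extPresentation (relativeDifferentials π) (structureModule Y)
  choose f hf using fun j : Finset.Icc 2 (n + 1) => exists_monomialHom (E := E) (n := n)
    (κx := κx) (κy := κy) (κz := κz) (fun p => by
      obtain ⟨U, hp, x, y, z, h⟩ := cover p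
      exact ⟨U, hp, x, y, z, h.isLinearCoordinates⟩)
    (Nat.add_sub_cancel' (Finset.mem_Icc.1 j.2).2)
  have : IsIso (biproduct.desc f) := isIso_of_locally_bijective _ fun V p hp => by
    obtain ⟨U, hpU, x, y, z, h⟩ := cover p
    obtain ⟨a, ha, hpa⟩ := exists_basicOpen_le h.isAnChart.isAffineOpen
      (V := V ⊓ U) inf_le_right ⟨hp, hpU⟩
    refine ⟨_, ha.trans inf_le_left, hpa, ?_⟩
    have h' := h.basicOpen a
    obtain ⟨e, he⟩ := h'.isLinearCoordinates.isDifferentialCoordinates.exists_isGenerator E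
    refine Eq.mp (congr_arg Function.Bijective (funext fun s => Eq.symm ?_))
      ((bijective_sum_monomialClass E hn (isUnit_natCast_of_hom π sS n) h' he).comp
        (bijective_biproduct_π_app _ _))
    refine (biproduct_desc_app _ f _ s).trans (Finset.sum_congr rfl fun j _ => ?_)
    exact hf j _ _ _ _ h'.isLinearCoordinates e he _
  exact ⟨(asIso (biproduct.desc f)).symm⟩

end
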